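/- Let $G=(V,E)$ be a connected, locally finite, non-oriented graph without loops or multiple edges and with at least two vertices, let $(a_e)_{e\in E}$ be positive weights, and let $i_0\in V$. All processes below start at $i_0$. Definitions. For positive weights $W=(W_e)_{e\in E}$, the vertex-reinforced jump process (VRJP) with weights $W$ is the jump process $(Y_t)_{t\ge 0}$ on $V$ which, conditionally on its past at time $t$, jumps from its position $i$ to a neighbour $j$ at rate $W_{\{i,j\}}L_j(t)$, where $L_j(t)=1+\int_0^t \mathbf 1_{\{Y_s=j\}}\,ds$. Its time modification is $X^W_t=Y_{A^{-1}(t)}$, where $A(s)=\int_0^s \frac{du}{L_{Y_u}(u)}$, and its skeleton is the sequence of its successive positions. The edge-reinforced random walk (ERRW) $(X_n)_{n\ge 0}$ with weights $(a_e)$ satisfies $\mathbb P(X_{n+1}=j\mid X_0,\dots,X_n)=\mathbf 1_{\{j\sim X_n\}}Z_n(\{X_n,j\})/\sum_{k\sim X_n}Z_n(\{X_n,k\})$, where $Z_n(e)$ is $a_e$ plus the number of crossings of $e$ up to time $n$. The continuous-time ERRW $(\tilde X_t)_{t\ge 0}$ with weights $(a_e)$ is built from independent exponential variables $(\tau^e_k)_{e\in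 E,k\ge 0}$ of parameter $1$: put $V^e_k=\sum_{l=0}^{k-1}\frac{\tau^e_l}{a_e+l}$ for $k\ge 1$, let the clock of $e=\{i,j\}$ at time $t$ show the total time that $\tilde X$ has spent at $i$ and at $j$ up to time $t$, and let $\tilde X$ cross an edge $e$ adjacent to its position exactly when the clock of $e$ reaches one of the values $V^e_k$, $k\ge 1$. If the jump times of one of these continuous-time processes accumulate at a finite time, the process is sent to a cemetery state from that time on; in the time change $A$, the cemetery is treated like a vertex. Theorem. (i) For every continuous-time ERRW $(\tilde X_t)_{t\ge 0}$ with weights $(a_e)$ there are, on the same probability space, independent random variables $W_e\sim\mathrm{Gamma}(a_e,1)$, $e\in E$, such that, conditionally on $W=(W_e)_{e\in E}$, the process $(\tilde X_t)_{t\ge 0}$ has the law of the time modification $(X^W_t)_{t\ge 0}$ of the VRJP with weights $W$. (ii) The ERRW $(X_n)_{n\ge 0}$ with weights $(a_e)$ is equal in law to the skeleton of a VRJP in random conductances $W_e$, $e\in E$, that are independent and $\mathrm{Gamma}(a_e,1)$-distributed. -/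

import Mathlib

open MeasureTheory ProbabilityTheory

open scoped NNReal

noncomputable section

/-- The state space of the continuous-time processes is `Option V`: the value `none` is the cemetery
state, in which a process sits from its explosion time on. It is discrete, like `V`. -/
instance optionMeasurableSpace {V : Type*} : MeasurableSpace (Option V) := ⊤

/-! ### Edge weights and the discrete edge-reinforced random walk -/

open Classical in
/-- The weight of the edge between `i` and `j`; it is `0` if `i` and `j` are not neighbours. -/
def pairWeight {V : Type*} (G : SimpleGraph V) (w : G.edgeSet → ℝ) (i j : V) : ℝ :=
  if h : G.Adj i j then w ⟨s(i, j), (SimpleGraph.mem_edgeSet G).2 h⟩ else 0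

open Classical in
/-- The weight `Z_n(e)` of the edge `e` at time `n` along the trajectory `x`: the initial weight plus
the number of crossings of `e` up to time `n`. -/
def reinforcedWeight {V : Type*} (G : SimpleGraph V) (a : G.edgeSet → ℝ) (x : ℕ → V) (n : ℕ)
    (e : G.edgeSet) : ℝ :=
  a e + ∑ k ∈ Finset.range n, if s(x k, x (k + 1)) = (e : Sym2 V) then 1 else 0

/-- The σ-algebra of `X 0, …, X n`. -/
abbrev chainPast {Ω V : Type*} [MeasurableSpace V] (X : ℕ → Ω → V) (n : ℕ) : MeasurableSpace Ω :=
  MeasurableSpace.comap (fun ω (k : Fin (n + 1)) => X k ω) inferInstance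

/-- `X` is an edge-reinforced random walk with initial weights `a` and starting point `i₀`. -/
structure IsERRW {V : Type*} [MeasurableSpace V] (G : SimpleGraph V) [G.LocallyFinite]
    (a : G.edgeSet → ℝ) (i₀ : V) {Ω : Type*} [MeasurableSpace Ω] (P : Measure Ω)
    (X : ℕ → Ω → V) : Prop where
  measurable : ∀ n, Measurable (X n)
  start : ∀ᵐ ω ∂P, X 0 ω = i₀
  step : ∀ (n : ℕ) (j : V),
    P⟦{ω | X (n + 1) ω = j} | chainPast X n⟧ =ᵐ[P] fun ω =>
      pairWeight G (reinforcedWeight G a (fun k => X k ω) n) (X n ω) j /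
        ∑ k ∈ G.neighborFinset (X n ω),
          pairWeight G (reinforcedWeight G a (fun k => X k ω) n) (X n ω) k

/-! ### Jump paths and their local times -/

/-- The time of the `n`-th jump of a path with successive holding times `S 0, S 1, …`. -/
def jumpTime (S : ℕ → ℝ) (n : ℕ) : ℝ := ∑ k ∈ Finset.range n, S k

open Classical in
/-- The right-continuous path that visits `ξ 0, ξ 1, …` and stays at `ξ n` for the time `S n`. If the
jumps accumulate, the path is in the cemetery state from the explosion time on. -/
def jumpPath {V : Type*} (ξ : ℕ → V) (S : ℕ → ℝ) (t : ℝ) : Option V :=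
  if h : ∃ n, jumpTime S n ≤ t ∧ t < jumpTime S (n + 1) then some (ξ (Nat.find h)) else none

open Classical in
/-- The time spent by the path `y` in the state `x` up to time `t`. -/
def localTime {α : Type*} (y : ℝ → α) (x : α) (t : ℝ) : ℝ :=
  ∫ u in (0 : ℝ)..t, if y u = x then 1 else 0

/-! ### The vertex-reinforced jump process -/

/-- The σ-algebra of the first `n + 1` positions and the first `n` holding times, that is, the
information available at the time of the `n`-th jump. -/
abbrev jumpPast {Ω V : Type*} [MeasurableSpace V] (ξ : ℕ → Ω → V) (S : ℕ → Ω → ℝ) (n : ℕ) :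
    MeasurableSpace Ω :=
  MeasurableSpace.comap
    (fun ω => ((fun k : Fin (n + 1) => ξ k ω), (fun k : Fin n => S k ω))) inferInstance

/-- The rate `W_{ij} L_j`, with `L_j` equal to 1 plus the local time of `j`, at which the
vertex-reinforced jump process jumps to `j` from its current position `i = ξ n`, at the time of its
`n`-th jump. As the local times of the neighbours of `i` do not change while the process sits at `i`,
this is also the rate at every time until the next jump. -/
def vrjpRate {V : Type*} (G : SimpleGraph V) (w : G.edgeSet → ℝ) (ξ : ℕ → V) (S : ℕ → ℝ)
    (n : ℕ) (j : V) : ℝ :=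
  pairWeight G w (ξ n) j * (1 + localTime (jumpPath ξ S) (some j) (jumpTime S n))

/-- The sum of the rates to all neighbours of the current position. -/
def vrjpTotalRate {V : Type*} (G : SimpleGraph V) [G.LocallyFinite] (w : G.edgeSet → ℝ)
    (ξ : ℕ → V) (S : ℕ → ℝ) (n : ℕ) : ℝ :=
  ∑ j ∈ G.neighborFinset (ξ n), vrjpRate G w ξ S n j

/-- The process with successive positions `ξ` and successive holding times `S` is a vertex-reinforced
jump process with weights `w` started at `i₀`: conditionally on the past at the `n`-th jump time, it
jumps to `j` at the rate `vrjpRate G w ξ S n j`, which does not change before the next jump. Hence the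
holding time exceeds `s` and the next position is `j` with conditional probability
`(rate of j / total rate) * exp (- total rate * s)`. -/
structure IsVRJP {V : Type*} [MeasurableSpace V] (G : SimpleGraph V) [G.LocallyFinite]
    (w : G.edgeSet → ℝ) (i₀ : V) {Ω : Type*} [MeasurableSpace Ω] (P : Measure Ω)
    (ξ : ℕ → Ω → V) (S : ℕ → Ω → ℝ) : Prop where
  measurable_position : ∀ n, Measurable (ξ n)
  measurable_holding : ∀ n, Measurable (S n)
  start : ∀ᵐ ω ∂P, ξ 0 ω = i₀
  jump : ∀ (n : ℕ) (j : V) (s : ℝ), 0 ≤ s →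
    P⟦{ω | s < S n ω ∧ ξ (n + 1) ω = j} | jumpPast ξ S n⟧ =ᵐ[P] fun ω =>
      vrjpRate G w (fun k => ξ k ω) (fun k => S k ω) n j /
          vrjpTotalRate G w (fun k => ξ k ω) (fun k => S k ω) n *
        Real.exp (-(vrjpTotalRate G w (fun k => ξ k ω) (fun k => S k ω) n * s))

/-- `κ` is a measurable version of the law of the vertex-reinforced jump process started at `i₀`, as a
function of its weights: for all positive weights `w`, under the probability measure `κ w`, the
sequence of pairs (position, holding time) is that of a vertex-reinforced jump process with
weights `w`. -/
def IsVRJPKernel {V : Type*} [MeasurableSpace V] (G : SimpleGraph V) [G.LocallyFinite] (i₀ : V)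
    (κ : Kernel (G.edgeSet → ℝ) (ℕ → V × ℝ)) : Prop :=
  IsMarkovKernel κ ∧ ∀ w : G.edgeSet → ℝ, (∀ e, 0 < w e) →
    IsVRJP G w i₀ (κ w) (fun n z => (z n).1) (fun n z => (z n).2)

/-! ### The time change -/

/-- The additive functional `A(s) = ∫_0^s du / L_{y_u}(u)`, where `L_x(u)` is 1 plus the local time
at `x`. For paths that explode, the cemetery is treated like any other state, so that `A` is an
increasing bijection of the half-line also in this case. -/
def additiveFunctional {α : Type*} (y : ℝ → α) (s : ℝ) : ℝ :=
  ∫ u in (0 : ℝ)..s, 1 / (1 + localTime y (y u) u)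

/-- The time-changed path `t ↦ y (A⁻¹ t)`. -/
def timeChange {α : Type*} (y : ℝ → α) (t : ℝ) : α :=
  y (sInf {s : ℝ | 0 ≤ s ∧ t ≤ additiveFunctional y s})

/-- The time modification of the path with positions and holding times `z`. -/
def timeChangedPath {V : Type*} (z : ℕ → V × ℝ) (t : ℝ≥0) : Option V :=
  timeChange (jumpPath (fun n => (z n).1) (fun n => (z n).2)) t

/-! ### The continuous-time edge-reinforced random walk -/

/-- The `k`-th alarm time `V_k` of an edge with initial weight `b` and exponential variables `τ`. -/
def alarmTime (b : ℝ) (τ : ℕ → ℝ) (k : ℕ) : ℝ := ∑ l ∈ Finset.range k, 1 / (b + l) * τ l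

/-- The clock of the edge `{i, j}`: it runs while the path is at `i` or at `j`. -/
def edgeClock {V : Type*} (y : ℝ → Option V) (i j : V) (t : ℝ) : ℝ :=
  localTime y (some i) t + localTime y (some j) t

/-- The path with positions `ξ` and holding times `S` obeys the alarms `τ`: while it stays at a vertex,
no clock of an adjacent edge rings, and at the time of each jump the clock of the crossed edge does. -/
def FollowsAlarms {V : Type*} (G : SimpleGraph V) (a : G.edgeSet → ℝ) (τ : G.edgeSet → ℕ → ℝ)
    (ξ : ℕ → V) (S : ℕ → ℝ) : Prop :=
  ∀ n : ℕ, 0 < S n ∧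
    (∃ h : G.Adj (ξ n) (ξ (n + 1)), ∃ k : ℕ, 0 < k ∧
      edgeClock (jumpPath ξ S) (ξ n) (ξ (n + 1)) (jumpTime S (n + 1)) =
        alarmTime (a ⟨s(ξ n, ξ (n + 1)), (SimpleGraph.mem_edgeSet G).2 h⟩)
          (τ ⟨s(ξ n, ξ (n + 1)), (SimpleGraph.mem_edgeSet G).2 h⟩) k) ∧
    ∀ (j : V) (h : G.Adj (ξ n) j) (k : ℕ), 0 < k →
      ∀ t ∈ Set.Ioo (jumpTime S n) (jumpTime S (n + 1)),
        edgeClock (jumpPath ξ S) (ξ n) j t ≠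
          alarmTime (a ⟨s(ξ n, j), (SimpleGraph.mem_edgeSet G).2 h⟩)
            (τ ⟨s(ξ n, j), (SimpleGraph.mem_edgeSet G).2 h⟩) k

/-- The process with successive positions `ξ` and successive holding times `S` is the continuous-time
edge-reinforced random walk with weights `a`, started at `i₀` and driven by the independent standard
exponential variables `τ`. -/
structure IsContinuousTimeERRW {V : Type*} [MeasurableSpace V] (G : SimpleGraph V)
    (a : G.edgeSet → ℝ) (i₀ : V) {Ω : Type*} [MeasurableSpace Ω] (P : Measure Ω)
    (τ : G.edgeSet → ℕ → Ω → ℝ) (ξ : ℕ → Ω → V) (S : ℕ → Ω → ℝ) : Prop where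
  measurable_alarm : ∀ e k, Measurable (τ e k)
  indep_alarm : iIndepFun (fun (p : G.edgeSet × ℕ) => τ p.1 p.2) P
  law_alarm : ∀ e k, HasLaw (τ e k) (expMeasure 1) P
  measurable_position : ∀ n, Measurable (ξ n)
  measurable_holding : ∀ n, Measurable (S n)
  start : ∀ᵐ ω ∂P, ξ 0 ω = i₀
  dynamics : ∀ᵐ ω ∂P, FollowsAlarms G a (fun e k => τ e k ω) (fun n => ξ n ω) (fun n => S n ω)

/-! ### Gamma conductances -/

/-- The joint law of independent Gamma variables with shapes `a e` and rate `1`. -/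
def gammaConductances {E : Type*} (a : E → ℝ) : Measure (E → ℝ) :=
  Measure.infinitePi (fun e => gammaMeasure (a e) 1)

end

noncomputable section

open scoped ENNReal

/-! In the new time scale the VRJP has a simple description. If `l_i` is the local time at `i` in
that scale, then `L_i = exp l_i`, and the process crosses `e = {i, j}` from `i` at rate `W_e L_i L_j
= W_e exp (l_i + l_j)`. This rate depends only on the clock `T_e = l_i + l_j` of the edge. So each
edge rings at the points of a Poisson process with intensity `W_e exp T dT`, run along its own
clock. The continuous-time ERRW is driven in the same way by the alarms `V^e_k`, which are the jump
times of a pure birth process with rates `a_e, a_e + 1, …`.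

Kendall's theorem says that these are the same alarms: `W = lim n exp (-V_n)` is a Gamma variable of
shape `a`, and given `W` the points `W (exp V_k - 1)` form a standard Poisson process
(`map_poissonClocks`). It is proved backwards. Let `W` be Gamma, add independent exponential
variables one by one to get `W = W_0 < W_1 < …`, and form `(a + k) log (W_{k+1} / W_k)`. By
`lintegral_gamma_exp` the first of these is exponential and independent of `W_1`, which is Gamma of
shape `a + 1`. By induction all of them are independent exponential variables (`map_logIncrement`).
The law of large numbers recovers `W`, so the construction is almost surely invertible.

The laws and the alarms are linked by exponential races. Both processes are realised as a
`RaceScheme` on edges. By memorylessness the distances left after a race are fresh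
(`RaceScheme.map_run`), which gives the conditional law of each jump. Pathwise, the distance left on
an edge is a function of its clock and its next alarm, which shows that each walk obeys its alarms
(`IsEdgeRace.isAlarmRace_of_crossings`, `IsEdgeRace.isAlarmRace_of_occupation`). Alarms and starting
point determine the walk (`IsAlarmRace.unique`, `IsAlarmRace.eq_of_followsAlarms`), so walks driven
by the same alarms coincide. Finally `HasJumpLaw.unique` and `HasStepLaw.unique` identify the
realisations with arbitrary processes satisfying the definitions. As the coupling concerns sequences
of positions and holding times, explosion needs no separate treatment there. -/

instance isProbabilityMeasure_expMeasure_one : IsProbabilityMeasure (expMeasure 1) :=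
  isProbabilityMeasure_expMeasure one_pos

/-- The law of a family of independent standard exponential variables. -/
def expField (ι : Type*) : Measure (ι → ℝ) := Measure.infinitePi fun _ => expMeasure 1

instance isProbabilityMeasure_expField (ι : Type*) : IsProbabilityMeasure (expField ι) := by
  unfold expField; infer_instance

/-! ### Exponential variables and memorylessness -/

theorem lintegral_expMeasure_one {f : ℝ → ℝ≥0∞} (hf : Measurable f) :
    ∫⁻ x, f x ∂expMeasure 1 = ∫⁻ x in Set.Ioi 0, ENNReal.ofReal (Real.exp (-x)) * f x := by
  have h : expMeasure 1 = volume.withDensity (exponentialPDF 1) := rfl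
  have hm : Measurable (exponentialPDF 1) := (measurable_exponentialPDFReal 1).ennreal_ofReal
  rw [h, lintegral_withDensity_eq_lintegral_mul _ hm hf,
    ← lintegral_indicator measurableSet_Ioi, ← lintegral_add_compl _ (measurableSet_singleton 0),
    ← lintegral_add_compl (fun a => (Set.Ioi (0 : ℝ)).indicator _ a) (measurableSet_singleton 0)]
  simp only [Measure.restrict_singleton, Real.volume_singleton, zero_smul, lintegral_zero_measure,
    zero_add]
  refine setLIntegral_congr_fun (measurableSet_singleton 0).compl fun x hx => ?_
  have hx0 : x ≠ 0 := hx
  rcases lt_or_gt_of_ne hx0 with h | h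
  · simp [exponentialPDF_of_neg h, h.le]
  · simp [exponentialPDF_of_nonneg h.le, h]

theorem ae_pos_expMeasure_one : ∀ᵐ x ∂expMeasure 1, 0 < x := by
  rw [ae_iff, ← lintegral_indicator_one (by measurability),
    lintegral_expMeasure_one (by fun_prop (disch := measurability)),
    setLIntegral_congr_fun (g := 0) measurableSet_Ioi]
  · simp
  · intro x hx
    simp_all

/-- Memorylessness: translating the density `exp (-x)` by `t` multiplies it by `exp (-t)`. -/
theorem expMeasure_one_shift {t : ℝ} (ht : 0 ≤ t) {s : Set ℝ} (hs : MeasurableSet s) :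
    expMeasure 1 {x | t < x ∧ x - t ∈ s} = ENNReal.ofReal (Real.exp (-t)) * expMeasure 1 s := by
  have hs' : MeasurableSet {x : ℝ | t < x ∧ x - t ∈ s} :=
    (measurableSet_lt measurable_const measurable_id).inter
      ((measurable_id.sub_const t) hs)
  rw [← lintegral_indicator_one hs', ← lintegral_indicator_one hs,
    lintegral_expMeasure_one (measurable_one.indicator hs'),
    lintegral_expMeasure_one (measurable_one.indicator hs), ← lintegral_const_mul _ (by
      exact ((Real.measurable_exp.comp measurable_neg).ennreal_ofReal).mul
        (measurable_one.indicator hs)),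
    ← lintegral_indicator measurableSet_Ioi, ← lintegral_indicator measurableSet_Ioi,
    ← lintegral_add_right_eq_self (fun x => Set.indicator (Set.Ioi 0) _ x) t]
  refine lintegral_congr fun x => ?_
  by_cases hx : 0 < x
  · have hxt : 0 < x + t := by linarith
    by_cases hxs : x ∈ s
    · simp [hx, hxt, hxs, ← ENNReal.ofReal_mul (Real.exp_nonneg _), ← Real.exp_add]
    · simp [hx, hxt, hxs]
  · by_cases hxt : 0 < x + t <;> simp [hx, hxt]

/-- Memorylessness in finitely many coordinates at once; the coordinates outside `F` are left alone
because `t` vanishes there. -/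
theorem expField_map_shift {ι : Type*} (F : Finset ι) (t : ι → ℝ) (h0 : ∀ i, 0 ≤ t i)
    (hF : ∀ i, i ∉ F → t i = 0) :
    ((expField ι).restrict {σ | ∀ i ∈ F, t i < σ i}).map (fun σ i => σ i - t i) =
      ENNReal.ofReal (Real.exp (-∑ i ∈ F, t i)) • expField ι := by
  classical
  have hset : MeasurableSet {σ : ι → ℝ | ∀ i ∈ F, t i < σ i} := by
    simp only [Set.ofPred_forall]
    exact Finset.measurableSet_biInter F fun i _ =>
      measurableSet_lt measurable_const (measurable_pi_apply i)
  set c := ENNReal.ofReal (Real.exp (-∑ i ∈ F, t i)) with hc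
  have hc0 : c ≠ 0 := by simp [hc, Real.exp_pos]
  have hct : c ≠ ⊤ := ENNReal.ofReal_ne_top
  -- Divided by its mass, the left side should be the product measure, which is characterised by its
  -- values on finite boxes.
  have key : c⁻¹ • ((expField ι).restrict {σ | ∀ i ∈ F, t i < σ i}).map (fun σ i => σ i - t i) =
      expField ι := by
    refine Measure.eq_infinitePi _ fun s A hA => ?_
    rw [Measure.smul_apply, Measure.map_apply (by fun_prop)
      (MeasurableSet.pi s.countable_toSet fun i _ => hA i),
      Measure.restrict_apply ((by fun_prop : Measurable fun (σ : ι → ℝ) i => σ i - t i)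
      (MeasurableSet.pi s.countable_toSet fun i _ => hA i))]
    have h1 : ((fun (σ : ι → ℝ) i => σ i - t i) ⁻¹' (s : Set ι).pi A) ∩
        {σ : ι → ℝ | ∀ i ∈ F, t i < σ i} = ((s ∪ F : Finset ι) : Set ι).pi
          fun i => {x | (i ∈ F → t i < x) ∧ (i ∈ s → x - t i ∈ A i)} := by
      ext σ
      simp only [Set.mem_inter_iff, Set.mem_preimage, Set.mem_pi, Set.mem_ofPred_eq, Finset.coe_union,
        Set.mem_union, Finset.mem_coe]
      constructor
      · rintro ⟨h, h'⟩ i _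
        exact ⟨h' i, h i⟩
      · intro h
        exact ⟨fun i hi => (h i (Or.inl hi)).2 hi, fun i hi => (h i (Or.inr hi)).1 hi⟩
    have hB : ∀ i, MeasurableSet {x : ℝ | (i ∈ F → t i < x) ∧ (i ∈ s → x - t i ∈ A i)} := by
      intro i
      have h1 : MeasurableSet {x : ℝ | t i < x} := measurableSet_lt measurable_const measurable_id
      have h2 : MeasurableSet {x : ℝ | x - t i ∈ A i} := (measurable_id.sub_const _) (hA i)
      by_cases hi : i ∈ F <;> by_cases hs : i ∈ s <;> simp only [hi, hs, true_imp_iff,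
        false_imp_iff, true_and, and_true, Set.ofPred_true, MeasurableSet.univ]
      · exact h1.inter h2
      · exact h1
      · exact h2
    rw [h1, expField, Measure.infinitePi_pi _ fun i _ => hB i]
    have h2 : ∀ i, expMeasure 1 {x : ℝ | (i ∈ F → t i < x) ∧ (i ∈ s → x - t i ∈ A i)} =
        (if i ∈ F then ENNReal.ofReal (Real.exp (-t i)) else 1) *
          (if i ∈ s then expMeasure 1 (A i) else 1) := by
      intro i
      by_cases hi : i ∈ F <;> by_cases hs : i ∈ s
      · simp only [hi, hs, true_imp_iff, if_true]
        exact expMeasure_one_shift (h0 i) (hA i)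
      · simpa [hi, hs] using expMeasure_one_shift (h0 i) MeasurableSet.univ
      · simp [hi, hs, hF i hi]
      · simp [hi, hs]
    rw [Finset.prod_congr rfl fun i _ => h2 i, Finset.prod_mul_distrib, Finset.prod_ite_mem,
      Finset.prod_ite_mem, Finset.union_inter_cancel_right, Finset.union_inter_cancel_left,
      ← ENNReal.ofReal_prod_of_nonneg (fun _ _ => Real.exp_nonneg _), ← Real.exp_sum,
      Finset.sum_neg_distrib, smul_eq_mul, ← mul_assoc, ENNReal.inv_mul_cancel hc0 hct, one_mul]
  conv_rhs => rw [← key]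
  rw [smul_smul, ENNReal.mul_inv_cancel hc0 hct, one_smul]

theorem lintegral_expField_shift {ι : Type*} (F : Finset ι) (t : ι → ℝ) (h0 : ∀ i, 0 ≤ t i)
    (hF : ∀ i, i ∉ F → t i = 0) {f : (ι → ℝ) → ℝ≥0∞} (hf : Measurable f) :
    ∫⁻ σ in {σ | ∀ i ∈ F, t i < σ i}, f (fun i => σ i - t i) ∂expField ι =
      ENNReal.ofReal (Real.exp (-∑ i ∈ F, t i)) * ∫⁻ σ, f σ ∂expField ι := by
  rw [← lintegral_map (f := f) (g := fun (σ : ι → ℝ) i => σ i - t i) hf (by fun_prop),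
    expField_map_shift F t h0 hF, lintegral_smul_measure, smul_eq_mul]

theorem expField_option (ι : Type*) :
    ((expMeasure 1).prod (expField ι)).map (fun (p : ℝ × (ι → ℝ)) (k : Option ι) => k.elim p.1 p.2) =
      expField (Option ι) := by
  classical
  have hm : Measurable fun (p : ℝ × (ι → ℝ)) (k : Option ι) => k.elim p.1 p.2 := by
    refine measurable_pi_lambda _ fun k => ?_
    cases k with
    | none => exact measurable_fst
    | some i => exact (measurable_pi_apply i).comp measurable_snd
  refine Measure.eq_infinitePi _ fun s A hA => ?_
  have hms := MeasurableSet.pi s.countable_toSet fun i (_ : i ∈ (s : Set (Option ι))) => hA i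
  rw [Measure.map_apply hm hms]
  have h1 : (fun (p : ℝ × (ι → ℝ)) (k : Option ι) => k.elim p.1 p.2) ⁻¹' (s : Set (Option ι)).pi A =
      {x | none ∈ s → x ∈ A none} ×ˢ ((s.eraseNone : Set ι).pi fun i => A (some i)) := by
    ext p
    simp only [Set.mem_preimage, Set.mem_pi, Finset.mem_coe, Option.forall, Option.elim_none,
      Option.elim_some, Set.mem_prod, Set.mem_ofPred_eq, Finset.mem_eraseNone]
  rw [h1, Measure.prod_prod, expField, Measure.infinitePi_pi _ fun i _ => hA _,
    ← Finset.prod_filter_mul_prod_filter_not s (fun k => k = none),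
    Finset.filter_eq' s none]
  congr 1
  · by_cases h : none ∈ s <;> simp [h]
  · refine Finset.prod_bij (fun i _ => some i) ?_ ?_ ?_ ?_
    · intro i hi
      simpa using hi
    · intro i _ j _ h
      simpa using h
    · intro k hk
      cases k with
      | none => simp at hk
      | some i => exact ⟨i, by simpa using hk, rfl⟩
    · intro i _
      rfl

theorem expField_reindex {ι κ : Type*} {g : κ → ι} (hg : Function.Injective g) :
    (expField ι).map (fun σ k => σ (g k)) = expField κ :=
  Measure.map_infinitePi_infinitePi_of_inj hg

/-- If `g` splits one coordinate off `κ`, then a family of independent exponential variables indexed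
by `κ` is built from one exponential variable and an independent family indexed by `ι`. -/
theorem expField_insert {ι κ : Type*} {g : κ → Option ι} (hg : Function.Injective g) :
    ((expMeasure 1).prod (expField ι)).map
      (fun (p : ℝ × (ι → ℝ)) (k : κ) => (g k).elim p.1 p.2) = expField κ := by
  rw [← expField_reindex hg, ← expField_option, Measure.map_map]
  · rfl
  · fun_prop
  · refine measurable_pi_lambda _ fun k => ?_
    cases k with
    | none => exact measurable_fst
    | some i => exact (measurable_pi_apply i).comp measurable_snd

/-! ### The exponential race -/

/-- The runner `e ∈ F` wins the race: with speeds `c`, it is the first to run the distance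
`σ (e, 0)`, and there is no tie. -/
def Wins {E : Type*} (F : Finset E) (c : E → ℝ) (σ : E × ℕ → ℝ) (e : E) : Prop :=
  e ∈ F ∧ ∀ e' ∈ F, e' ≠ e → σ (e, 0) / c e < σ (e', 0) / c e'

open Classical in
/-- The distances left after the win of `e`: the winner starts to run its next distance. -/
def remaining {E : Type*} (c : E → ℝ) (σ : E × ℕ → ℝ) (e : E) : E × ℕ → ℝ := fun p =>
  if p.1 = e then σ (e, p.2 + 1)
  else if p.2 = 0 then σ p - c p.1 * (σ (e, 0) / c e) else σ p

theorem measurableSet_wins {E : Type*} (F : Finset E) (c : E → ℝ) (e : E) :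
    MeasurableSet {σ | Wins F c σ e} := by
  have : {σ : E × ℕ → ℝ | Wins F c σ e} = {_σ : E × ℕ → ℝ | e ∈ F} ∩
      ⋂ e' ∈ F, {σ | e' ≠ e → σ (e, 0) / c e < σ (e', 0) / c e'} := by
    ext σ; simp [Wins]
  rw [this]
  refine (MeasurableSet.const _).inter (Finset.measurableSet_biInter F fun e' _ => ?_)
  by_cases h : e' = e
  · simp [h]
  · simp only [ne_eq, h, not_false_eq_true, true_imp_iff]
    exact measurableSet_lt (by fun_prop) (by fun_prop)

theorem measurable_remaining {E : Type*} (c : E → ℝ) (e : E) :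
    Measurable fun σ : E × ℕ → ℝ => remaining c σ e := by
  refine measurable_pi_lambda _ fun p => ?_
  unfold remaining
  split_ifs <;> fun_prop

open Classical in
-- This isolates the first distance of the winner `e` and closes the gap that it leaves, with the
-- same renumbering of the distances of `e` as in `remaining`.
def splitCoordinate {E : Type*} (e : E) (p : E × ℕ) : Option (E × ℕ) :=
  if p.1 = e then (if p.2 = 0 then none else some (e, p.2 - 1)) else some p

theorem splitCoordinate_injective {E : Type*} (e : E) :
    Function.Injective (splitCoordinate e) := by
  rintro ⟨x, m⟩ ⟨y, n⟩ h
  unfold splitCoordinate at h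
  by_cases hx : x = e <;> by_cases hy : y = e <;> by_cases hm : m = 0 <;> by_cases hn : n = 0 <;>
    simp [hx, hy, hm, hn] at h ⊢ <;> grind

/-- The distance of `e` gives its arrival time `s` the density `c e * exp (-c e * s)`. Given `s`,
every other runner must still be running, which costs `exp (-c i * s)` each, and by memorylessness
the distances left are again independent exponential variables. Hence the duration and identity of
the winner are independent of what remains. -/
theorem lintegral_wins {E : Type*} (F : Finset E) (c : E → ℝ) (hc : ∀ e ∈ F, 0 < c e)
    (hc0 : ∀ e, e ∉ F → c e = 0) {e : E} (he : e ∈ F) {f : ℝ → (E × ℕ → ℝ) → ℝ≥0∞}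
    (hf : Measurable (Function.uncurry f)) :
    ∫⁻ σ in {σ | Wins F c σ e}, f (σ (e, 0) / c e) (remaining c σ e) ∂expField (E × ℕ) =
      ∫⁻ s in Set.Ioi 0, ENNReal.ofReal (c e * Real.exp (-(∑ i ∈ F, c i) * s)) *
        ∫⁻ σ, f s σ ∂expField (E × ℕ) := by
  classical
  have hce := hc e he
  have hins := expField_insert (splitCoordinate_injective e)
  set J := fun (p : ℝ × (E × ℕ → ℝ)) (k : E × ℕ) => (splitCoordinate e k).elim p.1 p.2 with hJ
  have hJm : Measurable J := by
    refine measurable_pi_lambda _ fun k => ?_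
    cases h : splitCoordinate e k with
    | none => simpa [hJ, h] using measurable_fst
    | some i => simpa [hJ, h, Function.comp_def] using (measurable_pi_apply i).comp measurable_snd
  have hpm : Measurable fun σ : E × ℕ → ℝ => f (σ (e, 0) / c e) (remaining c σ e) :=
    hf.comp (Measurable.prodMk (by fun_prop) (measurable_remaining c e))
  have hwm := measurableSet_wins F c e
  have hJ0 : ∀ p, J p (e, 0) = p.1 := fun p => by simp [hJ, splitCoordinate]
  -- Once the winner's distance `p.1` is split off, `remaining` is a mere translation: each other
  -- runner has run its speed times `p.1 / c e`.
  have hJr : ∀ p, remaining c (J p) e =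
      fun k => p.2 k - (if k.1 ≠ e ∧ k.2 = 0 then c k.1 * (p.1 / c e) else 0) := by
    intro p
    funext ⟨x, m⟩
    by_cases hx : x = e
    · simp [remaining, hx, hJ, splitCoordinate]
    · by_cases hm : m = 0 <;> simp [remaining, hx, hm, hJ, splitCoordinate]
  have hJw : ∀ p, Wins F c (J p) e ↔
      ∀ k ∈ (F.erase e).image (fun i => (i, 0)), 
        (if k.1 ≠ e ∧ k.2 = 0 then c k.1 * (p.1 / c e) else 0) < p.2 k := by
    intro p
    simp only [Wins, he, true_and, hJ0, Finset.mem_image, Finset.mem_erase, forall_exists_index,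
      and_imp]
    constructor
    · rintro h k i hie hi rfl
      have := h i hi hie
      simp only [hJ, splitCoordinate, hie, if_false, Option.elim_some] at this
      simp only [ne_eq, hie, not_false_eq_true, and_self, if_true]
      rwa [lt_div_iff₀ (hc i hi), mul_comm] at this
    · intro h i hi hie
      have := h (i, 0) i hie hi rfl
      simp only [hJ, splitCoordinate, hie, if_false, Option.elim_some]
      simp only [ne_eq, hie, not_false_eq_true, and_self, if_true] at this
      rwa [lt_div_iff₀ (hc i hi), mul_comm]
  have hgm : Measurable fun a => {σ | Wins F c σ e}.indicator
      (fun σ => f (σ (e, 0) / c e) (remaining c σ e)) (J a) := (hpm.indicator hwm).comp hJm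
  rw [← lintegral_indicator hwm, ← hins, lintegral_map (hpm.indicator hwm) hJm,
    lintegral_prod _ hgm.aemeasurable, hins]
  have hfint : Measurable fun s => ∫⁻ σ, f s σ ∂expField (E × ℕ) :=
    Measurable.lintegral_prod_right hf
  -- With the winner's distance `y` fixed, this is memorylessness applied to the current distances
  -- of the other runners.
  have hinner : ∀ y : ℝ, 0 < y → ∫⁻ σ, ({σ | Wins F c σ e}.indicator
      (fun σ => f (σ (e, 0) / c e) (remaining c σ e)) (J (y, σ))) ∂expField (E × ℕ) =
      ENNReal.ofReal (Real.exp (-∑ i ∈ F.erase e, c i * (y / c e))) *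
        ∫⁻ σ, f (y / c e) σ ∂expField (E × ℕ) := by
    intro y hy
    have := lintegral_expField_shift ((F.erase e).image (fun i => (i, 0)))
      (fun k : E × ℕ => if k.1 ≠ e ∧ k.2 = 0 then c k.1 * (y / c e) else 0)
      (fun k => by
        split_ifs with h
        · by_cases hk : k.1 ∈ F
          · have := hc _ hk; positivity
          · simp [hc0 _ hk]
        · exact le_rfl)
      (fun k hk => by
        split_ifs with h
        · by_cases hkF : k.1 ∈ F
          · exact (hk (Finset.mem_image.2 ⟨k.1, Finset.mem_erase.2 ⟨h.1, hkF⟩,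
              Prod.ext rfl h.2.symm⟩)).elim
          · simp [hc0 _ hkF]
        · rfl)
      (f := f (y / c e)) (hf.comp measurable_prodMk_left)
    rw [Finset.sum_image (fun i _ j _ h => by simpa using h)] at this
    rw [Finset.sum_congr rfl (g := fun i => c i * (y / c e)) (fun i hi => by
      simp [Finset.ne_of_mem_erase hi])] at this
    rw [← this, ← lintegral_indicator]
    · refine lintegral_congr fun σ => ?_
      by_cases hw : Wins F c (J (y, σ)) e
      · have hw' := (hJw (y, σ)).1 hw
        rw [Set.indicator_of_mem (by exact hw), Set.indicator_of_mem (by exact hw'), hJ0, hJr]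
      · have hw' := fun h => hw ((hJw (y, σ)).2 h)
        rw [Set.indicator_of_notMem (by exact hw), Set.indicator_of_notMem (by exact hw')]
    · simp only [Set.ofPred_forall]
      exact Finset.measurableSet_biInter _ fun i _ =>
        measurableSet_lt measurable_const (measurable_pi_apply i)
  rw [lintegral_congr_ae (g := fun y => ENNReal.ofReal
      (Real.exp (-∑ i ∈ F.erase e, c i * (y / c e))) * ∫⁻ σ, f (y / c e) σ ∂expField (E × ℕ))
      (ae_pos_expMeasure_one.mono fun y hy => hinner y hy), lintegral_expMeasure_one (by fun_prop)]
  -- Substitute `y = c e * s` to pass from the winner's distance to the duration; the Jacobian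
  -- supplies the factor `c e` of the rate.
  have himg : Set.Ioi (0 : ℝ) = (fun s => c e * s) '' Set.Ioi 0 := by
    ext y
    constructor
    · intro hy
      exact ⟨y / c e, div_pos hy hce, by field_simp⟩
    · rintro ⟨s, hs, rfl⟩
      exact mul_pos hce hs
  conv_lhs => rw [himg]
  rw [lintegral_image_eq_lintegral_abs_deriv_mul measurableSet_Ioi (f' := fun _ => c e)
    (fun x _ => by simpa using ((hasDerivAt_id x).const_mul (c e)).hasDerivWithinAt)
    (fun x _ y _ h => mul_left_cancel₀ hce.ne' h)]
  refine setLIntegral_congr_fun measurableSet_Ioi fun s _ => ?_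
  simp only [mul_div_cancel_left₀ s hce.ne']
  rw [← mul_assoc, ← mul_assoc, ← ENNReal.ofReal_mul (abs_nonneg _), ← ENNReal.ofReal_mul (by positivity),
    abs_of_pos hce, mul_assoc, ← Real.exp_add, ← Finset.add_sum_erase F c he, ← Finset.sum_mul]
  congr 4
  ring

/-! ### Sequences of races and their laws -/

theorem measurable_of_countable_selector {α β ι : Type*} [MeasurableSpace α] [MeasurableSpace β]
    [Countable ι] {e : α → ι} (he : ∀ i, MeasurableSet {x | e x = i}) {f : ι → α → β}
    (hf : ∀ i, Measurable (f i)) : Measurable fun x => f (e x) x := by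
  intro s hs
  have : (fun x => f (e x) x) ⁻¹' s = ⋃ i, {x | e x = i} ∩ f i ⁻¹' s := by
    ext x; simp
  rw [this]
  exact MeasurableSet.iUnion fun i => (he i).inter (hf i hs)

theorem lintegral_Ioi_const_mul_exp {b R s : ℝ} (hb : 0 ≤ b) (hR : 0 < R) :
    ∫⁻ x in Set.Ioi s, ENNReal.ofReal (b * Real.exp (-R * x)) =
      ENNReal.ofReal (b / R * Real.exp (-R * s)) := by
  rw [← ofReal_integral_eq_lintegral_ofReal]
  · rw [integral_const_mul, integral_exp_mul_Ioi (neg_lt_zero.2 hR)]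
    congr 1
    field_simp
  · exact (integrableOn_exp_mul_Ioi (neg_lt_zero.2 hR) s).const_mul b
  · exact Filter.Eventually.of_forall fun x => by positivity

/-- The rules of a sequence of exponential races in which runners and speeds of the `n`-th race
depend on a history `h : H`, which is updated with the winner and the duration of the race. -/
structure RaceScheme (E H : Type*) [MeasurableSpace H] where
  runners : ℕ → H → Finset E
  speed : ℕ → H → E → ℝ
  next : ℕ → H → E → ℝ → H
  runners_nonempty : ∀ n h, (runners n h).Nonempty
  speed_pos : ∀ n h, ∀ e ∈ runners n h, 0 < speed n h e
  speed_eq_zero : ∀ n h e, e ∉ runners n h → speed n h e = 0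
  measurable_speed : ∀ n e, Measurable fun h => speed n h e
  measurable_next : ∀ n e, Measurable fun p : H × ℝ => next n p.1 e p.2

namespace RaceScheme

variable {E H : Type*} [MeasurableSpace H] (R : RaceScheme E H)

theorem mem_runners_iff (n : ℕ) (h : H) (e : E) : e ∈ R.runners n h ↔ R.speed n h e ≠ 0 :=
  ⟨fun he => (R.speed_pos n h e he).ne', fun he => by_contra fun hn => he (R.speed_eq_zero n h e hn)⟩

theorem speed_nonneg (n : ℕ) (h : H) (e : E) : 0 ≤ R.speed n h e := by
  by_cases he : e ∈ R.runners n h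
  · exact (R.speed_pos n h e he).le
  · exact (R.speed_eq_zero n h e he).ge

/-- The sum of the speeds of all runners. -/
def totalSpeed (n : ℕ) (h : H) : ℝ := ∑ e ∈ R.runners n h, R.speed n h e

theorem totalSpeed_pos (n : ℕ) (h : H) : 0 < R.totalSpeed n h :=
  Finset.sum_pos (R.speed_pos n h) (R.runners_nonempty n h)

/-- The runner `e` wins the `n`-th race. -/
def WinsAt (n : ℕ) (p : H × (E × ℕ → ℝ)) (e : E) : Prop :=
  Wins (R.runners n p.1) (R.speed n p.1) p.2 e

/-- The duration of the `n`-th race if `e` is its winner. -/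
def duration (n : ℕ) (p : H × (E × ℕ → ℝ)) (e : E) : ℝ := p.2 (e, 0) / R.speed n p.1 e

variable {R} in
theorem WinsAt.unique {n : ℕ} {p : H × (E × ℕ → ℝ)} {e e' : E} (h : R.WinsAt n p e)
    (h' : R.WinsAt n p e') : e = e' := by
  by_contra hne
  exact lt_asymm (h.2 e' h'.1 (Ne.symm hne)) (h'.2 e h.1 hne)

open Classical in
/-- The winner of the `n`-th race. -/
def winner [Nonempty E] (n : ℕ) (p : H × (E × ℕ → ℝ)) : E :=
  if h : ∃ e, R.WinsAt n p e then h.choose else Classical.arbitrary E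

/-- The history and the distances left after the `n`-th race if `e` is its winner. -/
def stepOf (n : ℕ) (e : E) (p : H × (E × ℕ → ℝ)) : H × (E × ℕ → ℝ) :=
  (R.next n p.1 e (R.duration n p e), remaining (R.speed n p.1) p.2 e)

variable [Nonempty E]

/-- The history and the distances left after the `n`-th race. -/
def step (n : ℕ) (p : H × (E × ℕ → ℝ)) : H × (E × ℕ → ℝ) := R.stepOf n (R.winner n p) p

/-- The history and the distances left after the first `n` races. -/
def run (p : H × (E × ℕ → ℝ)) : ℕ → H × (E × ℕ → ℝ)
  | 0 => p
  | n + 1 => R.step n (run p n)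

variable {R} in
theorem WinsAt.winner_eq {n : ℕ} {p : H × (E × ℕ → ℝ)} {e : E} (h : R.WinsAt n p e) :
    R.winner n p = e := by
  have hex : ∃ e, R.WinsAt n p e := ⟨e, h⟩
  rw [winner, dif_pos hex]
  exact hex.choose_spec.unique h

section Measurability

omit [Nonempty E] in
theorem measurable_duration (n : ℕ) (e : E) : Measurable fun p => R.duration n p e :=
  ((measurable_pi_apply (e, 0)).comp measurable_snd).div
    ((R.measurable_speed n e).comp measurable_fst)

omit [Nonempty E] in
theorem measurableSet_mem_runners (n : ℕ) (e : E) : MeasurableSet {h | e ∈ R.runners n h} := by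
  simp only [R.mem_runners_iff]
  exact (R.measurable_speed n e) (measurableSet_singleton 0).compl

omit [Nonempty E] in
theorem measurable_stepOf (n : ℕ) (e : E) : Measurable (R.stepOf n e) := by
  refine Measurable.prodMk ?_ (measurable_pi_lambda _ fun q => ?_)
  · exact (R.measurable_next n e).comp (measurable_fst.prodMk (R.measurable_duration n e))
  · have h1 := fun q : E × ℕ => (measurable_pi_apply (X := fun _ => ℝ) q).comp
      (measurable_snd : Measurable (Prod.snd : H × (E × ℕ → ℝ) → E × ℕ → ℝ))
    unfold remaining
    split_ifs
    · exact h1 _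
    · exact (h1 _).sub (((R.measurable_speed n _).comp measurable_fst).mul
        (R.measurable_duration n e))
    · exact h1 _

variable [Countable E]

omit [Nonempty E] in
theorem measurableSet_winsAt (n : ℕ) (e : E) : MeasurableSet {p | R.WinsAt n p e} := by
  have : {p | R.WinsAt n p e} = {p | e ∈ R.runners n p.1} ∩
      ⋂ e', ({p | e' ∈ R.runners n p.1}ᶜ ∪ ({_p : H × (E × ℕ → ℝ) | e' = e} ∪
        {p | R.duration n p e < R.duration n p e'})) := by
    ext p
    simp only [WinsAt, Wins, duration, Set.mem_ofPred_eq, Set.mem_inter_iff, Set.mem_iInter,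
      Set.mem_union, Set.mem_compl_iff]
    refine and_congr_right fun _ => forall_congr' fun e' => ?_
    tauto
  rw [this]
  refine (measurable_fst (R.measurableSet_mem_runners n e)).inter (MeasurableSet.iInter fun e' => ?_)
  exact (measurable_fst (R.measurableSet_mem_runners n e')).compl.union ((MeasurableSet.const _).union
    (measurableSet_lt (R.measurable_duration n e) (R.measurable_duration n e')))

theorem measurableSet_winner_eq (n : ℕ) (e : E) : MeasurableSet {p | R.winner n p = e} := by
  have : {p | R.winner n p = e} = {p | R.WinsAt n p e} ∪
      ((⋃ e', {p | R.WinsAt n p e'})ᶜ ∩ {_p | Classical.arbitrary E = e}) := by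
    ext p
    simp only [Set.mem_ofPred_eq, Set.mem_union, Set.mem_inter_iff, Set.mem_compl_iff,
      Set.mem_iUnion]
    by_cases h : ∃ e', R.WinsAt n p e'
    · obtain ⟨e', he'⟩ := h
      rw [he'.winner_eq]
      constructor
      · rintro rfl; exact Or.inl he'
      · rintro (h | h)
        · exact he'.unique h
        · exact (h.1 ⟨e', he'⟩).elim
    · have hn : ¬ R.WinsAt n p e := fun h' => h ⟨e, h'⟩
      have hw : R.winner n p = Classical.arbitrary E := dif_neg h
      simp only [hw, hn, h, false_or, not_false_eq_true, true_and]
  rw [this]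
  exact (R.measurableSet_winsAt n e).union
    ((MeasurableSet.iUnion fun e' => R.measurableSet_winsAt n e').compl.inter (MeasurableSet.const _))

theorem measurable_step (n : ℕ) : Measurable (R.step n) :=
  measurable_of_countable_selector (R.measurableSet_winner_eq n) (R.measurable_stepOf n)

theorem measurable_run (n : ℕ) : Measurable fun p => R.run p n := by
  induction n with
  | zero => exact measurable_id
  | succ n ih => exact (R.measurable_step n).comp ih

end Measurability

section Law

variable [Countable E] (ν : Measure H)

omit [Nonempty E] in
-- This is `lintegral_wins` integrated over the history. Histories for which `e` does not run
-- contribute nothing on either side, as the speed of `e` is then zero.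
theorem lintegral_winsAt (n : ℕ) (e : E) {g : H → ℝ → (E × ℕ → ℝ) → ℝ≥0∞}
    (hg : Measurable fun q : H × ℝ × (E × ℕ → ℝ) => g q.1 q.2.1 q.2.2) :
    ∫⁻ p in {p | R.WinsAt n p e}, g p.1 (R.duration n p e) (remaining (R.speed n p.1) p.2 e)
        ∂ν.prod (expField (E × ℕ)) =
      ∫⁻ h, (∫⁻ s in Set.Ioi (0 : ℝ),
        ENNReal.ofReal (R.speed n h e * Real.exp (-R.totalSpeed n h * s)) *
          ∫⁻ σ, g h s σ ∂expField (E × ℕ)) ∂ν := by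
  have hm : Measurable fun p : H × (E × ℕ → ℝ) =>
      g p.1 (R.duration n p e) (remaining (R.speed n p.1) p.2 e) :=
    hg.comp (measurable_fst.prodMk ((R.measurable_duration n e).prodMk
      (measurable_snd.comp (R.measurable_stepOf n e))))
  rw [← lintegral_indicator (R.measurableSet_winsAt n e), lintegral_prod _
    (hm.indicator (R.measurableSet_winsAt n e)).aemeasurable]
  refine lintegral_congr fun h => ?_
  by_cases he : e ∈ R.runners n h
  · rw [totalSpeed, ← lintegral_wins (R.runners n h) (R.speed n h) (R.speed_pos n h)
      (R.speed_eq_zero n h) he (f := g h)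
      (hg.comp (measurable_const.prodMk measurable_id)),
      ← lintegral_indicator (measurableSet_wins _ _ _)]
    rfl
  · have h1 : ∀ σ, ¬ R.WinsAt n (h, σ) e := fun σ hw => he hw.1
    simp [h1, R.speed_eq_zero n h e he]

omit [Nonempty E] in
-- The winning probabilities are the speeds divided by the total speed. They add up to one, so ties
-- are negligible.
theorem ae_exists_winsAt (n : ℕ) :
    ∀ᵐ p ∂ν.prod (expField (E × ℕ)), ∃ e, R.WinsAt n p e := by
  have hms : MeasurableSet {p : H × (E × ℕ → ℝ) | ∃ e, R.WinsAt n p e} := by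
    simp only [Set.ofPred_exists]
    exact MeasurableSet.iUnion fun e => R.measurableSet_winsAt n e
  refine (Measure.ae_prod_iff_ae_ae hms).2 (Filter.Eventually.of_forall fun h => ?_)
  have h1 : ∀ e ∈ R.runners n h, expField (E × ℕ) {σ | R.WinsAt n (h, σ) e} =
      ENNReal.ofReal (R.speed n h e / R.totalSpeed n h) := by
    intro e he
    have := lintegral_wins (R.runners n h) (R.speed n h) (R.speed_pos n h)
      (R.speed_eq_zero n h) he (f := fun _ _ => 1) measurable_const
    simp only [lintegral_const, measure_univ, mul_one, MeasurableSet.univ, Measure.restrict_apply,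
      Set.univ_inter, one_mul] at this
    have h2 := lintegral_Ioi_const_mul_exp (s := 0) (R.speed_nonneg n h e) (R.totalSpeed_pos n h)
    rw [mul_zero, Real.exp_zero, mul_one] at h2
    exact this.trans h2
  have h2 : {σ | ∃ e, R.WinsAt n (h, σ) e} =
      ⋃ e ∈ R.runners n h, {σ | R.WinsAt n (h, σ) e} := by
    ext σ
    simp only [Set.mem_ofPred_eq, Set.mem_iUnion, exists_prop]
    exact exists_congr fun e => ⟨fun hw => ⟨hw.1, hw⟩, fun hw => hw.2⟩
  have h3 : expField (E × ℕ) {σ | ∃ e, R.WinsAt n (h, σ) e} = 1 := by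
    rw [h2, measure_biUnion_finset, Finset.sum_congr rfl h1, ← ENNReal.ofReal_sum_of_nonneg,
      ← Finset.sum_div]
    · change ENNReal.ofReal (R.totalSpeed n h / R.totalSpeed n h) = 1
      rw [div_self (R.totalSpeed_pos n h).ne', ENNReal.ofReal_one]
    · exact fun e _ => div_nonneg (R.speed_nonneg n h e) (R.totalSpeed_pos n h).le
    · intro e _ e' _ hne
      exact Set.disjoint_left.2 fun σ hσ hσ' => hne (WinsAt.unique hσ hσ')
    · exact fun e _ => measurable_prodMk_left (R.measurableSet_winsAt n e)
  exact (mem_ae_iff_prob_eq_one (measurable_prodMk_left hms)).2 h3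

theorem lintegral_step (n : ℕ) {g : H × (E × ℕ → ℝ) → ℝ≥0∞} (hg : Measurable g) :
    ∫⁻ p, g (R.step n p) ∂ν.prod (expField (E × ℕ)) =
      ∑' e, ∫⁻ h, (∫⁻ s in Set.Ioi (0 : ℝ),
        ENNReal.ofReal (R.speed n h e * Real.exp (-R.totalSpeed n h * s)) *
          ∫⁻ σ, g (R.next n h e s, σ) ∂expField (E × ℕ)) ∂ν := by
  have h1 : ∀ᵐ p ∂ν.prod (expField (E × ℕ)), p ∈ ⋃ e, {p | R.WinsAt n p e} := by
    filter_upwards [R.ae_exists_winsAt ν n] with p hp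
    simpa using hp
  have h2 : Measurable fun p => g (R.step n p) := hg.comp (R.measurable_step n)
  rw [← Measure.restrict_eq_self_of_ae_mem h1,
    lintegral_iUnion (fun e => R.measurableSet_winsAt n e) (fun e e' hne =>
      Set.disjoint_left.2 fun p hp hp' => hne (WinsAt.unique hp hp'))]
  refine tsum_congr fun e => ?_
  rw [← R.lintegral_winsAt ν n e (g := fun h s σ => g (R.next n h e s, σ))
    (hg.comp (((R.measurable_next n e).comp (measurable_fst.prodMk
      (measurable_fst.comp measurable_snd))).prodMk (measurable_snd.comp measurable_snd)))]
  refine setLIntegral_congr_fun (R.measurableSet_winsAt n e) fun p hp => ?_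
  have hp' : R.WinsAt n p e := hp
  simp only [step, hp'.winner_eq, stepOf]

/-- The formula of `lintegral_step` sees the test function only through its average over the
distances. Replacing the function by this average changes nothing, and that is the asserted
independence. -/
theorem map_step (n : ℕ) :
    (ν.prod (expField (E × ℕ))).map (R.step n) =
      ((ν.prod (expField (E × ℕ))).map fun p => (R.step n p).1).prod (expField (E × ℕ)) := by
  refine Measure.ext_of_lintegral _ fun g hg => ?_
  have hG : Measurable fun h => ∫⁻ σ, g (h, σ) ∂expField (E × ℕ) := hg.lintegral_prod_right'
  rw [lintegral_map hg (R.measurable_step n), lintegral_prod _ hg.aemeasurable,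
    lintegral_map hG (R.measurable_step n).fst, R.lintegral_step ν n hg,
    R.lintegral_step ν n (g := fun q => ∫⁻ σ, g (q.1, σ) ∂expField (E × ℕ))
      (hG.comp measurable_fst)]
  simp

/-- The distances left after the `n`-th race are independent of the history and have the same law as
at the beginning. -/
theorem map_run (n : ℕ) :
    (ν.prod (expField (E × ℕ))).map (fun p => R.run p n) =
      ((ν.prod (expField (E × ℕ))).map fun p => (R.run p n).1).prod (expField (E × ℕ)) := by
  induction n with
  | zero =>
    have h1 : (fun p : H × (E × ℕ → ℝ) => R.run p 0) = id := rfl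
    have h2 : (fun p : H × (E × ℕ → ℝ) => (R.run p 0).1) = Prod.fst := rfl
    rw [h1, h2, Measure.map_id, Measure.map_fst_prod, measure_univ, one_smul]
  | succ n ih =>
    have h1 : (fun p : H × (E × ℕ → ℝ) => R.run p (n + 1)) = R.step n ∘ fun p => R.run p n := rfl
    have h2 : (fun p : H × (E × ℕ → ℝ) => (R.run p (n + 1)).1) =
      (fun p => (R.step n p).1) ∘ fun p => R.run p n := rfl
    rw [h1, h2, ← Measure.map_map (R.measurable_step n) (R.measurable_run n),
      ← Measure.map_map (R.measurable_step n).fst (R.measurable_run n), ih]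
    exact R.map_step _ n

/-- Almost surely every race has a winner, and all distances are positive. -/
theorem ae_run_good : ∀ᵐ p ∂ν.prod (expField (E × ℕ)), ∀ n,
    (∃ e, R.WinsAt n (R.run p n) e) ∧ ∀ k, 0 < (R.run p n).2 k := by
  refine ae_all_iff.2 fun n => ?_
  refine ae_of_ae_map (f := fun p => R.run p n)
    (p := fun q => (∃ e, R.WinsAt n q e) ∧ ∀ k, 0 < q.2 k) (R.measurable_run n).aemeasurable ?_
  rw [R.map_run ν n]
  refine (R.ae_exists_winsAt _ n).and (ae_all_iff.2 fun k => ?_)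
  refine ae_of_ae_map (f := fun q : H × (E × ℕ → ℝ) => q.2) (p := fun σ => 0 < σ k)
    measurable_snd.aemeasurable ?_
  rw [Measure.map_snd_prod]
  refine ae_of_ae_map (f := fun σ : E × ℕ → ℝ => σ k) (p := fun x => 0 < x)
    (measurable_pi_apply k).aemeasurable ?_
  rw [Measure.map_smul, expField, Measure.infinitePi_map_eval]
  exact Measure.ae_smul_measure ae_pos_expMeasure_one _

/-- The conditional law of winner and duration of the `n`-th race given the history, in integrated
form. By `map_run` it is a single race started from the law of the history after `n` races. -/
theorem measure_run_winsAt (n : ℕ) (e : E) {s : ℝ} (hs : 0 ≤ s) {A : Set H} (hA : MeasurableSet A) :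
    ν.prod (expField (E × ℕ)) {p | (R.run p n).1 ∈ A ∧ R.WinsAt n (R.run p n) e ∧
        s < R.duration n (R.run p n) e} =
      ∫⁻ h in A, ENNReal.ofReal (R.speed n h e / R.totalSpeed n h *
        Real.exp (-R.totalSpeed n h * s))
          ∂(ν.prod (expField (E × ℕ))).map fun p => (R.run p n).1 := by
  set ν' := (ν.prod (expField (E × ℕ))).map fun p => (R.run p n).1 with hν'
  have hm : MeasurableSet {q : H × (E × ℕ → ℝ) | q.1 ∈ A ∧ s < R.duration n q e} :=
    (measurable_fst hA).inter (measurableSet_lt measurable_const (R.measurable_duration n e))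
  have hw := R.measurableSet_winsAt n e
  have h1 := R.lintegral_winsAt ν' n e (g := fun h x _ => A.indicator 1 h * (Set.Ioi s).indicator 1 x)
    (((measurable_one.indicator hA).comp measurable_fst).mul
      ((measurable_one.indicator measurableSet_Ioi).comp (measurable_fst.comp measurable_snd)))
  have h2 : {p | (R.run p n).1 ∈ A ∧ R.WinsAt n (R.run p n) e ∧ s < R.duration n (R.run p n) e} =
      (fun p => R.run p n) ⁻¹' ({q | q.1 ∈ A ∧ s < R.duration n q e} ∩ {q | R.WinsAt n q e}) := by
    ext p
    simp only [Set.mem_ofPred_eq, Set.mem_preimage, Set.mem_inter_iff]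
    tauto
  rw [h2, ← Measure.map_apply (R.measurable_run n) (hm.inter hw), R.map_run ν n,
    ← Measure.restrict_apply hm, ← lintegral_indicator_one hm, ← lintegral_indicator hA]
  refine Eq.trans (lintegral_congr fun q => ?_) (h1.trans (lintegral_congr fun h => ?_))
  · by_cases hq : q.1 ∈ A <;> by_cases hq' : s < R.duration n q e <;> simp [hq, hq']
  · by_cases hh : h ∈ A
    · simp only [hh, Set.indicator_of_mem, Pi.one_apply, one_mul, lintegral_const, measure_univ,
        mul_one]
      rw [← lintegral_Ioi_const_mul_exp (R.speed_nonneg n h e) (R.totalSpeed_pos n h),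
        ← lintegral_indicator measurableSet_Ioi, ← lintegral_indicator measurableSet_Ioi]
      refine lintegral_congr fun x => ?_
      by_cases hx : s < x
      · simp [hx, hs.trans_lt hx]
      · simp [hx]
    · simp [hh]

end Law
end RaceScheme

/-! ### Gamma variables and Kendall's theorem -/

theorem lintegral_gammaMeasure_one {a : ℝ} {f : ℝ → ℝ≥0∞} (hf : Measurable f) :
    ∫⁻ x, f x ∂gammaMeasure a 1 = ∫⁻ x in Set.Ioi 0,
      ENNReal.ofReal (x ^ (a - 1) * Real.exp (-x) / Real.Gamma a) * f x := by
  have hm : Measurable (gammaPDF a 1) := (measurable_gammaPDFReal a 1).ennreal_ofReal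
  rw [gammaMeasure, lintegral_withDensity_eq_lintegral_mul _ hm hf,
    ← lintegral_indicator measurableSet_Ioi, ← lintegral_add_compl _ (measurableSet_singleton 0),
    ← lintegral_add_compl (fun a => (Set.Ioi (0 : ℝ)).indicator _ a) (measurableSet_singleton 0)]
  simp only [Measure.restrict_singleton, Real.volume_singleton, zero_smul, lintegral_zero_measure,
    zero_add]
  refine setLIntegral_congr_fun (measurableSet_singleton 0).compl fun x hx => ?_
  have hx0 : x ≠ 0 := hx
  rcases lt_or_gt_of_ne hx0 with h | h
  · simp [gammaPDF_of_neg h, h.le]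
  · simp only [gammaPDF_of_nonneg h.le, Real.one_rpow, one_mul, Pi.mul_apply, Set.mem_Ioi, h,
      Set.indicator_of_mem]
    congr 2
    ring

theorem ae_pos_gammaMeasure_one {a : ℝ} : ∀ᵐ x ∂gammaMeasure a 1, 0 < x := by
  rw [ae_iff, ← lintegral_indicator_one (by measurability),
    lintegral_gammaMeasure_one (by fun_prop (disch := measurability)),
    setLIntegral_congr_fun (g := 0) measurableSet_Ioi]
  · simp
  · intro x hx
    simp_all

/-- If `W` is a Gamma variable with shape `a` and `σ` an independent standard exponential variable,
then `a log ((W + σ) / W)` is exponential and independent of `W + σ`, which is a Gamma variable with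
shape `a + 1`. -/
theorem lintegral_gamma_exp {a : ℝ} (ha : 0 < a) {f : ℝ → ℝ → ℝ≥0∞}
    (hf : Measurable (Function.uncurry f)) :
    ∫⁻ w, (∫⁻ s, f (a * Real.log ((w + s) / w)) (w + s) ∂expMeasure 1) ∂gammaMeasure a 1 =
      ∫⁻ u, (∫⁻ v, f u v ∂gammaMeasure (a + 1) 1) ∂expMeasure 1 := by
  have := isProbabilityMeasure_gammaMeasure ha one_pos
  have := isProbabilityMeasure_gammaMeasure (a := a + 1) (by linarith) one_pos
  have hf' : ∀ {α : Type} [MeasurableSpace α] (u v : α → ℝ), Measurable u → Measurable v →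
      Measurable fun x => f (u x) (v x) := fun u v hu hv => hf.comp (hu.prodMk hv)
  have h1 : Measurable fun p : ℝ × ℝ => f (a * Real.log ((p.1 + p.2) / p.1)) (p.1 + p.2) :=
    hf' _ _ (by fun_prop) (by fun_prop)
  rw [lintegral_gammaMeasure_one h1.lintegral_prod_right']
  have hG := Real.Gamma_pos_of_pos ha
  -- the integrand on the left, as a function of `w` and `v = w + s`
  set K : ℝ → ℝ → ℝ≥0∞ := fun w v => (Set.Ioi (0 : ℝ)).indicator 1 w * (Set.Ioi w).indicator 1 v *
    (ENNReal.ofReal (w ^ (a - 1) * Real.exp (-v) / Real.Gamma a) *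
      f (a * Real.log (v / w)) v) with hK
  have hKm : Measurable (Function.uncurry K) := by
    refine Measurable.mul (Measurable.mul ?_ ?_) (Measurable.mul ?_ ?_)
    · exact (measurable_one.indicator measurableSet_Ioi).comp measurable_fst
    · have : (fun p : ℝ × ℝ => (Set.Ioi p.1).indicator (1 : ℝ → ℝ≥0∞) p.2) =
          {p : ℝ × ℝ | p.1 < p.2}.indicator 1 := by
        ext p
        by_cases h : p.1 < p.2 <;> simp [h]
      rw [this]
      exact measurable_one.indicator (measurableSet_lt measurable_fst measurable_snd)
    · fun_prop
    · exact hf' _ _ (by fun_prop) (by fun_prop)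
  have hleft : ∀ w : ℝ, (Set.Ioi (0 : ℝ)).indicator (fun w =>
      ENNReal.ofReal (w ^ (a - 1) * Real.exp (-w) / Real.Gamma a) *
        ∫⁻ s, f (a * Real.log ((w + s) / w)) (w + s) ∂expMeasure 1) w = ∫⁻ v, K w v := by
    intro w
    by_cases hw : 0 < w
    · have h2 : Measurable fun s => f (a * Real.log ((w + s) / w)) (w + s) :=
        h1.comp measurable_prodMk_left
      have h3 : Measurable fun s : ℝ => ENNReal.ofReal (Real.exp (-s)) := by fun_prop
      rw [Set.indicator_of_mem (by exact hw), lintegral_expMeasure_one h2,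
        ← lintegral_const_mul _ (by fun_prop),
        ← lintegral_indicator measurableSet_Ioi,
        ← lintegral_add_left_eq_self (fun v => K w v) w]
      refine lintegral_congr fun s => ?_
      by_cases hs : 0 < s
      · have : w < w + s := by linarith
        simp only [hK, Set.mem_Ioi, hs, hw, this, Set.indicator_of_mem, Pi.one_apply, one_mul]
        rw [← mul_assoc, ← ENNReal.ofReal_mul (by positivity)]
        congr 2
        rw [neg_add, Real.exp_add]
        ring
      · simp [hK, hs]
    · simp [hK, hw]
  have hright : ∀ v : ℝ, ∫⁻ w, K w v = (Set.Ioi (0 : ℝ)).indicator (fun v =>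
      ENNReal.ofReal (v ^ (a + 1 - 1) * Real.exp (-v) / Real.Gamma (a + 1)) *
        ∫⁻ u, f u v ∂expMeasure 1) v := by
    intro v
    by_cases hv : 0 < v
    -- For fixed `v`, put `u = a log (v / w)`, that is `w = v exp (-u / a)`. Then `w ^ (a - 1) dw`
    -- becomes `v ^ a exp (-u) du / a`, and `a * Gamma a = Gamma (a + 1)` produces the Gamma density
    -- of shape `a + 1` in `v`.
    · have himg : Set.Ioo 0 v = (fun u => v * Real.exp (-u / a)) '' Set.Ioi 0 := by
        ext w
        constructor
        · rintro ⟨h0, hwv⟩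
          refine ⟨a * Real.log (v / w), mul_pos ha (Real.log_pos ((one_lt_div h0).2 hwv)), ?_⟩
          have : -(a * Real.log (v / w)) / a = Real.log (w / v) := by
            rw [← inv_div v w, Real.log_inv]; field_simp
          simp only [this]
          rw [Real.exp_log (div_pos h0 hv)]
          field_simp
        · rintro ⟨u, hu, rfl⟩
          refine ⟨by positivity, mul_lt_of_lt_one_right hv ?_⟩
          rw [Real.exp_lt_one_iff]
          exact div_neg_of_neg_of_pos (neg_lt_zero.2 hu) ha
      have h5 : Measurable fun u => f u v := hf.comp measurable_prodMk_right
      have h6 : Measurable fun s : ℝ => ENNReal.ofReal (Real.exp (-s)) := by fun_prop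
      rw [Set.indicator_of_mem (by exact hv), lintegral_expMeasure_one h5,
        ← lintegral_const_mul _ (by fun_prop)]
      have h2 : ∫⁻ w, K w v = ∫⁻ w in Set.Ioo 0 v,
          ENNReal.ofReal (w ^ (a - 1) * Real.exp (-v) / Real.Gamma a) *
            f (a * Real.log (v / w)) v := by
        rw [← lintegral_indicator measurableSet_Ioo]
        refine lintegral_congr fun w => ?_
        by_cases h0 : 0 < w <;> by_cases hwv : w < v <;> simp [hK, h0, hwv]
      have hder : ∀ x : ℝ, HasDerivWithinAt (fun u => v * Real.exp (-u / a))
          (v * (Real.exp (-x / a) * (-1 / a))) (Set.Ioi 0) x := fun x =>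
        ((((hasDerivAt_id x).neg.div_const a).exp).const_mul v).hasDerivWithinAt
      rw [h2, himg, lintegral_image_eq_lintegral_abs_deriv_mul measurableSet_Ioi
        (f' := fun u => v * (Real.exp (-u / a) * (-1 / a)))
        (fun x _ => hder x)]
      · refine setLIntegral_congr_fun measurableSet_Ioi fun u _ => ?_
        have h3 : a * Real.log (v / (v * Real.exp (-u / a))) = u := by
          rw [div_mul_cancel_left₀ hv.ne', Real.log_inv, Real.log_exp]
          field_simp
        simp only [h3]
        rw [← mul_assoc, ← ENNReal.ofReal_mul (abs_nonneg _),
          ← mul_assoc (ENNReal.ofReal _) (ENNReal.ofReal _) (f u v), ← ENNReal.ofReal_mul (by positivity)]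
        congr 2
        rw [abs_of_nonpos (by
          have : 0 < v * Real.exp (-u / a) / a := by positivity
          calc _ = -(v * Real.exp (-u / a) / a) := by ring
            _ ≤ 0 := by linarith), Real.Gamma_add_one ha.ne', add_sub_cancel_right,
          Real.mul_rpow hv.le (Real.exp_nonneg _), ← Real.exp_mul, Real.rpow_sub_one hv.ne']
        have h4 : Real.exp (-u) = Real.exp (-u / a) * Real.exp (-u / a * (a - 1)) := by
          rw [← Real.exp_add]
          congr 1
          field_simp
          ring
        rw [h4]
        field_simp
      · intro x _ y _ h
        have := Real.exp_injective (mul_left_cancel₀ hv.ne' h)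
        field_simp at this
        linarith
    · rw [Set.indicator_of_notMem (by exact hv)]
      refine (lintegral_congr fun w => ?_).trans lintegral_zero
      by_cases hw : 0 < w
      · have : ¬ w < v := fun h => hv (hw.trans h)
        simp [hK, this]
      · simp [hK, hw]
  have h7 : Measurable fun v => ∫⁻ u, f u v ∂expMeasure 1 := hf.lintegral_prod_left'
  rw [← lintegral_indicator measurableSet_Ioi, lintegral_congr hleft,
    lintegral_lintegral_swap hKm.aemeasurable, lintegral_congr hright,
    lintegral_indicator measurableSet_Ioi, ← lintegral_gammaMeasure_one h7,
    lintegral_lintegral_swap (f := fun v u => f u v) (hf.comp measurable_swap).aemeasurable]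

/-- With `W_k = w + σ 0 + ⋯ + σ (k - 1)`, the normalized increments `(a + k) log (W_{k+1} / W_k)`. -/
def logIncrement (a w : ℝ) (σ : ℕ → ℝ) (k : ℕ) : ℝ :=
  (a + k) * Real.log ((w + ∑ l ∈ Finset.range (k + 1), σ l) / (w + ∑ l ∈ Finset.range k, σ l))

theorem measurable_logIncrement (a : ℝ) (k : ℕ) :
    Measurable fun p : ℝ × (ℕ → ℝ) => logIncrement a p.1 p.2 k := by
  unfold logIncrement
  fun_prop

/-- The sequence `y, σ 0, σ 1, …`. -/
def consSeq (y : ℝ) (σ : ℕ → ℝ) (k : ℕ) : ℝ :=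
  (if k = 0 then none else some (k - 1) : Option ℕ).elim y σ

theorem expField_consSeq : ((expMeasure 1).prod (expField ℕ)).map
    (fun p : ℝ × (ℕ → ℝ) => consSeq p.1 p.2) = expField ℕ :=
  expField_insert (g := fun k : ℕ => if k = 0 then none else some (k - 1)) (by
    intro i j h
    by_cases hi : i = 0 <;> by_cases hj : j = 0 <;> simp [hi, hj] at h ⊢
    omega)

theorem measurable_consSeq : Measurable fun p : ℝ × (ℕ → ℝ) => consSeq p.1 p.2 := by
  refine measurable_pi_lambda _ fun k => ?_
  cases k with
  | zero => exact measurable_fst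
  | succ k => exact (measurable_pi_apply k).comp measurable_snd

theorem logIncrement_consSeq_zero (a w y : ℝ) (σ : ℕ → ℝ) :
    logIncrement a w (consSeq y σ) 0 = a * Real.log ((w + y) / w) := by
  simp [logIncrement, consSeq]

/-- The self-similarity behind the induction: after the first waiting time `y`, the construction
restarts with `a + 1` and `w + y`. -/
theorem logIncrement_consSeq_succ (a w y : ℝ) (σ : ℕ → ℝ) (k : ℕ) :
    logIncrement a w (consSeq y σ) (k + 1) = logIncrement (a + 1) (w + y) σ k := by
  have h : ∀ n, w + ∑ l ∈ Finset.range (n + 1), consSeq y σ l =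
      w + y + ∑ l ∈ Finset.range n, σ l := by
    intro n
    rw [Finset.sum_range_succ', add_comm (∑ l ∈ _, _), ← add_assoc]
    simp [consSeq]
  rw [logIncrement, h, h, logIncrement]
  push_cast
  ring_nf

/-- Induction with `a` and the box generalised. By `lintegral_gamma_exp` the first increment is
exponential and independent of `w + y`, a Gamma variable of shape `a + 1`, from which the later
increments are formed in the same way. -/
theorem measure_logIncrement_box (n : ℕ) : ∀ {a : ℝ}, 0 < a → ∀ t : ℕ → Set ℝ,
    (∀ k, MeasurableSet (t k)) →
    (gammaMeasure a 1).prod (expField ℕ) {p | ∀ k < n, logIncrement a p.1 p.2 k ∈ t k} =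
      ∏ k ∈ Finset.range n, expMeasure 1 (t k) := by
  have hms : ∀ (n : ℕ) (a : ℝ) (t : ℕ → Set ℝ), (∀ k, MeasurableSet (t k)) →
      MeasurableSet {p : ℝ × (ℕ → ℝ) | ∀ k < n, logIncrement a p.1 p.2 k ∈ t k} := by
    intro n a t ht
    simp only [Set.ofPred_forall]
    exact MeasurableSet.iInter fun k => MeasurableSet.iInter fun _ =>
      (measurable_logIncrement a k) (ht k)
  induction n with
  | zero =>
    intro a ha t _
    have := isProbabilityMeasure_gammaMeasure ha one_pos
    simp
  | succ n ih =>
    intro a ha t ht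
    have := isProbabilityMeasure_gammaMeasure ha one_pos
    have h1 := ih (a := a + 1) (by linarith) (fun k => t (k + 1)) fun k => ht _
    have hms1 := hms n (a + 1) (fun k => t (k + 1)) fun k => ht _
    set B := {p : ℝ × (ℕ → ℝ) | ∀ k < n, logIncrement (a + 1) p.1 p.2 k ∈ t (k + 1)} with hB
    have h2 : ∀ w y σ, ((w, consSeq y σ) ∈
        {p : ℝ × (ℕ → ℝ) | ∀ k < n + 1, logIncrement a p.1 p.2 k ∈ t k}) ↔
        a * Real.log ((w + y) / w) ∈ t 0 ∧ (w + y, σ) ∈ B := by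
      intro w y σ
      simp only [hB, Set.mem_ofPred_eq]
      constructor
      · intro h
        refine ⟨?_, fun k hk => ?_⟩
        · rw [← logIncrement_consSeq_zero a w y σ]
          exact h 0 (Nat.succ_pos n)
        · rw [← logIncrement_consSeq_succ]
          exact h (k + 1) (by omega)
      · rintro ⟨h0, h⟩ k hk
        cases k with
        | zero => rwa [logIncrement_consSeq_zero]
        | succ k => rw [logIncrement_consSeq_succ]; exact h k (by omega)
    have hf : Measurable (Function.uncurry fun u v : ℝ =>
        (t 0).indicator (1 : ℝ → ℝ≥0∞) u * ∫⁻ σ, B.indicator 1 (v, σ) ∂expField ℕ) := by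
      refine ((measurable_one.indicator (ht 0)).comp measurable_fst).mul ?_
      exact ((measurable_one.indicator hms1).lintegral_prod_right').comp measurable_snd
    have hms2 := hms (n + 1) a t ht
    rw [← lintegral_indicator_one hms2, lintegral_prod _ (measurable_one.indicator hms2).aemeasurable]
    have h3 : ∀ w, ∫⁻ σ, {p : ℝ × (ℕ → ℝ) | ∀ k < n + 1, logIncrement a p.1 p.2 k ∈ t k}.indicator
        (1 : ℝ × (ℕ → ℝ) → ℝ≥0∞) (w, σ) ∂expField ℕ = ∫⁻ y, ((t 0).indicator (1 : ℝ → ℝ≥0∞)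
          (a * Real.log ((w + y) / w)) * ∫⁻ σ, B.indicator 1 (w + y, σ) ∂expField ℕ)
            ∂expMeasure 1 := by
      intro w
      have hm1 : Measurable fun σ => {p : ℝ × (ℕ → ℝ) | ∀ k < n + 1,
          logIncrement a p.1 p.2 k ∈ t k}.indicator (1 : ℝ × (ℕ → ℝ) → ℝ≥0∞) (w, σ) :=
        (measurable_one.indicator hms2).comp measurable_prodMk_left
      have hm2 : Measurable fun p : ℝ × (ℕ → ℝ) => {p : ℝ × (ℕ → ℝ) | ∀ k < n + 1,
          logIncrement a p.1 p.2 k ∈ t k}.indicator (1 : ℝ × (ℕ → ℝ) → ℝ≥0∞)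
            (w, consSeq p.1 p.2) := hm1.comp measurable_consSeq
      rw [← expField_consSeq, lintegral_map hm1 measurable_consSeq,
        lintegral_prod _ hm2.aemeasurable, expField_consSeq]
      refine lintegral_congr fun y => ?_
      have hm3 : Measurable fun σ => B.indicator (1 : ℝ × (ℕ → ℝ) → ℝ≥0∞) (w + y, σ) :=
        (measurable_one.indicator hms1).comp measurable_prodMk_left
      rw [← lintegral_const_mul _ hm3]
      refine lintegral_congr fun σ => ?_
      have := h2 w y σ
      by_cases h4 : a * Real.log ((w + y) / w) ∈ t 0
      · by_cases h5 : (w + y, σ) ∈ B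
        · have h6 := this.2 ⟨h4, h5⟩
          rw [Set.indicator_of_mem h6, Set.indicator_of_mem h4, Set.indicator_of_mem h5]
          simp
        · have h6 := fun h => h5 (this.1 h).2
          rw [Set.indicator_of_notMem h6, Set.indicator_of_notMem h5, mul_zero]
      · have h6 := fun h => h4 (this.1 h).1
        rw [Set.indicator_of_notMem h6, Set.indicator_of_notMem h4, zero_mul]
    rw [lintegral_congr h3, lintegral_gamma_exp ha hf]
    have h4 : ∫⁻ v, ∫⁻ σ, B.indicator 1 (v, σ) ∂expField ℕ ∂gammaMeasure (a + 1) 1 =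
        ∏ k ∈ Finset.range n, expMeasure 1 (t (k + 1)) := by
      rw [← h1, ← lintegral_indicator_one hms1,
        lintegral_prod _ (measurable_one.indicator hms1).aemeasurable]
    have h5 : Measurable fun v => ∫⁻ σ, B.indicator (1 : ℝ × (ℕ → ℝ) → ℝ≥0∞) (v, σ) ∂expField ℕ :=
      (measurable_one.indicator hms1).lintegral_prod_right'
    simp only [lintegral_const_mul _ h5, h4]
    rw [lintegral_mul_const _ (measurable_one.indicator (ht 0)), lintegral_indicator_one (ht 0),
      Finset.prod_range_succ', mul_comm]

/-- Kendall's theorem read from the Poisson side: a Gamma variable and independent exponential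
waiting times produce the normalised increments of a birth process. A box over a finite set of
indices is completed by `Set.univ` to a box over an initial segment. -/
theorem map_logIncrement {a : ℝ} (ha : 0 < a) :
    ((gammaMeasure a 1).prod (expField ℕ)).map
      (fun p k => logIncrement a p.1 p.2 k) = expField ℕ := by
  classical
  refine Measure.eq_infinitePi _ fun s t ht => ?_
  obtain ⟨n, hn⟩ := s.exists_nat_subset_range
  have h := measure_logIncrement_box n ha (fun k => if k ∈ s then t k else Set.univ) (fun k => by
    split_ifs
    · exact ht k
    · exact MeasurableSet.univ)
  rw [Measure.map_apply (measurable_pi_lambda _ fun k => measurable_logIncrement a k)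
    (MeasurableSet.pi s.countable_toSet fun i _ => ht i)]
  have h2 : ∏ k ∈ s, expMeasure 1 (t k) =
      ∏ k ∈ Finset.range n, expMeasure 1 (if k ∈ s then t k else Set.univ) := by
    rw [← Finset.prod_subset hn]
    · exact Finset.prod_congr rfl fun k hk => by rw [if_pos hk]
    · intro k _ hk
      rw [if_neg hk, measure_univ]
  rw [h2, ← h]
  congr 1
  · ext p
    simp only [Set.mem_preimage, Set.mem_pi, Finset.mem_coe, Set.mem_ofPred_eq]
    constructor
    · intro h k _
      split_ifs with hk
      · exact h k hk
      · trivial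
    · intro h k hk
      have := h k (Finset.mem_range.1 (hn hk))
      rwa [if_pos hk] at this

/-- `logIncrement` for a family of edges. -/
def logIncrements {E : Type*} (a : E → ℝ) (p : (E → ℝ) × (E × ℕ → ℝ)) (k : E × ℕ) : ℝ :=
  logIncrement (a k.1) (p.1 k.1) (fun l => p.2 (k.1, l)) k.2

theorem measurable_logIncrements {E : Type*} (a : E → ℝ) : Measurable (logIncrements a) := by
  refine measurable_pi_lambda _ fun k => ?_
  have : Measurable fun p : (E → ℝ) × (E × ℕ → ℝ) => (p.1 k.1, fun l => p.2 (k.1, l)) := by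
    refine Measurable.prodMk (by fun_prop) (measurable_pi_lambda _ fun l => by fun_prop)
  exact (measurable_logIncrement (a k.1) k.2).comp this

/-- Regrouping the product by edges, each edge carrying its conductance and its sequence of waiting
times, so that the one-edge statement can be applied in every factor. -/
theorem map_edgewise {E : Type*} {a : E → ℝ} (ha : ∀ e, 0 < a e) :
    ((gammaConductances a).prod (expField (E × ℕ))).map
      (fun p e => (p.1 e, fun k => p.2 (e, k))) =
      Measure.infinitePi fun e => (gammaMeasure (a e) 1).prod (expField ℕ) := by
  have := fun e => isProbabilityMeasure_gammaMeasure (ha e) one_pos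
  refine Measure.eq_infinitePi _ fun s t ht => ?_
  have hm : Measurable fun (p : (E → ℝ) × (E × ℕ → ℝ)) (e : E) => (p.1 e, fun k => p.2 (e, k)) :=
    measurable_pi_lambda _ fun e =>
      Measurable.prodMk (by fun_prop) (measurable_pi_lambda _ fun l => by fun_prop)
  have hbox := MeasurableSet.pi s.countable_toSet fun i (_ : i ∈ (s : Set E)) => ht i
  rw [Measure.map_apply hm hbox, Measure.prod_apply (hm hbox)]
  have hcurry : (expField (E × ℕ)).map (MeasurableEquiv.curry E ℕ ℝ) =
      Measure.infinitePi fun _ : E => expField ℕ :=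
    Measure.infinitePi_map_curry fun _ _ => expMeasure 1
  have h1 : ∀ w : E → ℝ, expField (E × ℕ) (Prod.mk w ⁻¹'
      ((fun (p : (E → ℝ) × (E × ℕ → ℝ)) (e : E) => (p.1 e, fun k => p.2 (e, k))) ⁻¹'
        (s : Set E).pi t)) = ∏ e ∈ s, expField ℕ (Prod.mk (w e) ⁻¹' t e) := by
    intro w
    rw [← Measure.infinitePi_pi (fun _ : E => expField ℕ) (s := s)
      (t := fun e => Prod.mk (w e) ⁻¹' t e) (fun e _ => measurable_prodMk_left (ht e)), ← hcurry,
      Measure.map_apply (MeasurableEquiv.measurable _)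
        (MeasurableSet.pi s.countable_toSet fun i _ => measurable_prodMk_left (ht i))]
    rfl
  rw [lintegral_congr h1, gammaConductances]
  have hmt : ∀ e, Measurable fun x => expField ℕ (Prod.mk x ⁻¹' t e) := fun e =>
    measurable_measure_prodMk_left (ht e)
  rw [lintegral_prod_eq_prod_lintegral_of_indepFun s
    (fun e (w : E → ℝ) => expField ℕ (Prod.mk (w e) ⁻¹' t e)) (iIndepFun_infinitePi hmt)
    (fun e => (hmt e).comp (measurable_pi_apply e))]
  refine Finset.prod_congr rfl fun e _ => ?_
  rw [Measure.prod_apply (ht e), ← Measure.infinitePi_map_eval (fun e => gammaMeasure (a e) 1) e,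
    lintegral_map (hmt e) (measurable_pi_apply e)]

theorem map_logIncrements {E : Type*} {a : E → ℝ} (ha : ∀ e, 0 < a e) :
    ((gammaConductances a).prod (expField (E × ℕ))).map (logIncrements a) = expField (E × ℕ) := by
  have := fun e => isProbabilityMeasure_gammaMeasure (ha e) one_pos
  have h1 := Measure.infinitePi_map_pi (fun e => (gammaMeasure (a e) 1).prod (expField ℕ))
    (f := fun e p k => logIncrement (a e) p.1 p.2 k)
    (fun e => measurable_pi_lambda _ fun k => measurable_logIncrement (a e) k)
  simp only [map_logIncrement (ha _)] at h1
  have h2 : (Measure.infinitePi fun _ : E => expField ℕ).map (MeasurableEquiv.curry E ℕ ℝ).symm =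
      expField (E × ℕ) := Measure.infinitePi_map_curry_symm fun _ _ => expMeasure 1
  have hm1 : Measurable fun (x : E → ℝ × (ℕ → ℝ)) (e : E) (k : ℕ) =>
      logIncrement (a e) (x e).1 (x e).2 k :=
    measurable_pi_lambda _ fun e => measurable_pi_lambda _ fun k =>
      (measurable_logIncrement (a e) k).comp (measurable_pi_apply e)
  have hm2 : Measurable fun (p : (E → ℝ) × (E × ℕ → ℝ)) (e : E) => (p.1 e, fun k => p.2 (e, k)) :=
    measurable_pi_lambda _ fun e =>
      Measurable.prodMk (by fun_prop) (measurable_pi_lambda _ fun l => by fun_prop)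
  rw [← map_edgewise ha, Measure.map_map hm1 hm2] at h1
  rw [← h1, Measure.map_map (MeasurableEquiv.measurable _) (hm1.comp hm2)] at h2
  exact h2

/-- The function `x * exp (-x)` is the density of the Gamma law of shape 2, which has mass one. -/
theorem lintegral_id_expMeasure_one : ∫⁻ x, ENNReal.ofReal x ∂expMeasure 1 = 1 := by
  have := isProbabilityMeasure_gammaMeasure (a := 2) two_pos one_pos
  have h := lintegral_gammaMeasure_one (a := 2) (f := fun _ => 1) measurable_const
  rw [lintegral_one, measure_univ] at h
  rw [lintegral_expMeasure_one (by fun_prop), h]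
  refine setLIntegral_congr_fun measurableSet_Ioi fun x hx => ?_
  have h2 : Real.Gamma 2 = 1 := by simp
  have h1 : (2 : ℝ) - 1 = 1 := by norm_num
  simp only [h2, h1, Real.rpow_one, div_one, mul_one]
  rw [← ENNReal.ofReal_mul (Real.exp_nonneg _), mul_comm]

theorem integrable_id_expMeasure_one : Integrable (fun x : ℝ => x) (expMeasure 1) := by
  refine ⟨by fun_prop, ?_⟩
  rw [hasFiniteIntegral_iff_ofReal (ae_pos_expMeasure_one.mono fun x hx => hx.le),
    lintegral_id_expMeasure_one]
  exact ENNReal.one_lt_top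

theorem integral_id_expMeasure_one : ∫ x, x ∂expMeasure 1 = 1 := by
  rw [integral_eq_lintegral_of_nonneg_ae (ae_pos_expMeasure_one.mono fun x hx => hx.le)
    (by fun_prop), lintegral_id_expMeasure_one, ENNReal.toReal_one]

theorem hasLaw_eval_expField {ι : Type*} (i : ι) :
    HasLaw (fun σ : ι → ℝ => σ i) (expMeasure 1) (expField ι) :=
  ⟨(measurable_pi_apply i).aemeasurable, Measure.infinitePi_map_eval _ i⟩

/-- The strong law of large numbers for the waiting times of one edge; it makes the conductance
recoverable from the alarms. -/
theorem expField_ae_tendsto_mean {E : Type*} (e : E) : ∀ᵐ σ ∂expField (E × ℕ),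
    Filter.Tendsto (fun n : ℕ => (∑ l ∈ Finset.range n, σ (e, l)) / (n : ℝ)) Filter.atTop (nhds 1) := by
  have hlaw := fun l : ℕ => hasLaw_eval_expField (e, l)
  have hint : Integrable (fun σ : E × ℕ → ℝ => σ (e, 0)) (expField (E × ℕ)) := by
    have h := integrable_id_expMeasure_one
    rw [← (hlaw 0).map_eq] at h
    exact h.comp_aemeasurable (hlaw 0).aemeasurable
  have hmean : ∫ σ, σ (e, 0) ∂expField (E × ℕ) = 1 := by
    have := integral_map (μ := expField (E × ℕ)) (hlaw 0).aemeasurable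
      (f := fun x : ℝ => x) (by fun_prop)
    rw [← this, (hlaw 0).map_eq, integral_id_expMeasure_one]
  have hind : iIndepFun (fun (k : E × ℕ) (σ : E × ℕ → ℝ) => σ k) (expField (E × ℕ)) :=
    iIndepFun_infinitePi (X := fun _ x => x) fun _ => measurable_id
  rw [← hmean]
  refine strong_law_ae_real (fun l (σ : E × ℕ → ℝ) => σ (e, l)) hint ?_ fun l => ?_
  · intro i j hij
    exact hind.indepFun (by simpa using hij)
  · exact ⟨(hlaw l).aemeasurable, (hlaw 0).aemeasurable, by rw [(hlaw l).map_eq, (hlaw 0).map_eq]⟩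

theorem expField_ae_pos {ι : Type*} [Countable ι] : ∀ᵐ σ ∂expField ι, ∀ i, 0 < σ i :=
  ae_all_iff.2 fun i => ae_of_ae_map (f := fun σ : ι → ℝ => σ i) (p := fun x => 0 < x)
    (measurable_pi_apply i).aemeasurable (by
      rw [(hasLaw_eval_expField i).map_eq]; exact ae_pos_expMeasure_one)

/-- The conductance of an edge as a function of its alarms: the limit of `n exp (- V_n)`. -/
def limitWeight (b : ℝ) (τ : ℕ → ℝ) : ℝ :=
  Filter.limsup (fun n : ℕ => n * Real.exp (-alarmTime b τ n)) Filter.atTop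

theorem measurable_limitWeight (b : ℝ) : Measurable (limitWeight b) := by
  unfold limitWeight alarmTime
  exact Measurable.limsup fun n => by fun_prop

/-- The conductances and, in the time scale of the Poisson processes, the successive waiting times
for the alarms. -/
def poissonClocks {E : Type*} (a : E → ℝ) (τ : E × ℕ → ℝ) : (E → ℝ) × (E × ℕ → ℝ) :=
  (fun e => limitWeight (a e) fun l => τ (e, l),
   fun k => limitWeight (a k.1) (fun l => τ (k.1, l)) *
    (Real.exp (alarmTime (a k.1) (fun l => τ (k.1, l)) (k.2 + 1)) -
      Real.exp (alarmTime (a k.1) (fun l => τ (k.1, l)) k.2)))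

theorem measurable_poissonClocks {E : Type*} (a : E → ℝ) : Measurable (poissonClocks a) := by
  have h1 : ∀ e : E, Measurable fun (τ : E × ℕ → ℝ) (l : ℕ) => τ (e, l) := fun e =>
    measurable_pi_lambda _ fun l => by fun_prop
  have h2 : ∀ e : E, Measurable fun τ : E × ℕ → ℝ => limitWeight (a e) fun l => τ (e, l) := fun e =>
    (measurable_limitWeight (a e)).comp (h1 e)
  have h3 : ∀ (b : ℝ) n, Measurable fun τ : ℕ → ℝ => alarmTime b τ n := fun b n => by
    unfold alarmTime; fun_prop
  refine Measurable.prodMk (measurable_pi_lambda _ h2) (measurable_pi_lambda _ fun k => ?_)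
  exact (h2 k.1).mul ((Real.measurable_exp.comp ((h3 _ _).comp (h1 k.1))).sub
    (Real.measurable_exp.comp ((h3 _ _).comp (h1 k.1))))

/-- The factors `a + k` cancel against those in `alarmTime`, and the sum of logarithms telescopes.
-/
theorem exp_alarmTime_logIncrement {a w : ℝ} (ha : 0 < a) (hw : 0 < w) {σ : ℕ → ℝ}
    (hσ : ∀ l, 0 < σ l) (k : ℕ) :
    Real.exp (alarmTime a (logIncrement a w σ) k) = (w + ∑ l ∈ Finset.range k, σ l) / w := by
  have hpos : ∀ k, 0 < w + ∑ l ∈ Finset.range k, σ l := fun k =>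
    add_pos_of_pos_of_nonneg hw (Finset.sum_nonneg fun l _ => (hσ l).le)
  induction k with
  | zero => simp [alarmTime, hw.ne']
  | succ k ih =>
    have h : alarmTime a (logIncrement a w σ) (k + 1) = alarmTime a (logIncrement a w σ) k +
        Real.log ((w + ∑ l ∈ Finset.range (k + 1), σ l) / (w + ∑ l ∈ Finset.range k, σ l)) := by
      have : a + (k : ℝ) ≠ 0 := by positivity
      rw [alarmTime, Finset.sum_range_succ, alarmTime, logIncrement]
      field_simp
    have h1 := hpos k
    rw [h, Real.exp_add, ih, Real.exp_log (div_pos (hpos _) h1)]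
    field_simp

/-- Since `exp V_n = W_n / W`, the conductance is the limit of `n * W / W_n` by the law of large
numbers. Once it is known, the differences of `W * exp V_k` give back the waiting times. -/
theorem poissonClocks_logIncrements {E : Type*} {a : E → ℝ} (ha : ∀ e, 0 < a e)
    {p : (E → ℝ) × (E × ℕ → ℝ)} (hw : ∀ e, 0 < p.1 e) (hσ : ∀ k, 0 < p.2 k)
    (hlim : ∀ e, Filter.Tendsto (fun n : ℕ => (∑ l ∈ Finset.range n, p.2 (e, l)) / n)
      Filter.atTop (nhds 1)) :
    poissonClocks a (logIncrements a p) = p := by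
  have h1 : ∀ e k, Real.exp (alarmTime (a e) (fun l => logIncrements a p (e, l)) k) =
      (p.1 e + ∑ l ∈ Finset.range k, p.2 (e, l)) / p.1 e := fun e k =>
    exp_alarmTime_logIncrement (ha e) (hw e) (fun l => hσ (e, l)) k
  have h2 : ∀ e, limitWeight (a e) (fun l => logIncrements a p (e, l)) = p.1 e := by
    intro e
    refine Filter.Tendsto.limsup_eq ?_
    -- `n * W / W_n` written as `W / (W / n + mean)`, where the mean of the waiting times tends to
    -- one.
    have h3 : Filter.Tendsto (fun n : ℕ => p.1 e / (p.1 e / n +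
        (∑ l ∈ Finset.range n, p.2 (e, l)) / n)) Filter.atTop (nhds (p.1 e / (0 + 1))) :=
      tendsto_const_nhds.div ((tendsto_const_div_atTop_nhds_zero_nat _).add (hlim e)) (by norm_num)
    rw [zero_add, div_one] at h3
    refine h3.congr' ?_
    filter_upwards [Filter.eventually_gt_atTop 0] with n hn
    have hn' : (0 : ℝ) < n := Nat.cast_pos.2 hn
    rw [Real.exp_neg, h1, inv_div]
    have h4 : 0 ≤ ∑ l ∈ Finset.range n, p.2 (e, l) := Finset.sum_nonneg fun l _ => (hσ _).le
    have h5 := hw e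
    field_simp
  refine Prod.ext (funext h2) (funext fun k => ?_)
  have h3 := (hw k.1).ne'
  simp only [poissonClocks, h1, h2, Finset.sum_range_succ]
  field_simp
  ring

section

variable {E : Type*} [Countable E] {a : E → ℝ}

theorem gammaConductances_ae_pos (ha : ∀ e, 0 < a e) :
    ∀ᵐ w ∂gammaConductances a, ∀ e, 0 < w e := by
  have := fun e => isProbabilityMeasure_gammaMeasure (ha e) one_pos
  exact ae_all_iff.2 fun e => ae_of_ae_map (f := fun w : E → ℝ => w e) (p := fun x => 0 < x)
    (measurable_pi_apply e).aemeasurable (by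
      rw [gammaConductances, Measure.infinitePi_map_eval]; exact ae_pos_gammaMeasure_one)

omit [Countable E] in
theorem isProbabilityMeasure_gammaConductances (ha : ∀ e, 0 < a e) :
    IsProbabilityMeasure (gammaConductances a) := by
  have := fun e => isProbabilityMeasure_gammaMeasure (ha e) one_pos
  unfold gammaConductances
  infer_instance

theorem ae_poissonClocks_logIncrements (ha : ∀ e, 0 < a e) :
    ∀ᵐ p ∂(gammaConductances a).prod (expField (E × ℕ)), (∀ e, 0 < p.1 e) ∧ (∀ k, 0 < p.2 k) ∧
      poissonClocks a (logIncrements a p) = p := by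
  have := isProbabilityMeasure_gammaConductances ha
  have h1 : ∀ᵐ p ∂(gammaConductances a).prod (expField (E × ℕ)), ∀ e, 0 < p.1 e :=
    Measure.quasiMeasurePreserving_fst.ae (gammaConductances_ae_pos ha)
  have h2 : ∀ᵐ p ∂(gammaConductances a).prod (expField (E × ℕ)), ∀ k, 0 < p.2 k :=
    Measure.quasiMeasurePreserving_snd.ae expField_ae_pos
  have h3 : ∀ᵐ p ∂(gammaConductances a).prod (expField (E × ℕ)), ∀ e,
      Filter.Tendsto (fun n : ℕ => (∑ l ∈ Finset.range n, p.2 (e, l)) / (n : ℝ))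
        Filter.atTop (nhds 1) :=
    Measure.quasiMeasurePreserving_snd.ae (ae_all_iff.2 fun e => expField_ae_tendsto_mean e)
  filter_upwards [h1, h2, h3] with p h1 h2 h3
  exact ⟨h1, h2, poissonClocks_logIncrements ha h1 h2 h3⟩

/-- **Kendall's theorem** for the pure birth processes of all edges: conductances and Poisson waiting
times are independent, Gamma and exponential, respectively. -/
theorem map_poissonClocks (ha : ∀ e, 0 < a e) :
    (expField (E × ℕ)).map (poissonClocks a) = (gammaConductances a).prod (expField (E × ℕ)) := by
  -- Realise the exponential variables of the alarms as `logIncrements` of Gamma conductances and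
  -- Poisson waiting times; `poissonClocks` almost surely undoes this.
  rw [← map_logIncrements ha, Measure.map_map (measurable_poissonClocks a)
    (measurable_logIncrements a), map_logIncrements ha]
  conv_rhs => rw [← Measure.map_id (μ := (gammaConductances a).prod (expField (E × ℕ)))]
  refine Measure.map_congr ?_
  filter_upwards [ae_poissonClocks_logIncrements ha] with p hp
  exact hp.2.2

/-- An almost sure left inverse of `logIncrements` is also an almost sure right inverse for the
image law, and by `map_logIncrements` that law is the exponential one. -/
theorem ae_logIncrements_poissonClocks (ha : ∀ e, 0 < a e) :
    ∀ᵐ τ ∂expField (E × ℕ), logIncrements a (poissonClocks a τ) = τ := by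
  have hm : MeasurableSet {τ : E × ℕ → ℝ | logIncrements a (poissonClocks a τ) = τ} :=
    measurableSet_eq_fun ((measurable_logIncrements a).comp (measurable_poissonClocks a))
      measurable_id
  rw [← map_logIncrements ha, ae_map_iff (measurable_logIncrements a).aemeasurable hm]
  filter_upwards [ae_poissonClocks_logIncrements ha] with p hp
  rw [hp.2.2]

end

/-! ### Measurability and inversion of the time change -/

theorem measurable_intervalIntegral_right {Z : Type*} [MeasurableSpace Z] {f : Z × ℝ → ℝ}
    (hf : Measurable f) : Measurable fun p : Z × ℝ => ∫ u in (0 : ℝ)..p.2, f (p.1, u) := by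
  have key : ∀ B : Set ((Z × ℝ) × ℝ), MeasurableSet B → (∀ p, MeasurableSet (Prod.mk p ⁻¹' B)) →
      Measurable fun p : Z × ℝ => ∫ u in Prod.mk p ⁻¹' B, f (p.1, u) := by
    intro B hB hB'
    have h1 : Measurable fun q : (Z × ℝ) × ℝ => B.indicator (fun q => f (q.1.1, q.2)) q :=
      Measurable.indicator (by fun_prop) hB
    have h2 := h1.stronglyMeasurable.integral_prod_right' (ν := volume)
    convert h2.measurable using 2 with p
    rw [← integral_indicator (hB' p)]
    rfl
  simp only [intervalIntegral]
  refine Measurable.sub ?_ ?_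
  · have h : MeasurableSet {q : (Z × ℝ) × ℝ | 0 < q.2 ∧ q.2 ≤ q.1.2} :=
      (measurableSet_lt measurable_const measurable_snd).inter
        (measurableSet_le measurable_snd (by fun_prop))
    exact key _ h fun p => measurable_prodMk_left h
  · have h : MeasurableSet {q : (Z × ℝ) × ℝ | q.1.2 < q.2 ∧ q.2 ≤ 0} :=
      (measurableSet_lt (by fun_prop) measurable_snd).inter
        (measurableSet_le measurable_snd measurable_const)
    exact key _ h fun p => measurable_prodMk_left h

/-- The path with the sequence `z` of positions and holding times. -/
def pathOf {V : Type*} (z : ℕ → V × ℝ) : ℝ → Option V :=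
  jumpPath (fun n => (z n).1) (fun n => (z n).2)

section Measurability

variable {V : Type*} [Countable V] [MeasurableSpace V] [DiscreteMeasurableSpace V]

omit [Countable V] [DiscreteMeasurableSpace V] in
theorem measurable_jumpTime (n : ℕ) :
    Measurable fun z : ℕ → V × ℝ => jumpTime (fun n => (z n).2) n := by
  unfold jumpTime
  fun_prop

theorem measurable_pathOf : Measurable fun p : (ℕ → V × ℝ) × ℝ => pathOf p.1 p.2 := by
  classical
  set Q : ℕ → Set ((ℕ → V × ℝ) × ℝ) := fun n =>
    {p | jumpTime (fun n => (p.1 n).2) n ≤ p.2 ∧ p.2 < jumpTime (fun n => (p.1 n).2) (n + 1)} with hQ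
  have hQm : ∀ n, MeasurableSet (Q n) := fun n =>
    (measurableSet_le ((measurable_jumpTime n).comp measurable_fst) measurable_snd).inter
      (measurableSet_lt measurable_snd ((measurable_jumpTime (n + 1)).comp measurable_fst))
  refine measurable_to_countable' fun x => ?_
  cases x with
  | none =>
    have : (fun p : (ℕ → V × ℝ) × ℝ => pathOf p.1 p.2) ⁻¹' {none} = (⋃ n, Q n)ᶜ := by
      ext p
      simp only [Set.mem_preimage, Set.mem_singleton_iff, Set.mem_compl_iff, Set.mem_iUnion]
      unfold pathOf jumpPath
      split_ifs with h
      · simpa [hQ] using h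
      · simpa [hQ] using h
    rw [this]
    exact (MeasurableSet.iUnion hQm).compl
  | some x =>
    -- Holding times may be negative here, so the holding intervals may overlap; `jumpPath` uses the
    -- first one that contains the time, which is why earlier intervals are removed.
    have : (fun p : (ℕ → V × ℝ) × ℝ => pathOf p.1 p.2) ⁻¹' {some x} =
        ⋃ n, (Q n ∩ ⋂ m ∈ Finset.range n, (Q m)ᶜ) ∩ {p | (p.1 n).1 = x} := by
      ext p
      simp only [Set.mem_preimage, Set.mem_singleton_iff, Set.mem_iUnion, Set.mem_inter_iff,
        Set.mem_iInter, Set.mem_compl_iff, Finset.mem_range]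
      unfold pathOf jumpPath
      split_ifs with h
      · rw [Option.some_inj]
        constructor
        · intro hx
          exact ⟨Nat.find h, ⟨Nat.find_spec h, fun m hm => Nat.find_min h hm⟩, hx⟩
        · rintro ⟨n, ⟨hn, hmin⟩, hx⟩
          rwa [(Nat.find_eq_iff h).2 ⟨hn, hmin⟩]
      · constructor
        · intro h'
          cases h'
        · rintro ⟨n, ⟨hn, _⟩, _⟩
          exact (h ⟨n, hn⟩).elim
    rw [this]
    refine MeasurableSet.iUnion fun n => MeasurableSet.inter ?_ ?_
    · exact (hQm n).inter (Finset.measurableSet_biInter _ fun m _ => (hQm m).compl)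
    · have h1 : Measurable fun p : (ℕ → V × ℝ) × ℝ => (p.1 n).1 := by fun_prop
      exact h1 (MeasurableSet.of_discrete (s := {x}))

omit [Countable V] [MeasurableSpace V] [DiscreteMeasurableSpace V] in
theorem localTime_eq_integral_indicator (y : ℝ → Option V) (x : Option V) (t : ℝ) :
    localTime y x t = ∫ u in (0 : ℝ)..t, {u | y u = x}.indicator 1 u := by
  classical
  unfold localTime
  congr 1

theorem measurableSet_pathOf_eq (x : Option V) :
    MeasurableSet {p : (ℕ → V × ℝ) × ℝ | pathOf p.1 p.2 = x} :=
  measurable_pathOf (MeasurableSet.of_discrete (s := {x}))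

theorem measurableSet_pathOf_eq' (z : ℕ → V × ℝ) (x : Option V) :
    MeasurableSet {u | pathOf z u = x} :=
  measurable_prodMk_left (x := z) (measurableSet_pathOf_eq x)

theorem measurable_localTime (x : Option V) :
    Measurable fun p : (ℕ → V × ℝ) × ℝ => localTime (pathOf p.1) x p.2 := by
  simp only [localTime_eq_integral_indicator]
  exact measurable_intervalIntegral_right (measurable_one.indicator (measurableSet_pathOf_eq x))

theorem measurable_inv_localTime : Measurable fun p : (ℕ → V × ℝ) × ℝ =>
    1 / (1 + localTime (pathOf p.1) (pathOf p.1 p.2) p.2) :=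
  measurable_of_countable_selector (e := fun p : (ℕ → V × ℝ) × ℝ => pathOf p.1 p.2)
    (f := fun x p => 1 / (1 + localTime (pathOf p.1) x p.2))
    measurableSet_pathOf_eq fun x => ((measurable_localTime x).const_add 1).const_div 1

theorem measurable_additiveFunctional :
    Measurable fun p : (ℕ → V × ℝ) × ℝ => additiveFunctional (pathOf p.1) p.2 :=
  measurable_intervalIntegral_right
    (f := fun p => 1 / (1 + localTime (pathOf p.1) (pathOf p.1 p.2) p.2)) measurable_inv_localTime

theorem localTime_mem_Icc (z : ℕ → V × ℝ) (x : Option V) {t : ℝ} (ht : 0 ≤ t) :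
    localTime (pathOf z) x t ∈ Set.Icc 0 t := by
  have hb : ∀ u, {u | pathOf z u = x}.indicator (1 : ℝ → ℝ) u ∈ Set.Icc 0 1 := fun u =>
    ⟨Set.indicator_nonneg (fun _ _ => zero_le_one) u,
      Set.indicator_le_self' (fun _ _ => zero_le_one) u⟩
  have hm : Measurable ({u | pathOf z u = x}.indicator (1 : ℝ → ℝ)) :=
    measurable_one.indicator (measurableSet_pathOf_eq' z x)
  have hint : IntervalIntegrable ({u | pathOf z u = x}.indicator (1 : ℝ → ℝ)) volume 0 t := by
    refine (intervalIntegrable_const (c := (1 : ℝ))).mono_fun' hm.aestronglyMeasurable ?_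
    refine Filter.Eventually.of_forall fun u => ?_
    beta_reduce
    rw [Real.norm_eq_abs, abs_of_nonneg (hb u).1]
    exact (hb u).2
  rw [localTime_eq_integral_indicator]
  constructor
  · exact intervalIntegral.integral_nonneg ht fun u _ => (hb u).1
  · have := intervalIntegral.integral_mono_on ht hint (intervalIntegrable_const (c := (1 : ℝ)))
      fun u _ => (hb u).2
    simpa using this

/-- The integrand of the additive functional of a path. -/
def inverseLocalTime {α : Type*} (y : ℝ → α) (u : ℝ) : ℝ := 1 / (1 + localTime y (y u) u)

/-- A local time up to `u` lies between `0` and `u`. These bounds make the additive functional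
1-Lipschitz, strictly increasing and unbounded, also beyond explosion, since the cemetery has a
local time too. -/
theorem inverseLocalTime_bounds (z : ℕ → V × ℝ) {u : ℝ} (hu : 0 ≤ u) :
    1 / (1 + u) ≤ inverseLocalTime (pathOf z) u ∧ inverseLocalTime (pathOf z) u ≤ 1 := by
  have h := localTime_mem_Icc z (pathOf z u) hu
  constructor
  · exact one_div_le_one_div_of_le (by linarith [h.1]) (by linarith [h.2])
  · rw [inverseLocalTime, div_le_one (by linarith [h.1])]
    linarith [h.1]

theorem intervalIntegrable_inverseLocalTime (z : ℕ → V × ℝ) {s t : ℝ} (hs : 0 ≤ s) (hst : s ≤ t) :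
    IntervalIntegrable (inverseLocalTime (pathOf z)) volume s t := by
  have hm : Measurable (inverseLocalTime (pathOf z)) :=
    measurable_inv_localTime.comp (g := fun p : (ℕ → V × ℝ) × ℝ =>
    1 / (1 + localTime (pathOf p.1) (pathOf p.1 p.2) p.2)) (f := fun u => (z, u))
    measurable_prodMk_left
  refine (intervalIntegrable_const (c := (1 : ℝ))).mono_fun' hm.aestronglyMeasurable ?_
  filter_upwards [ae_restrict_mem measurableSet_uIoc] with u hu
  rw [Set.uIoc_of_le hst] at hu
  have hu0 : 0 ≤ u := hs.trans hu.1.le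
  have h0 : 0 < 1 / (1 + u) := by positivity
  have hb := inverseLocalTime_bounds z hu0
  rw [Real.norm_eq_abs, abs_of_nonneg (h0.le.trans hb.1)]
  exact hb.2

theorem additiveFunctional_sub_eq (z : ℕ → V × ℝ) {s t : ℝ} (hs : 0 ≤ s) (hst : s ≤ t) :
    additiveFunctional (pathOf z) t - additiveFunctional (pathOf z) s =
      ∫ u in s..t, inverseLocalTime (pathOf z) u :=
  intervalIntegral.integral_interval_sub_left
    (intervalIntegrable_inverseLocalTime z le_rfl (hs.trans hst))
    (intervalIntegrable_inverseLocalTime z le_rfl hs)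

theorem additiveFunctional_sub_mem_Icc (z : ℕ → V × ℝ) {s t : ℝ} (hs : 0 ≤ s) (hst : s ≤ t) :
    additiveFunctional (pathOf z) t - additiveFunctional (pathOf z) s ∈
      Set.Icc ((t - s) / (1 + t)) (t - s) := by
  have hint := intervalIntegrable_inverseLocalTime z hs hst
  have hb := fun u (hu : 0 ≤ u) => inverseLocalTime_bounds z hu
  rw [additiveFunctional_sub_eq z hs hst]
  constructor
  · have := intervalIntegral.integral_mono_on hst (intervalIntegrable_const (c := 1 / (1 + t)))
      hint fun u hu => (one_div_le_one_div_of_le (by linarith [hu.1])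
        (by linarith [hu.2])).trans (hb u (hs.trans hu.1)).1
    rw [intervalIntegral.integral_const, smul_eq_mul] at this
    rwa [div_eq_mul_one_div]
  · have := intervalIntegral.integral_mono_on hst hint
      (intervalIntegrable_const (c := (1 : ℝ))) fun u hu => (hb u (hs.trans hu.1)).2
    simpa using this

theorem additiveFunctional_mono (z : ℕ → V × ℝ) {s t : ℝ} (hs : 0 ≤ s) (hst : s ≤ t) :
    additiveFunctional (pathOf z) s ≤ additiveFunctional (pathOf z) t := by
  have h := (additiveFunctional_sub_mem_Icc z hs hst).1
  have : 0 ≤ (t - s) / (1 + t) := div_nonneg (by linarith) (by linarith)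
  linarith

theorem additiveFunctional_lt (z : ℕ → V × ℝ) {s t : ℝ} (hs : 0 ≤ s) (hst : s < t) :
    additiveFunctional (pathOf z) s < additiveFunctional (pathOf z) t := by
  have h := (additiveFunctional_sub_mem_Icc z hs hst.le).1
  have : 0 < (t - s) / (1 + t) := div_pos (by linarith) (by linarith)
  linarith

theorem exists_le_additiveFunctional (z : ℕ → V × ℝ) (t : ℝ) :
    ∃ s, 0 ≤ s ∧ t ≤ additiveFunctional (pathOf z) s := by
  have h : ∀ k : ℕ, ∃ s, 0 ≤ s ∧ (k : ℝ) / 2 ≤ additiveFunctional (pathOf z) s := by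
    intro k
    induction k with
    | zero => exact ⟨0, le_rfl, by simp [additiveFunctional]⟩
    | succ k ih =>
      obtain ⟨s, hs, hk⟩ := ih
      -- From `s` to `2 * s + 1` the functional gains at least `(s + 1) / (2 * s + 2) = 1 / 2`, so
      -- it is unbounded although its integrand may decay.
      have h := (additiveFunctional_sub_mem_Icc z hs (by linarith : s ≤ 2 * s + 1)).1
      have h2 : (2 * s + 1 - s) / (1 + (2 * s + 1)) = 1 / 2 := by
        field_simp
        ring
      rw [h2] at h
      refine ⟨2 * s + 1, by linarith, ?_⟩
      push_cast
      linarith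
  obtain ⟨k, hk⟩ := exists_nat_ge (2 * t)
  obtain ⟨s, hs, hks⟩ := h k
  exact ⟨s, hs, by linarith⟩

/-- The generalized inverse of the additive functional. -/
def inverseFunctional {α : Type*} (y : ℝ → α) (t : ℝ) : ℝ :=
  sInf {s : ℝ | 0 ≤ s ∧ t ≤ additiveFunctional y s}

/-- The infimum is attained because the functional is continuous; its 1-Lipschitz bound is used with
an arbitrary `ε`. -/
theorem inverseFunctional_le_iff (z : ℕ → V × ℝ) {s t : ℝ} (hs : 0 ≤ s) :
    inverseFunctional (pathOf z) t ≤ s ↔ t ≤ additiveFunctional (pathOf z) s := by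
  set T := {s : ℝ | 0 ≤ s ∧ t ≤ additiveFunctional (pathOf z) s} with hT
  have hbdd : BddBelow T := ⟨0, fun x hx => hx.1⟩
  constructor
  · intro h
    refine le_of_forall_pos_le_add fun ε hε => ?_
    obtain ⟨r, hr, hrs⟩ := exists_lt_of_csInf_lt (exists_le_additiveFunctional z t)
      (lt_of_le_of_lt h (by linarith : s < s + ε))
    have h1 := (additiveFunctional_sub_mem_Icc z hs (by linarith : s ≤ s + ε)).2
    have h2 := additiveFunctional_mono z hr.1 hrs.le
    linarith [hr.2]
  · intro h
    exact csInf_le hbdd ⟨hs, h⟩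

theorem inverseFunctional_nonneg {α : Type*} (y : ℝ → α) (t : ℝ) : 0 ≤ inverseFunctional y t :=
  Real.sInf_nonneg fun _ hx => hx.1

theorem additiveFunctional_inverseFunctional (z : ℕ → V × ℝ) {t : ℝ} (ht : 0 ≤ t) :
    additiveFunctional (pathOf z) (inverseFunctional (pathOf z) t) = t := by
  set s := inverseFunctional (pathOf z) t with hs
  have hs0 : 0 ≤ s := inverseFunctional_nonneg _ _
  have h1 : t ≤ additiveFunctional (pathOf z) s := (inverseFunctional_le_iff z hs0).1 le_rfl
  refine le_antisymm (not_lt.1 fun hlt => ?_) h1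
  have hpos : 0 < s := by
    refine hs0.lt_of_ne fun h0 => ?_
    rw [← h0] at hlt
    simp only [additiveFunctional, intervalIntegral.integral_same] at hlt
    linarith
  -- If the functional exceeded `t` at `s`, one could step back by the excess and, by the
  -- 1-Lipschitz bound, still be at `t` or above, against the minimality of `s`.
  set r := max 0 (s - (additiveFunctional (pathOf z) s - t)) with hr
  have hrs : r < s := max_lt hpos (by linarith)
  have hr0 : 0 ≤ r := le_max_left _ _
  have h2 := (additiveFunctional_sub_mem_Icc z hr0 hrs.le).2
  have h3 : s - (additiveFunctional (pathOf z) s - t) ≤ r := le_max_right _ _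
  have h4 := (inverseFunctional_le_iff z hr0).2 (by linarith : t ≤ additiveFunctional (pathOf z) r)
  linarith

theorem le_inverseFunctional_iff (z : ℕ → V × ℝ) {s t : ℝ} (hs : 0 ≤ s) (ht : 0 ≤ t) :
    s ≤ inverseFunctional (pathOf z) t ↔ additiveFunctional (pathOf z) s ≤ t := by
  have h := additiveFunctional_inverseFunctional z ht
  constructor
  · intro hst
    exact (additiveFunctional_mono z hs hst).trans_eq h
  · intro hst
    refine not_lt.1 fun hlt => ?_
    have := additiveFunctional_lt z (inverseFunctional_nonneg _ _) hlt
    linarith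

/-- Sublevel sets of the inverse functional are superlevel sets of the functional at a fixed time,
hence measurable; the path is then evaluated at a measurable random time. -/
theorem measurable_timeChangedPath :
    Measurable (timeChangedPath : (ℕ → V × ℝ) → (ℝ≥0 → Option V)) := by
  refine measurable_pi_lambda _ fun t => ?_
  have h : Measurable fun z : ℕ → V × ℝ => inverseFunctional (pathOf z) (t : ℝ) := by
    refine measurable_of_Iic fun s => ?_
    by_cases hs : 0 ≤ s
    · have : (fun z : ℕ → V × ℝ => inverseFunctional (pathOf z) (t : ℝ)) ⁻¹' Set.Iic s =
          {z | (t : ℝ) ≤ additiveFunctional (pathOf z) s} := by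
        ext z
        exact inverseFunctional_le_iff z hs
      rw [this]
      exact measurableSet_le measurable_const
        (measurable_additiveFunctional.comp (g := fun p : (ℕ → V × ℝ) × ℝ =>
          additiveFunctional (pathOf p.1) p.2) (f := fun z => (z, s)) measurable_prodMk_right)
    · convert MeasurableSet.empty
      refine Set.eq_empty_of_forall_notMem fun z hz => hs ?_
      exact (inverseFunctional_nonneg (pathOf z) (t : ℝ)).trans hz
  exact measurable_pathOf.comp (g := fun p : (ℕ → V × ℝ) × ℝ => pathOf p.1 p.2)
    (f := fun z => (z, inverseFunctional (pathOf z) (t : ℝ))) (measurable_id.prodMk h)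

end Measurability

/-! ### Local times and time change of jump paths -/

section Path

variable {V : Type*}

theorem jumpTime_succ (S : ℕ → ℝ) (n : ℕ) : jumpTime S (n + 1) = jumpTime S n + S n :=
  Finset.sum_range_succ _ _

theorem jumpTime_mono {S : ℕ → ℝ} {m n : ℕ} (hS : ∀ k < n, 0 < S k) (hmn : m ≤ n) :
    jumpTime S m ≤ jumpTime S n :=
  Finset.sum_le_sum_of_subset_of_nonneg (Finset.range_mono hmn) fun k hk _ =>
    (hS k (Finset.mem_range.1 hk)).le

theorem jumpTime_nonneg {S : ℕ → ℝ} {n : ℕ} (hS : ∀ k < n, 0 < S k) : 0 ≤ jumpTime S n :=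
  jumpTime_mono hS (Nat.zero_le n)

/-- Only the holding times before `n` have to be positive. This allows positivity of all holding
times to be proved later by induction on `n`. -/
theorem jumpPath_eq_some {ξ : ℕ → V} {S : ℕ → ℝ} {n : ℕ} (hS : ∀ k < n, 0 < S k) {t : ℝ}
    (h1 : jumpTime S n ≤ t) (h2 : t < jumpTime S (n + 1)) : jumpPath ξ S t = some (ξ n) := by
  classical
  have h : ∃ n, jumpTime S n ≤ t ∧ t < jumpTime S (n + 1) := ⟨n, h1, h2⟩
  rw [jumpPath, dif_pos h, (Nat.find_eq_iff h).2 ⟨⟨h1, h2⟩, fun m hm hm' => ?_⟩]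
  exact absurd ((jumpTime_mono hS hm).trans h1) (not_le.2 hm'.2)

open Classical in
/-- The time spent at `x` before the `n`-th jump. -/
def occupation (ξ : ℕ → V) (S : ℕ → ℝ) (x : V) (n : ℕ) : ℝ :=
  ∑ k ∈ Finset.range n, if ξ k = x then S k else 0

theorem occupation_succ (ξ : ℕ → V) (S : ℕ → ℝ) (x : V) (n : ℕ) [Decidable (ξ n = x)] :
    occupation ξ S x (n + 1) = occupation ξ S x n + if ξ n = x then S n else 0 := by
  rw [occupation, Finset.sum_range_succ]
  congr

theorem occupation_nonneg {ξ : ℕ → V} {S : ℕ → ℝ} {x : V} {n : ℕ} (hS : ∀ k < n, 0 < S k) :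
    0 ≤ occupation ξ S x n :=
  Finset.sum_nonneg fun k hk => by
    split_ifs
    · exact (hS k (Finset.mem_range.1 hk)).le
    · exact le_rfl

theorem integral_congr_Ioo {f g : ℝ → ℝ} {a b : ℝ} (hab : a ≤ b)
    (h : ∀ t, a ≤ t → t < b → f t = g t) : ∫ t in a..b, f t = ∫ t in a..b, g t := by
  refine intervalIntegral.integral_congr_ae ?_
  filter_upwards [(Measure.ae_ne volume b)] with t ht hm
  rw [Set.uIoc_of_le hab] at hm
  exact h t hm.1.le (lt_of_le_of_ne hm.2 ht)

theorem intervalIntegrable_congr_Ioo {f g : ℝ → ℝ} {a b : ℝ} (hab : a ≤ b)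
    (h : ∀ t, a ≤ t → t < b → f t = g t) (hg : IntervalIntegrable g volume a b) :
    IntervalIntegrable f volume a b := by
  refine hg.congr_ae ?_
  rw [Set.uIoc_of_le hab]
  refine (ae_restrict_iff' measurableSet_Ioc).2 ?_
  filter_upwards [(Measure.ae_ne volume b)] with t ht hm
  exact (h t hm.1.le (lt_of_le_of_ne hm.2 ht)).symm

theorem localTime_jumpPath {ξ : ℕ → V} {S : ℕ → ℝ} {n : ℕ} (hS : ∀ k < n, 0 < S k) (x : V)
    [Decidable (ξ n = x)] {u : ℝ} (hu : 0 ≤ u) (huS : u ≤ S n) :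
    localTime (jumpPath ξ S) (some x) (jumpTime S n + u) =
      occupation ξ S x n + if ξ n = x then u else 0 := by
  classical
  set f : ℝ → ℝ := {t | jumpPath ξ S t = some x}.indicator 1 with hf
  have hpiece : ∀ m, (∀ k < m, 0 < S k) → ∀ v, 0 ≤ v → v ≤ S m → ∀ t, jumpTime S m ≤ t →
      t < jumpTime S m + v → f t = if ξ m = x then 1 else 0 := by
    intro m hm v hv hvS t h1 h2
    have := jumpPath_eq_some (ξ := ξ) hm h1 (by rw [jumpTime_succ]; linarith)
    simp [hf, Set.indicator_apply, this]
  have hI : ∀ m, (∀ k < m, 0 < S k) → ∀ v, 0 ≤ v → v ≤ S m →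
      IntervalIntegrable f volume (jumpTime S m) (jumpTime S m + v) ∧
      ∫ t in jumpTime S m..jumpTime S m + v, f t = if ξ m = x then v else 0 := by
    intro m hm v hv hvS
    refine ⟨intervalIntegrable_congr_Ioo (by linarith) (hpiece m hm v hv hvS)
      intervalIntegrable_const, ?_⟩
    rw [integral_congr_Ioo (by linarith) (hpiece m hm v hv hvS), intervalIntegral.integral_const]
    split_ifs <;> simp
  have hJ : ∀ m, (∀ k < m, 0 < S k) → IntervalIntegrable f volume 0 (jumpTime S m) ∧
      ∫ t in (0 : ℝ)..jumpTime S m, f t = occupation ξ S x m := by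
    intro m
    induction m with
    | zero => intro _; simp [jumpTime, occupation]
    | succ m ih =>
      intro hm
      have hm' : ∀ k < m, 0 < S k := fun k hk => hm k (by omega)
      obtain ⟨h1, h2⟩ := ih hm'
      obtain ⟨h3, h4⟩ := hI m hm' (S m) (hm m (by omega)).le le_rfl
      rw [jumpTime_succ, occupation_succ]
      exact ⟨h1.trans h3, by
        rw [← intervalIntegral.integral_add_adjacent_intervals h1 h3, h2, h4]⟩
  obtain ⟨h1, h2⟩ := hJ n hS
  obtain ⟨h3, h4⟩ := hI n hS u hu huS
  rw [localTime_eq_integral_indicator, ← intervalIntegral.integral_add_adjacent_intervals h1 h3, h2,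
    h4]
  congr

/-- The holding times of the time-changed path. -/
def logHolding (ξ : ℕ → V) (Y : ℕ → ℝ) (n : ℕ) : ℝ :=
  Real.log ((1 + occupation ξ Y (ξ n) n + Y n) / (1 + occupation ξ Y (ξ n) n))

theorem integral_inv_add {L a v : ℝ} (hL : 0 < L) (hv : 0 ≤ v) :
    ∫ u in a..a + v, 1 / (L + (u - a)) = Real.log ((L + v) / L) := by
  have hpos : ∀ u ∈ Set.uIcc a (a + v), 0 < L + (u - a) := by
    intro u hu
    rw [Set.uIcc_of_le (by linarith)] at hu
    linarith [hu.1]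
  rw [intervalIntegral.integral_eq_sub_of_hasDerivAt (f := fun u => Real.log (L + (u - a)))]
  · rw [Real.log_div (by linarith) hL.ne']
    simp
  · intro u hu
    exact (((hasDerivAt_id u).sub_const a).const_add L).log (hpos u hu).ne'
  · refine ContinuousOn.intervalIntegrable fun u hu => ContinuousAt.continuousWithinAt ?_
    exact continuousAt_const.div (by fun_prop) (hpos u hu).ne'

variable [Countable V] [MeasurableSpace V] [DiscreteMeasurableSpace V]

/-- While the path sits at `ξ n`, the quantity `L` of this vertex grows with slope one, so the
integral of `1 / L` over the holding time is the logarithm of a quotient, namely `logHolding`. -/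
theorem additiveFunctional_jumpTime (ξ : ℕ → V) {Y : ℕ → ℝ} (hY : ∀ n, 0 < Y n) (n : ℕ) :
    additiveFunctional (jumpPath ξ Y) (jumpTime Y n) = jumpTime (logHolding ξ Y) n := by
  induction n with
  | zero => simp [jumpTime, additiveFunctional]
  | succ n ih =>
    have h0 := jumpTime_nonneg (n := n) fun k _ => hY k
    have h1 := additiveFunctional_sub_eq (fun n => (ξ n, Y n)) h0
      (by rw [jumpTime_succ]; linarith [hY n] : jumpTime Y n ≤ jumpTime Y (n + 1))
    change additiveFunctional (jumpPath ξ Y) _ - additiveFunctional (jumpPath ξ Y) _ =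
      ∫ u in _.._, inverseLocalTime (jumpPath ξ Y) u at h1
    rw [jumpTime_succ (logHolding ξ Y), ← ih, ← sub_eq_iff_eq_add', h1, jumpTime_succ,
      integral_congr_Ioo (g := fun u => 1 / (1 + occupation ξ Y (ξ n) n + (u - jumpTime Y n)))
      (by linarith [hY n])]
    · exact integral_inv_add (by
        have := occupation_nonneg (ξ := ξ) (x := ξ n) (n := n) fun k _ => hY k
        linarith) (hY n).le
    · intro u hu1 hu2
      classical
      rw [inverseLocalTime, jumpPath_eq_some (fun k _ => hY k) hu1 (by rwa [jumpTime_succ])]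
      have := localTime_jumpPath (ξ := ξ) (n := n) (fun k _ => hY k) (ξ n)
        (u := u - jumpTime Y n) (by linarith) (by linarith)
      rw [add_sub_cancel, if_pos rfl] at this
      rw [this, add_assoc]

/-- The functional sends jump times to jump times and is increasing, so `t` and its inverse image
lie in holding intervals with the same indices. If they lie in none, both paths are in the cemetery.
-/
theorem timeChange_jumpPath (ξ : ℕ → V) {Y : ℕ → ℝ} (hY : ∀ n, 0 < Y n) {t : ℝ} (ht : 0 ≤ t) :
    timeChange (jumpPath ξ Y) t = jumpPath ξ (logHolding ξ Y) t := by
  have h : ∀ n, jumpTime Y n ≤ inverseFunctional (jumpPath ξ Y) t ↔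
      jumpTime (logHolding ξ Y) n ≤ t := by
    intro n
    rw [← additiveFunctional_jumpTime ξ hY n]
    exact le_inverseFunctional_iff (fun n => (ξ n, Y n)) (jumpTime_nonneg fun k _ => hY k) ht
  change jumpPath ξ Y (inverseFunctional (jumpPath ξ Y) t) = _
  generalize inverseFunctional (jumpPath ξ Y) t = s at h ⊢
  classical
  have h' : ∀ n, (jumpTime Y n ≤ s ∧ s < jumpTime Y (n + 1)) ↔
      (jumpTime (logHolding ξ Y) n ≤ t ∧ t < jumpTime (logHolding ξ Y) (n + 1)) := by
    intro n
    rw [h n, ← not_le, h (n + 1), not_le]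
  by_cases hex : ∃ n, jumpTime Y n ≤ s ∧ s < jumpTime Y (n + 1)
  · have hex' := (exists_congr h').1 hex
    rw [jumpPath, jumpPath, dif_pos hex, dif_pos hex', (Nat.find_eq_iff hex).2
      ⟨(h' _).2 (Nat.find_spec hex'), fun m hm hm' => Nat.find_min hex' hm ((h' m).1 hm')⟩]
  · rw [jumpPath, jumpPath, dif_neg hex, dif_neg fun hex' => hex ((exists_congr h').2 hex')]

end Path

/-! ### Walks determined by alarms -/

section AlarmRace

variable {V : Type*}

theorem occupation_succ_self (ξ : ℕ → V) (S : ℕ → ℝ) (n : ℕ) :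
    occupation ξ S (ξ n) (n + 1) = occupation ξ S (ξ n) n + S n := by
  classical
  rw [occupation_succ, if_pos rfl]

theorem occupation_succ_of_ne {ξ : ℕ → V} {S : ℕ → ℝ} {x : V} {n : ℕ} (h : ξ n ≠ x) :
    occupation ξ S x (n + 1) = occupation ξ S x n := by
  classical
  rw [occupation_succ, if_neg h, add_zero]

open Classical in
/-- The clock of the edge `e` at the time of the `n`-th jump. -/
def edgeOccupation (ξ : ℕ → V) (S : ℕ → ℝ) (e : Sym2 V) (n : ℕ) : ℝ :=
  ∑ k ∈ Finset.range n, if ξ k ∈ e then S k else 0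

theorem edgeOccupation_succ_of_mem {ξ : ℕ → V} {S : ℕ → ℝ} {e : Sym2 V} {n : ℕ} (h : ξ n ∈ e) :
    edgeOccupation ξ S e (n + 1) = edgeOccupation ξ S e n + S n := by
  rw [edgeOccupation, Finset.sum_range_succ, if_pos h, edgeOccupation]

theorem edgeOccupation_succ_of_notMem {ξ : ℕ → V} {S : ℕ → ℝ} {e : Sym2 V} {n : ℕ} (h : ξ n ∉ e) :
    edgeOccupation ξ S e (n + 1) = edgeOccupation ξ S e n := by
  rw [edgeOccupation, Finset.sum_range_succ, if_neg h, edgeOccupation, add_zero]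

theorem edgeOccupation_eq_add {ξ : ℕ → V} {S : ℕ → ℝ} {x y : V} (hxy : x ≠ y) (n : ℕ) :
    edgeOccupation ξ S s(x, y) n = occupation ξ S x n + occupation ξ S y n := by
  classical
  rw [edgeOccupation, occupation, occupation, ← Finset.sum_add_distrib]
  refine Finset.sum_congr rfl fun k _ => ?_
  by_cases hx : ξ k = x
  · have hy : ξ k ≠ y := fun h => hxy (hx.symm.trans h)
    simp [hx, hxy]
  · simp [hx]

open Classical in
/-- The number of crossings of `e` in the first `n` jumps. -/
def crossings (ξ : ℕ → V) (e : Sym2 V) (n : ℕ) : ℕ :=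
  ∑ k ∈ Finset.range n, if s(ξ k, ξ (k + 1)) = e then 1 else 0

theorem crossings_succ_of_eq {ξ : ℕ → V} {e : Sym2 V} {n : ℕ} (h : s(ξ n, ξ (n + 1)) = e) :
    crossings ξ e (n + 1) = crossings ξ e n + 1 := by
  rw [crossings, Finset.sum_range_succ, if_pos h, crossings]

theorem crossings_succ_of_ne {ξ : ℕ → V} {e : Sym2 V} {n : ℕ} (h : s(ξ n, ξ (n + 1)) ≠ e) :
    crossings ξ e (n + 1) = crossings ξ e n := by
  rw [crossings, Finset.sum_range_succ, if_neg h, crossings, add_zero]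

theorem crossings_congr {ξ ξ' : ℕ → V} {n : ℕ} (h : ∀ k ≤ n, ξ k = ξ' k) (e : Sym2 V) :
    crossings ξ e n = crossings ξ' e n :=
  Finset.sum_congr rfl fun k hk => by
    have hk := Finset.mem_range.1 hk
    rw [h k hk.le, h (k + 1) hk]

theorem edgeOccupation_congr {ξ ξ' : ℕ → V} {S S' : ℕ → ℝ} {n : ℕ} (h : ∀ k ≤ n, ξ k = ξ' k)
    (hS : ∀ k < n, S k = S' k) (e : Sym2 V) :
    edgeOccupation ξ S e n = edgeOccupation ξ' S' e n :=
  Finset.sum_congr rfl fun k hk => by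
    have hk := Finset.mem_range.1 hk
    rw [h k hk.le, hS k hk]

variable {G : SimpleGraph V}

/-- The walk with positions `ξ` and holding times `S` always crosses the adjacent edge whose next alarm,
among the alarm times `A`, is the first to ring, and there are no ties. -/
def IsAlarmRace (A : G.edgeSet → ℕ → ℝ) (ξ : ℕ → V) (S : ℕ → ℝ) : Prop :=
  ∀ n, ∃ e : G.edgeSet, (e : Sym2 V) = s(ξ n, ξ (n + 1)) ∧ 0 < S n ∧
    edgeOccupation ξ S e n + S n = A e (crossings ξ e n + 1) ∧
    ∀ e' : G.edgeSet, ξ n ∈ (e' : Sym2 V) → e' ≠ e →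
      edgeOccupation ξ S e' n + S n < A e' (crossings ξ e' n + 1)

/-- A clock runs only while the walk is at an endpoint of the edge, and the edge is crossed whenever
it rings. So the number of alarms that the clock has passed is the number of crossings. -/
theorem IsAlarmRace.next_alarm {A : G.edgeSet → ℕ → ℝ} {ξ : ℕ → V} {S : ℕ → ℝ}
    (h : IsAlarmRace A ξ S) (hA : ∀ e, StrictMono (A e)) (hA0 : ∀ e, A e 0 = 0) (n : ℕ)
    (e : G.edgeSet) : A e (crossings ξ e n) ≤ edgeOccupation ξ S e n ∧
      edgeOccupation ξ S e n < A e (crossings ξ e n + 1) := by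
  induction n with
  | zero =>
    have : A e 0 < A e 1 := hA e Nat.zero_lt_one
    simpa [crossings, edgeOccupation, hA0] using this
  | succ n ih =>
    obtain ⟨e₀, he₀, hS, hwin, hlose⟩ := h n
    have hmem : ξ n ∈ (e₀ : Sym2 V) := he₀ ▸ Sym2.mem_mk_left _ _
    by_cases hee : e = e₀
    · subst hee
      rw [crossings_succ_of_eq he₀.symm, edgeOccupation_succ_of_mem hmem, hwin]
      exact ⟨le_rfl, hA e (Nat.lt_succ_self _)⟩
    · have hne : s(ξ n, ξ (n + 1)) ≠ (e : Sym2 V) := fun hh =>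
        hee (Subtype.ext (hh.symm.trans he₀.symm))
      rw [crossings_succ_of_ne hne]
      by_cases hin : ξ n ∈ (e : Sym2 V)
      · rw [edgeOccupation_succ_of_mem hin]
        exact ⟨by linarith [ih.1], hlose e hin hee⟩
      · rw [edgeOccupation_succ_of_notMem hin]
        exact ih

theorem edgeClock_jumpPath {ξ : ℕ → V} {S : ℕ → ℝ} {n : ℕ} (hS : ∀ k < n, 0 < S k) {j : V}
    (hj : ξ n ≠ j) {t : ℝ} (h1 : jumpTime S n ≤ t) (h2 : t ≤ jumpTime S (n + 1)) :
    edgeClock (jumpPath ξ S) (ξ n) j t = edgeOccupation ξ S s(ξ n, j) n + (t - jumpTime S n) := by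
  classical
  have h3 : t - jumpTime S n ≤ S n := by rw [jumpTime_succ] at h2; linarith
  have h4 := localTime_jumpPath (ξ := ξ) hS (ξ n) (sub_nonneg.2 h1) h3
  have h5 := localTime_jumpPath (ξ := ξ) hS j (sub_nonneg.2 h1) h3
  rw [add_sub_cancel, if_pos rfl] at h4
  rw [add_sub_cancel, if_neg hj] at h5
  rw [edgeClock, h4, h5, edgeOccupation_eq_add hj]
  ring

/-- One-step determinism gives uniqueness of the whole walk. -/
theorem eq_of_step_eq {ξ ξ' : ℕ → V} {S S' : ℕ → ℝ} (h0 : ξ 0 = ξ' 0)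
    (h : ∀ n, (∀ k ≤ n, ξ k = ξ' k) → (∀ k < n, S k = S' k) →
      S n = S' n ∧ ξ (n + 1) = ξ' (n + 1)) : ξ = ξ' ∧ S = S' := by
  have key : ∀ n, (∀ k ≤ n, ξ k = ξ' k) ∧ ∀ k < n, S k = S' k := by
    intro n
    induction n with
    | zero =>
      refine ⟨fun k hk => ?_, fun k hk => absurd hk (Nat.not_lt_zero k)⟩
      rw [Nat.le_zero.1 hk, h0]
    | succ n ih =>
      have hn := h n ih.1 ih.2
      refine ⟨fun k hk => ?_, fun k hk => ?_⟩
      · rcases Nat.le_succ_iff.1 hk with hk | rfl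
        · exact ih.1 k hk
        · exact hn.2
      · rcases Nat.lt_succ_iff_lt_or_eq.1 hk with hk | rfl
        · exact ih.2 k hk
        · exact hn.1
  exact ⟨funext fun n => (key n).1 n le_rfl, funext fun n => (key (n + 1)).2 n (Nat.lt_succ_self n)⟩

/-- Equal pasts give equal clocks and crossing numbers. If the two races had different winners, each
would have to ring strictly before the other. -/
theorem IsAlarmRace.unique {A : G.edgeSet → ℕ → ℝ} {ξ ξ' : ℕ → V} {S S' : ℕ → ℝ}
    (h : IsAlarmRace A ξ S) (h' : IsAlarmRace A ξ' S') (h0 : ξ 0 = ξ' 0) : ξ = ξ' ∧ S = S' := by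
  refine eq_of_step_eq h0 fun n hξ hS => ?_
  obtain ⟨e, he, -, hwin, hlose⟩ := h n
  obtain ⟨e', he', -, hwin', hlose'⟩ := h' n
  simp only [← crossings_congr hξ, ← edgeOccupation_congr hξ hS, ← hξ n le_rfl] at he' hwin' hlose'
  have hmem : ξ n ∈ (e : Sym2 V) := he ▸ Sym2.mem_mk_left _ _
  have hmem' : ξ n ∈ (e' : Sym2 V) := he' ▸ Sym2.mem_mk_left _ _
  have hee : e = e' := by
    by_contra hne
    have h1 := hlose e' hmem' (Ne.symm hne)
    have h2 := hlose' e hmem hne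
    linarith
  subst hee
  exact ⟨by linarith, Sym2.congr_right.1 (he.symm.trans he')⟩

/-- `FollowsAlarms` does not say which alarm of the crossed edge rings. By `next_alarm` for the race
walk with the same past, it is at least the one numbered crossings plus one, so the jump cannot
precede that of the race. It cannot come later, for the race winner would then ring during the
holding time. Absence of ties identifies the edge. -/
theorem IsAlarmRace.eq_of_followsAlarms {a : G.edgeSet → ℝ} {τ : G.edgeSet → ℕ → ℝ}
    {ξ ξ' : ℕ → V} {S S' : ℕ → ℝ} (h : FollowsAlarms G a τ ξ S)
    (h' : IsAlarmRace (fun e => alarmTime (a e) (τ e)) ξ' S')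
    (hA : ∀ e, StrictMono (alarmTime (a e) (τ e))) (h0 : ξ 0 = ξ' 0) : ξ = ξ' ∧ S = S' := by
  have hpos : ∀ n, 0 < S n := fun n => (h n).1
  refine eq_of_step_eq h0 fun n hξ hS => ?_
  obtain ⟨-, ⟨hadj, k, -, hk⟩, hquiet⟩ := h n
  obtain ⟨e', he', hS', hwin', hlose'⟩ := h' n
  have hnext := h'.next_alarm hA (fun e => by simp [alarmTime]) n
  simp only [← crossings_congr hξ, ← edgeOccupation_congr hξ hS, ← hξ n le_rfl]
    at he' hwin' hlose' hnext
  set e : G.edgeSet := ⟨s(ξ n, ξ (n + 1)), (SimpleGraph.mem_edgeSet G).2 hadj⟩ with he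
  have hmem : ξ n ∈ (e : Sym2 V) := Sym2.mem_mk_left _ _
  have hJ := jumpTime_succ S n
  rw [edgeClock_jumpPath (fun k _ => hpos k) hadj.ne (by linarith [hpos n]) le_rfl, hJ,
    add_sub_cancel_left] at hk
  change edgeOccupation ξ S e n + S n = _ at hk
  -- The clock has moved by `S n > 0` beyond the alarm numbered by the crossings, so the ringing
  -- alarm has a larger number.
  have hlt : crossings ξ e n < k := (hA e).lt_iff_lt.1 (by linarith [(hnext e).1, hpos n])
  have hle : alarmTime (a e) (τ e) (crossings ξ e n + 1) ≤ alarmTime (a e) (τ e) k :=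
    (hA e).monotone hlt
  have hSS : S n = S' n := by
    have hle' : S' n ≤ S n := by
      by_cases hee : e = e'
      · rw [← hee] at hwin'
        linarith
      · linarith [hlose' e hmem hee]
    -- If the walk stayed longer, the clock of the race winner would ring at time `jumpTime S n + S'
    -- n`, inside the holding interval.
    refine le_antisymm (not_lt.1 fun hlt' => ?_) hle'
    have hadj' : G.Adj (ξ n) (ξ' (n + 1)) := by
      rw [← SimpleGraph.mem_edgeSet, ← he']
      exact e'.2
    have hq := hquiet (ξ' (n + 1)) hadj' (crossings ξ e' n + 1) (Nat.succ_pos _)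
      (jumpTime S n + S' n) ⟨by linarith, by linarith⟩
    rw [edgeClock_jumpPath (fun k _ => hpos k) hadj'.ne (by linarith) (by linarith),
      add_sub_cancel_left] at hq
    have hee : e' = ⟨s(ξ n, ξ' (n + 1)), (SimpleGraph.mem_edgeSet G).2 hadj'⟩ := Subtype.ext he'
    rw [← hee, ← he'] at hq
    exact hq hwin'
  refine ⟨hSS, ?_⟩
  have hee : e = e' := by
    by_contra hne
    linarith [hlose' e hmem hne]
  exact Sym2.congr_right.1 ((congrArg Subtype.val hee).trans he')

/-! ### Races on the edges of a graph -/

/-- The walk with positions `ξ` and holding times `S` crosses the edges that win the races with the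
speeds `c n` and the distances `ρ n`. -/
def IsEdgeRace (c : ℕ → G.edgeSet → ℝ) (ρ : ℕ → G.edgeSet × ℕ → ℝ) (ξ : ℕ → V) (S : ℕ → ℝ) : Prop :=
  ∀ n, ∃ e : G.edgeSet, (e : Sym2 V) = s(ξ n, ξ (n + 1)) ∧ 0 < S n ∧
    ρ n (e, 0) = c n e * S n ∧
    (∀ e' : G.edgeSet, ξ n ∈ (e' : Sym2 V) → e' ≠ e → c n e' * S n < ρ n (e', 0)) ∧
    (∀ m, ρ (n + 1) (e, m) = ρ n (e, m + 1)) ∧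
    ∀ e' ≠ e, ρ (n + 1) (e', 0) = ρ n (e', 0) - c n e' * S n ∧
      ∀ m, ρ (n + 1) (e', m + 1) = ρ n (e', m + 1)

/-- Only the current distance of an edge is consumed. The later ones are renumbered once for each
win, that is, for each crossing. -/
theorem IsEdgeRace.apply_succ {c : ℕ → G.edgeSet → ℝ} {ρ : ℕ → G.edgeSet × ℕ → ℝ} {ξ : ℕ → V}
    {S : ℕ → ℝ} (h : IsEdgeRace c ρ ξ S) (n : ℕ) (e : G.edgeSet) (m : ℕ) :
    ρ n (e, m + 1) = ρ 0 (e, crossings ξ e n + m + 1) := by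
  induction n generalizing m with
  | zero => simp [crossings]
  | succ n ih =>
    obtain ⟨e₀, he₀, -, -, -, hwin, hlose⟩ := h n
    by_cases hee : e = e₀
    · subst hee
      rw [hwin, ih, crossings_succ_of_eq he₀.symm]
      congr 2
      ring
    · have hne : s(ξ n, ξ (n + 1)) ≠ (e : Sym2 V) := fun hh =>
        hee (Subtype.ext (hh.symm.trans he₀.symm))
      rw [(hlose e hee).2, ih, crossings_succ_of_ne hne]

/-- A walk that crosses edges at rates `a e + crossings` follows the alarms of the edge-reinforced
random walk. -/
theorem IsEdgeRace.isAlarmRace_of_crossings {a : G.edgeSet → ℝ} (ha : ∀ e, 0 < a e)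
    {c : ℕ → G.edgeSet → ℝ} {ρ : ℕ → G.edgeSet × ℕ → ℝ} {ξ : ℕ → V} {S : ℕ → ℝ}
    (h : IsEdgeRace c ρ ξ S) (hc : ∀ n (e : G.edgeSet), ξ n ∈ (e : Sym2 V) → c n e = a e + crossings ξ e n)
    (hc0 : ∀ n (e : G.edgeSet), ξ n ∉ (e : Sym2 V) → c n e = 0) :
    IsAlarmRace (fun e => alarmTime (a e) fun k => ρ 0 (e, k)) ξ S := by
  set A := fun e : G.edgeSet => alarmTime (a e) fun k => ρ 0 (e, k) with hA
  have hpos : ∀ (e : G.edgeSet) (k : ℕ), 0 < a e + (k : ℝ) := fun e k => by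
    have := ha e; positivity
  have hAs : ∀ e (k : ℕ), (a e + (k : ℝ)) * (A e (k + 1) - A e k) = ρ 0 (e, k) := by
    intro e k
    have := (hpos e k).ne'
    simp only [hA, alarmTime, Finset.sum_range_succ]
    field_simp
    ring
  -- The invariant: the distance left on an edge is its current speed times the time its clock still
  -- lacks to the next alarm. After a win the clock is exactly at an alarm, and the next full
  -- distance begins.
  have hinv : ∀ n e, ρ n (e, 0) = (a e + crossings ξ e n) *
      (A e (crossings ξ e n + 1) - edgeOccupation ξ S e n) := by
    intro n
    induction n with
    | zero =>
      intro e
      have h1 := hAs e 0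
      have h2 : A e 0 = 0 := by simp [hA, alarmTime]
      simp only [crossings, edgeOccupation, Finset.range_zero, Finset.sum_empty]
      rw [← h1, h2]
    | succ n ih =>
      intro e
      obtain ⟨e₀, he₀, hS, hwin, hlose, hnew, hold⟩ := h n
      have hmem : ξ n ∈ (e₀ : Sym2 V) := he₀ ▸ Sym2.mem_mk_left _ _
      by_cases hee : e = e₀
      · subst hee
        rw [ih, hc n e hmem] at hwin
        have h1 := mul_left_cancel₀ (hpos e _).ne' hwin
        have h2 : edgeOccupation ξ S e n + S n = A e (crossings ξ e n + 1) := by linarith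
        rw [hnew, h.apply_succ, crossings_succ_of_eq he₀.symm, edgeOccupation_succ_of_mem hmem, h2,
          hAs]
      · have hne : s(ξ n, ξ (n + 1)) ≠ (e : Sym2 V) := fun hh =>
          hee (Subtype.ext (hh.symm.trans he₀.symm))
        rw [(hold e hee).1, ih, crossings_succ_of_ne hne]
        by_cases hin : ξ n ∈ (e : Sym2 V)
        · rw [edgeOccupation_succ_of_mem hin, hc n e hin]
          ring
        · rw [edgeOccupation_succ_of_notMem hin, hc0 n e hin]
          ring
  intro n
  obtain ⟨e, he, hS, hwin, hlose, -, -⟩ := h n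
  have hmem : ξ n ∈ (e : Sym2 V) := he ▸ Sym2.mem_mk_left _ _
  refine ⟨e, he, hS, ?_, fun e' hmem' hne => ?_⟩
  · rw [hinv, hc n e hmem] at hwin
    have h1 := mul_left_cancel₀ (hpos e _).ne' hwin
    linarith
  · have h1 := hlose e' hmem' hne
    rw [hinv, hc n e' hmem'] at h1
    have h2 := lt_of_mul_lt_mul_left h1 (hpos e' _).le
    linarith

/-- At every visit the exponential gains the quotient of `L` after and before the visit, and the
product telescopes: the new local time is `log L`. -/
theorem exp_occupation_logHolding {ξ : ℕ → V} {Y : ℕ → ℝ} (hY : ∀ n, 0 < Y n) (x : V) (n : ℕ) :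
    Real.exp (occupation ξ (logHolding ξ Y) x n) = 1 + occupation ξ Y x n := by
  induction n with
  | zero => simp [occupation]
  | succ n ih =>
    by_cases h : ξ n = x
    · subst h
      have := occupation_nonneg (ξ := ξ) (x := ξ n) (n := n) fun k _ => hY k
      have h1 := hY n
      rw [occupation_succ_self, occupation_succ_self, Real.exp_add, ih, logHolding,
        Real.exp_log (by positivity)]
      field_simp
      ring
    · rw [occupation_succ_of_ne h, occupation_succ_of_ne h, ih]

theorem logHolding_pos {ξ : ℕ → V} {Y : ℕ → ℝ} (hY : ∀ n, 0 < Y n) (n : ℕ) :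
    0 < logHolding ξ Y n := by
  have := occupation_nonneg (ξ := ξ) (x := ξ n) (n := n) fun k _ => hY k
  have h1 := hY n
  exact Real.log_pos ((one_lt_div (by positivity)).2 (by linarith))

/-- After the change of time, the vertex-reinforced jump process with weights `w` follows alarms that
are at the points of a Poisson process with rate `w e` in an exponential time scale. -/
theorem IsEdgeRace.isAlarmRace_of_occupation {w : G.edgeSet → ℝ} (hw : ∀ e, 0 < w e)
    {c : ℕ → G.edgeSet → ℝ} {ρ : ℕ → G.edgeSet × ℕ → ℝ} {ξ : ℕ → V} {Y : ℕ → ℝ}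
    (h : IsEdgeRace c ρ ξ Y)
    (hc : ∀ n (e : G.edgeSet) (y : V), (e : Sym2 V) = s(ξ n, y) →
      c n e = w e * (1 + occupation ξ Y y n))
    (hc0 : ∀ n (e : G.edgeSet), ξ n ∉ (e : Sym2 V) → c n e = 0) {A : G.edgeSet → ℕ → ℝ}
    (hA : ∀ e k, Real.exp (A e k) = (w e + ∑ l ∈ Finset.range k, ρ 0 (e, l)) / w e) :
    IsAlarmRace A ξ (logHolding ξ Y) := by
  have hY : ∀ n, 0 < Y n := fun n => by
    obtain ⟨e, -, hS, -⟩ := h n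
    exact hS
  have hAs : ∀ e k, w e * (Real.exp (A e (k + 1)) - Real.exp (A e k)) = ρ 0 (e, k) := by
    intro e k
    have := (hw e).ne'
    rw [hA, hA, Finset.sum_range_succ]
    field_simp
    ring
  set S := logHolding ξ Y with hS
  have hL : ∀ x n, 0 < 1 + occupation ξ Y x n := fun x n => by
    have := occupation_nonneg (ξ := ξ) (x := x) (n := n) fun k _ => hY k
    linarith
  have hexp : ∀ {x y : V}, x ≠ y → ∀ n, Real.exp (edgeOccupation ξ S s(x, y) n) =
      (1 + occupation ξ Y x n) * (1 + occupation ξ Y y n) := by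
    intro x y hxy n
    rw [edgeOccupation_eq_add hxy, Real.exp_add, exp_occupation_logHolding hY,
      exp_occupation_logHolding hY]
  -- The exponential of the clock of `{x, y}` is `L_x * L_y`. While the walk sits at `x` only `L_x`
  -- grows, so `w e * exp clock` grows at the crossing rate `c n e = w e * L_y` per unit of old
  -- time.
  have hmove : ∀ n (e : G.edgeSet), ξ n ∈ (e : Sym2 V) → w e * Real.exp (edgeOccupation ξ S e n + S n) =
      w e * Real.exp (edgeOccupation ξ S e n) + c n e * Y n := by
    intro n e hmem
    obtain ⟨y, hy⟩ := Sym2.mem_iff_exists.1 hmem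
    have hadj : G.Adj (ξ n) y := by
      rw [← SimpleGraph.mem_edgeSet, ← hy]
      exact e.2
    rw [← edgeOccupation_succ_of_mem hmem, hc n e y hy, hy, hexp hadj.ne, hexp hadj.ne,
      occupation_succ_self, occupation_succ_of_ne hadj.ne]
    ring
  -- The invariant: the distance left is what `w e * exp clock` still lacks to its value at the next
  -- alarm.
  have hinv : ∀ n e, ρ n (e, 0) = w e *
      (Real.exp (A e (crossings ξ e n + 1)) - Real.exp (edgeOccupation ξ S e n)) := by
    intro n
    induction n with
    | zero =>
      intro e
      have h1 := hAs e 0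
      have h2 : Real.exp (A e 0) = 1 := by rw [hA]; simp [(hw e).ne']
      simp only [crossings, edgeOccupation, Finset.range_zero, Finset.sum_empty, Real.exp_zero]
      rw [← h1, h2]
    | succ n ih =>
      intro e
      obtain ⟨e₀, he₀, -, hwin, hlose, hnew, hold⟩ := h n
      have hmem : ξ n ∈ (e₀ : Sym2 V) := he₀ ▸ Sym2.mem_mk_left _ _
      by_cases hee : e = e₀
      · subst hee
        have h1 := hmove n e hmem
        rw [ih] at hwin
        have h2 : Real.exp (edgeOccupation ξ S e n + S n) = Real.exp (A e (crossings ξ e n + 1)) :=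
          mul_left_cancel₀ (hw e).ne' (by linarith)
        rw [hnew, h.apply_succ, crossings_succ_of_eq he₀.symm, edgeOccupation_succ_of_mem hmem, h2,
          hAs]
      · have hne : s(ξ n, ξ (n + 1)) ≠ (e : Sym2 V) := fun hh =>
          hee (Subtype.ext (hh.symm.trans he₀.symm))
        rw [(hold e hee).1, ih, crossings_succ_of_ne hne]
        by_cases hin : ξ n ∈ (e : Sym2 V)
        · rw [edgeOccupation_succ_of_mem hin]
          linarith [hmove n e hin]
        · rw [edgeOccupation_succ_of_notMem hin, hc0 n e hin]
          ring
  intro n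
  obtain ⟨e, he, -, hwin, hlose, -, -⟩ := h n
  have hmem : ξ n ∈ (e : Sym2 V) := he ▸ Sym2.mem_mk_left _ _
  refine ⟨e, he, logHolding_pos hY n, ?_, fun e' hmem' hne => ?_⟩
  · rw [hinv] at hwin
    have h1 := hmove n e hmem
    exact Real.exp_injective (mul_left_cancel₀ (hw e).ne' (by linarith))
  · have h1 := hlose e' hmem' hne
    rw [hinv] at h1
    have h2 := hmove n e' hmem'
    exact Real.exp_lt_exp.1 (lt_of_mul_lt_mul_left (by linarith) (hw e').le)

end AlarmRace

/-! ### Edges at a vertex -/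

section Incidence

variable {V : Type*}

open Classical in
/-- The endpoint of the edge `e` other than `x`. -/
def otherEnd (x : V) (e : Sym2 V) : V := if h : x ∈ e then Sym2.Mem.other h else x

theorem otherEnd_mk (x y : V) : otherEnd x s(x, y) = y := by
  have h : x ∈ s(x, y) := Sym2.mem_mk_left x y
  rw [otherEnd, dif_pos h]
  exact Sym2.congr_right.1 (Sym2.other_spec h)

theorem mk_otherEnd {x : V} {e : Sym2 V} (h : x ∈ e) : s(x, otherEnd x e) = e := by
  rw [otherEnd, dif_pos h]
  exact Sym2.other_spec h

variable (G : SimpleGraph V)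

theorem pairWeight_of_eq {c : G.edgeSet → ℝ} {x y : V} {e : G.edgeSet} (h : (e : Sym2 V) = s(x, y)) :
    pairWeight G c x y = c e := by
  have hadj : G.Adj x y := by
    rw [← SimpleGraph.mem_edgeSet, ← h]
    exact e.2
  rw [pairWeight, dif_pos hadj]
  congr 1
  exact Subtype.ext h.symm

variable [G.LocallyFinite]

open Classical in
/-- The edges adjacent to `x`. -/
def incidentEdges (x : V) : Finset G.edgeSet :=
  (G.neighborFinset x).attach.image fun y : {y // y ∈ G.neighborFinset x} =>
    (⟨s(x, y.1), G.mem_edgeSet.2 ((G.mem_neighborFinset x y.1).1 y.2)⟩ : G.edgeSet)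

theorem mem_incidentEdges {x : V} {e : G.edgeSet} : e ∈ incidentEdges G x ↔ x ∈ (e : Sym2 V) := by
  classical
  simp only [incidentEdges, Finset.mem_image, Finset.mem_attach, true_and, Subtype.exists]
  constructor
  · rintro ⟨y, hy, rfl⟩
    exact Sym2.mem_mk_left x y
  · intro h
    have h1 := mk_otherEnd h
    have hadj : G.Adj x (otherEnd x e) := by
      rw [← SimpleGraph.mem_edgeSet, h1]
      exact e.2
    exact ⟨otherEnd x e, (G.mem_neighborFinset x _).2 hadj, Subtype.ext h1⟩

theorem sum_incidentEdges (c : G.edgeSet → ℝ) (x : V) :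
    ∑ e ∈ incidentEdges G x, c e = ∑ y ∈ G.neighborFinset x, pairWeight G c x y := by
  classical
  rw [incidentEdges, Finset.sum_image, ← Finset.sum_attach (G.neighborFinset x)]
  · exact Finset.sum_congr rfl fun y _ => (pairWeight_of_eq G rfl).symm
  · intro y _ y' _ h
    exact Subtype.ext (Sym2.congr_right.1 (congrArg Subtype.val h))

end Incidence

/-! ### Records of jumps and the walk built from a race -/

section EdgeRace

variable {V : Type*}

/-- Add to the record `z` of the first `n` jumps a holding time `s` and a jump to `y`. -/
def recordJump (n : ℕ) (z : ℕ → V × ℝ) (y : V) (s : ℝ) : ℕ → V × ℝ := fun k =>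
  if k = n then ((z n).1, s) else if k = n + 1 then (y, 0) else z k

/-- The record of the first `n` jumps. -/
def jumpRecord (i₀ : V) (n : ℕ) (z : ℕ → V × ℝ) : ℕ → V × ℝ := fun k =>
  if k < n then z k else if k = n then ((z n).1, 0) else (i₀, 0)

theorem jumpRecord_apply_of_lt (i₀ : V) {n k : ℕ} (z : ℕ → V × ℝ) (h : k < n) :
    jumpRecord i₀ n z k = z k := if_pos h

theorem jumpRecord_apply_fst (i₀ : V) {n k : ℕ} (z : ℕ → V × ℝ) (h : k ≤ n) :
    (jumpRecord i₀ n z k).1 = (z k).1 := by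
  rcases h.lt_or_eq with h | rfl
  · rw [jumpRecord_apply_of_lt i₀ z h]
  · simp [jumpRecord]

/-- Records of every length live in the same space, filled up with default values. Hence the passage
to the next record is one fixed map, which is also the history update in `edgeRace`. -/
theorem jumpRecord_succ (i₀ : V) (n : ℕ) (z : ℕ → V × ℝ) :
    jumpRecord i₀ (n + 1) z = recordJump n (jumpRecord i₀ n z) (z (n + 1)).1 (z n).2 := by
  funext k
  rcases lt_trichotomy k n with h | rfl | h
  · simp [jumpRecord, recordJump, h, h.ne, Nat.lt_succ_of_lt h, (Nat.lt_succ_of_lt h).ne]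
  · simp [jumpRecord, recordJump]
  · by_cases hk : k = n + 1
    · subst hk
      simp [jumpRecord, recordJump]
    · have h1 : ¬ k < n + 1 := by omega
      have h2 : ¬ k < n := by omega
      simp [jumpRecord, recordJump, hk, h.ne', h1, h2]

variable [MeasurableSpace V]

theorem measurable_recordJump (n : ℕ) :
    Measurable fun p : (ℕ → V × ℝ) × V × ℝ => recordJump n p.1 p.2.1 p.2.2 := by
  refine measurable_pi_lambda _ fun k => ?_
  unfold recordJump
  split_ifs <;> fun_prop

theorem measurable_jumpRecord (i₀ : V) (n : ℕ) : Measurable (jumpRecord i₀ n) := by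
  refine measurable_pi_lambda _ fun k => ?_
  unfold jumpRecord
  split_ifs <;> fun_prop

variable [DiscreteMeasurableSpace V] {G : SimpleGraph V} [G.LocallyFinite]

open Classical in
/-- The race along the edges of `G`: the history consists of parameters and of the record of past jumps,
and the speed of an edge adjacent to the current position is `q`, if this is positive. -/
def edgeRace (hdeg : ∀ x, ∃ y, G.Adj x y)
    (q : ℕ → (G.edgeSet → ℝ) × (ℕ → V × ℝ) → G.edgeSet → ℝ) (hq : ∀ n e, Measurable fun h => q n h e) :
    RaceScheme G.edgeSet ((G.edgeSet → ℝ) × (ℕ → V × ℝ)) where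
  runners n h := incidentEdges G (h.2 n).1
  -- The default `1` makes the speed of an adjacent edge positive for every history, even one with
  -- nonpositive parameters or holding times, as a `RaceScheme` requires.
  speed n h e := if (h.2 n).1 ∈ (e : Sym2 V) then (if 0 < q n h e then q n h e else 1) else 0
  next n h e s := (h.1, recordJump n h.2 (otherEnd (h.2 n).1 e) s)
  runners_nonempty n h := by
    obtain ⟨y, hy⟩ := hdeg (h.2 n).1
    exact ⟨⟨s((h.2 n).1, y), G.mem_edgeSet.2 hy⟩, (mem_incidentEdges G).2 (Sym2.mem_mk_left _ _)⟩
  speed_pos n h e he := by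
    rw [if_pos ((mem_incidentEdges G).1 he)]
    split_ifs with h1
    · exact h1
    · exact one_pos
  speed_eq_zero n h e he := if_neg fun h1 => he ((mem_incidentEdges G).2 h1)
  measurable_speed n e := by
    have h1 : Measurable fun h : (G.edgeSet → ℝ) × (ℕ → V × ℝ) => (h.2 n).1 := by fun_prop
    exact Measurable.ite (h1 (MeasurableSet.of_discrete (s := {x | x ∈ (e : Sym2 V)})))
      (Measurable.ite (measurableSet_lt measurable_const (hq n e)) (hq n e) measurable_const)
      measurable_const
  measurable_next n e := by
    have h1 : Measurable fun x : V => otherEnd x (e : Sym2 V) := Measurable.of_discrete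
    have h2 : Measurable fun p : ((G.edgeSet → ℝ) × (ℕ → V × ℝ)) × ℝ =>
        (p.1.2, otherEnd (p.1.2 n).1 (e : Sym2 V), p.2) := by fun_prop
    exact (measurable_fst.comp measurable_fst).prodMk ((measurable_recordJump n).comp h2)

variable (hdeg : ∀ x, ∃ y, G.Adj x y)
    (q : ℕ → (G.edgeSet → ℝ) × (ℕ → V × ℝ) → G.edgeSet → ℝ) (hq : ∀ n e, Measurable fun h => q n h e)

theorem edgeRace_speed_of_mem {n : ℕ} {h : (G.edgeSet → ℝ) × (ℕ → V × ℝ)} {e : G.edgeSet}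
    (he : (h.2 n).1 ∈ (e : Sym2 V)) (hpos : 0 < q n h e) :
    (edgeRace hdeg q hq).speed n h e = q n h e :=
  (if_pos he).trans (if_pos hpos)

theorem edgeRace_speed_of_notMem {n : ℕ} {h : (G.edgeSet → ℝ) × (ℕ → V × ℝ)} {e : G.edgeSet}
    (he : (h.2 n).1 ∉ (e : Sym2 V)) : (edgeRace hdeg q hq).speed n h e = 0 := if_neg he

theorem edgeRace_mem_runners {n : ℕ} {h : (G.edgeSet → ℝ) × (ℕ → V × ℝ)} {e : G.edgeSet} :
    e ∈ (edgeRace hdeg q hq).runners n h ↔ (h.2 n).1 ∈ (e : Sym2 V) := mem_incidentEdges G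

theorem edgeRace_totalSpeed (n : ℕ) (h : (G.edgeSet → ℝ) × (ℕ → V × ℝ)) :
    (edgeRace hdeg q hq).totalSpeed n h = ∑ y ∈ G.neighborFinset (h.2 n).1,
      pairWeight G ((edgeRace hdeg q hq).speed n h) (h.2 n).1 y :=
  sum_incidentEdges G _ _

variable [Nonempty G.edgeSet] (i₀ : V)

/-- The initial state of the race: no jump is recorded. -/
def raceStart (p : (G.edgeSet → ℝ) × (G.edgeSet × ℕ → ℝ)) :
    ((G.edgeSet → ℝ) × (ℕ → V × ℝ)) × (G.edgeSet × ℕ → ℝ) := ((p.1, fun _ => (i₀, 0)), p.2)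

/-- The state of the race after `n` jumps. -/
def raceState (p : (G.edgeSet → ℝ) × (G.edgeSet × ℕ → ℝ)) (n : ℕ) :
    ((G.edgeSet → ℝ) × (ℕ → V × ℝ)) × (G.edgeSet × ℕ → ℝ) :=
  (edgeRace hdeg q hq).run (raceStart i₀ p) n

/-- The successive positions and holding times of the race. -/
def raceWalk (p : (G.edgeSet → ℝ) × (G.edgeSet × ℕ → ℝ)) (n : ℕ) : V × ℝ :=
  (((raceState hdeg q hq i₀ p n).1.2 n).1, ((raceState hdeg q hq i₀ p (n + 1)).1.2 n).2)

theorem raceWalk_zero (p : (G.edgeSet → ℝ) × (G.edgeSet × ℕ → ℝ)) :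
    (raceWalk hdeg q hq i₀ p 0).1 = i₀ := rfl

/-- The history kept by the race is the record of its own walk, so statements about races
conditional on the history become statements conditional on past jumps. -/
theorem raceState_history (p : (G.edgeSet → ℝ) × (G.edgeSet × ℕ → ℝ)) (n : ℕ) :
    (raceState hdeg q hq i₀ p n).1 = (p.1, jumpRecord i₀ n (raceWalk hdeg q hq i₀ p)) := by
  induction n with
  | zero =>
    refine Prod.ext rfl (funext fun k => ?_)
    change (i₀, (0 : ℝ)) = _
    by_cases hk : k = 0
    · subst hk
      simp [jumpRecord, raceWalk_zero]
    · simp [jumpRecord, hk]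
  | succ n ih =>
    set p' := raceState hdeg q hq i₀ p n with hp'
    set e := (edgeRace hdeg q hq).winner n p'
    have h1 : (raceState hdeg q hq i₀ p (n + 1)).1 = (p'.1.1, recordJump n p'.1.2
      (otherEnd (p'.1.2 n).1 e) ((edgeRace hdeg q hq).duration n p' e)) := rfl
    have h2 : (raceWalk hdeg q hq i₀ p (n + 1)).1 = otherEnd (p'.1.2 n).1 e := by
      rw [raceWalk, h1]
      simp [recordJump]
    have h3 : (raceWalk hdeg q hq i₀ p n).2 = (edgeRace hdeg q hq).duration n p' e := by
      rw [raceWalk, h1]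
      simp [recordJump]
    rw [jumpRecord_succ, h2, h3, h1, ih]

theorem raceWalk_succ {p : (G.edgeSet → ℝ) × (G.edgeSet × ℕ → ℝ)} {n : ℕ} {e : G.edgeSet}
    (h : (edgeRace hdeg q hq).WinsAt n (raceState hdeg q hq i₀ p n) e) :
    (e : Sym2 V) = s((raceWalk hdeg q hq i₀ p n).1, (raceWalk hdeg q hq i₀ p (n + 1)).1) ∧
    (raceWalk hdeg q hq i₀ p n).2 =
      (edgeRace hdeg q hq).duration n (raceState hdeg q hq i₀ p n) e ∧
    (raceState hdeg q hq i₀ p (n + 1)).2 = remaining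
      ((edgeRace hdeg q hq).speed n (raceState hdeg q hq i₀ p n).1)
      (raceState hdeg q hq i₀ p n).2 e := by
  set p' := raceState hdeg q hq i₀ p n with hp'
  have h0 : raceState hdeg q hq i₀ p (n + 1) = (edgeRace hdeg q hq).stepOf n e p' := by
    rw [← h.winner_eq]
    rfl
  have h1 : (raceState hdeg q hq i₀ p (n + 1)).1 = (p'.1.1, recordJump n p'.1.2
      (otherEnd (p'.1.2 n).1 e) ((edgeRace hdeg q hq).duration n p' e)) := by
    rw [h0]
    rfl
  refine ⟨?_, ?_, ?_⟩
  · have h2 : (raceWalk hdeg q hq i₀ p (n + 1)).1 = otherEnd (p'.1.2 n).1 e := by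
      rw [raceWalk, h1]
      simp [recordJump]
    rw [h2]
    exact (mk_otherEnd ((edgeRace_mem_runners hdeg q hq).1 h.1)).symm
  · rw [raceWalk, h1]
    simp [recordJump]
  · rw [h0]
    rfl

omit [DiscreteMeasurableSpace V] [G.LocallyFinite] [Nonempty G.edgeSet] in
theorem measurable_raceStart : Measurable (raceStart (G := G) i₀) :=
  (measurable_fst.prodMk measurable_const).prodMk measurable_snd

variable [Countable V]

theorem measurable_raceWalk : Measurable (raceWalk hdeg q hq i₀) := by
  refine measurable_pi_lambda _ fun n => ?_
  have h1 : ∀ n, Measurable fun p => raceState hdeg q hq i₀ p n := fun n =>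
    ((edgeRace hdeg q hq).measurable_run n).comp (measurable_raceStart i₀)
  have h2 : ∀ n, Measurable fun p => (raceState hdeg q hq i₀ p n).1.2 n := fun n =>
    (measurable_pi_apply n).comp (h1 n).fst.snd
  have h3 : Measurable fun p => (raceState hdeg q hq i₀ p (n + 1)).1.2 n :=
    (measurable_pi_apply n).comp (h1 (n + 1)).fst.snd
  exact (h2 n).fst.prodMk h3.snd

end EdgeRace

/-! ### The conditional law of the jumps of a race walk -/

section RaceLaw

variable {V : Type*} [MeasurableSpace V] [DiscreteMeasurableSpace V] {G : SimpleGraph V}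
    [G.LocallyFinite] (hdeg : ∀ x, ∃ y, G.Adj x y)
    (q : ℕ → (G.edgeSet → ℝ) × (ℕ → V × ℝ) → G.edgeSet → ℝ) (hq : ∀ n e, Measurable fun h => q n h e)

/-- The conditional probability that the `n`-th jump leads to `j` after a holding time exceeding `s`. -/
def jumpProb (n : ℕ) (h : (G.edgeSet → ℝ) × (ℕ → V × ℝ)) (j : V) (s : ℝ) : ℝ :=
  pairWeight G ((edgeRace hdeg q hq).speed n h) (h.2 n).1 j / (edgeRace hdeg q hq).totalSpeed n h *
    Real.exp (-(edgeRace hdeg q hq).totalSpeed n h * s)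

omit [MeasurableSpace V] [DiscreteMeasurableSpace V] [G.LocallyFinite] in
theorem pairWeight_nonneg {c : G.edgeSet → ℝ} (hc : ∀ e, 0 ≤ c e) (x y : V) :
    0 ≤ pairWeight G c x y := by
  rw [pairWeight]
  split_ifs
  · exact hc _
  · exact le_rfl

theorem jumpProb_nonneg (n : ℕ) (h : (G.edgeSet → ℝ) × (ℕ → V × ℝ)) (j : V) (s : ℝ) :
    0 ≤ jumpProb hdeg q hq n h j s :=
  mul_nonneg (div_nonneg (pairWeight_nonneg ((edgeRace hdeg q hq).speed_nonneg n h) _ _)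
    ((edgeRace hdeg q hq).totalSpeed_pos n h).le) (Real.exp_nonneg _)

/-- Total mass one at `s = 0` is what forces holding times to be almost surely positive in
`ae_holding_pos`. -/
theorem tsum_jumpProb (n : ℕ) (h : (G.edgeSet → ℝ) × (ℕ → V × ℝ)) :
    ∑' j, ENNReal.ofReal (jumpProb hdeg q hq n h j 0) = 1 := by
  rw [tsum_eq_sum (s := G.neighborFinset (h.2 n).1), ← ENNReal.ofReal_sum_of_nonneg]
  · simp only [jumpProb, mul_zero, Real.exp_zero, mul_one]
    rw [← Finset.sum_div, ← edgeRace_totalSpeed hdeg q hq, div_self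
      ((edgeRace hdeg q hq).totalSpeed_pos n h).ne', ENNReal.ofReal_one]
  · exact fun j _ => jumpProb_nonneg hdeg q hq n h j 0
  · intro j hj
    have : ¬ G.Adj (h.2 n).1 j := fun hadj => hj ((G.mem_neighborFinset _ _).2 hadj)
    simp [jumpProb, pairWeight, this]

omit [G.LocallyFinite] in
theorem measurableSet_position_eq (n : ℕ) (x : V) :
    MeasurableSet {h : (G.edgeSet → ℝ) × (ℕ → V × ℝ) | (h.2 n).1 = x} := by
  have h1 : Measurable fun h : (G.edgeSet → ℝ) × (ℕ → V × ℝ) => (h.2 n).1 := by fun_prop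
  exact h1 (MeasurableSet.of_discrete (s := {x}))

theorem measurable_edgeRace_totalSpeed [Countable V] (n : ℕ) :
    Measurable ((edgeRace hdeg q hq).totalSpeed n) :=
  measurable_of_countable_selector (f := fun x h =>
    ∑ e ∈ incidentEdges G x, (edgeRace hdeg q hq).speed n h e) (measurableSet_position_eq n) fun _ =>
    Finset.measurable_sum _ fun e _ => (edgeRace hdeg q hq).measurable_speed n e

theorem measurable_jumpProb [Countable V] (n : ℕ) (j : V) (s : ℝ) :
    Measurable fun h => jumpProb hdeg q hq n h j s := by
  have h1 : Measurable fun h => pairWeight G ((edgeRace hdeg q hq).speed n h) (h.2 n).1 j :=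
    measurable_of_countable_selector (f := fun x h => pairWeight G ((edgeRace hdeg q hq).speed n h) x j)
      (measurableSet_position_eq n) fun x => by
        unfold pairWeight
        split_ifs
        · exact (edgeRace hdeg q hq).measurable_speed n _
        · exact measurable_const
  have h2 := measurable_edgeRace_totalSpeed hdeg q hq n
  exact (h1.div h2).mul (Real.measurable_exp.comp (h2.neg.mul_const s))

variable [Nonempty G.edgeSet] (i₀ : V)

theorem isEdgeRace_raceWalk {p : (G.edgeSet → ℝ) × (G.edgeSet × ℕ → ℝ)}
    (hp : ∀ n, (∃ e, (edgeRace hdeg q hq).WinsAt n (raceState hdeg q hq i₀ p n) e) ∧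
      ∀ k, 0 < (raceState hdeg q hq i₀ p n).2 k) :
    IsEdgeRace
      (fun n => (edgeRace hdeg q hq).speed n (p.1, jumpRecord i₀ n (raceWalk hdeg q hq i₀ p)))
      (fun n => (raceState hdeg q hq i₀ p n).2) (fun n => (raceWalk hdeg q hq i₀ p n).1)
      (fun n => (raceWalk hdeg q hq i₀ p n).2) := by
  intro n
  obtain ⟨⟨e, he⟩, hpos⟩ := hp n
  obtain ⟨h1, h2, h3⟩ := raceWalk_succ hdeg q hq i₀ he
  have hc := (edgeRace hdeg q hq).speed_pos n _ e he.1
  rw [RaceScheme.duration] at h2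
  refine ⟨e, h1, ?_, ?_, ?_, ?_, ?_⟩ <;> beta_reduce
  · rw [h2]
    exact div_pos (hpos _) hc
  · simp only [← raceState_history, h2]
    field_simp
  · intro e' hmem hne
    have he' : e' ∈ (edgeRace hdeg q hq).runners n (raceState hdeg q hq i₀ p n).1 :=
      (edgeRace_mem_runners hdeg q hq).2 hmem
    have h4 := he.2 e' he' hne
    have hc' := (edgeRace hdeg q hq).speed_pos n _ e' he'
    simp only [← raceState_history, h2]
    rwa [lt_div_iff₀ hc', mul_comm] at h4
  · intro m
    simp only [h3, remaining, if_true]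
  · intro e' hne
    refine ⟨?_, fun m => ?_⟩
    · simp only [h3, remaining, if_neg hne, if_true, ← raceState_history, h2]
    · simp [h3, remaining, if_neg hne]

variable [Countable V]

theorem ae_raceState_good (ν : Measure (G.edgeSet → ℝ)) [SFinite ν] :
    ∀ᵐ p ∂ν.prod (expField (G.edgeSet × ℕ)), ∀ n,
      (∃ e, (edgeRace hdeg q hq).WinsAt n (raceState hdeg q hq i₀ p n) e) ∧
        ∀ k, 0 < (raceState hdeg q hq i₀ p n).2 k := by
  have hm : Measurable fun θ : G.edgeSet → ℝ => (θ, fun _ : ℕ => (i₀, (0 : ℝ))) :=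
    measurable_id.prodMk measurable_const
  have h := (edgeRace hdeg q hq).ae_run_good (ν.map fun θ => (θ, fun _ => (i₀, 0)))
  have h1 : (ν.map fun θ => (θ, fun _ : ℕ => (i₀, (0 : ℝ)))).prod (expField (G.edgeSet × ℕ)) =
      (ν.prod (expField (G.edgeSet × ℕ))).map (raceStart i₀) := by
    have h2 := Measure.map_prod_map ν (expField (G.edgeSet × ℕ)) hm measurable_id
    rwa [Measure.map_id] at h2
  rw [h1] at h
  exact ae_of_ae_map (measurable_raceStart i₀).aemeasurable h

/-- Once the current position `x` is fixed, jumping to `j` means that the edge `{x, j}` wins, so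
`measure_run_winsAt` applies. There are countably many `x` to sum over. -/
theorem measure_raceWalk_jump (θ : G.edgeSet → ℝ) (n : ℕ) (j : V) {s : ℝ} (hs : 0 ≤ s)
    {A : Set (ℕ → V × ℝ)} (hA : MeasurableSet A) :
    expField (G.edgeSet × ℕ) {σ | jumpRecord i₀ n (raceWalk hdeg q hq i₀ (θ, σ)) ∈ A ∧
        s < (raceWalk hdeg q hq i₀ (θ, σ) n).2 ∧ (raceWalk hdeg q hq i₀ (θ, σ) (n + 1)).1 = j} =
      ∫⁻ σ in {σ | jumpRecord i₀ n (raceWalk hdeg q hq i₀ (θ, σ)) ∈ A},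
        ENNReal.ofReal (jumpProb hdeg q hq n (θ, jumpRecord i₀ n (raceWalk hdeg q hq i₀ (θ, σ))) j s)
          ∂expField (G.edgeSet × ℕ) := by
  set μ := expField (G.edgeSet × ℕ) with hμ
  set z : (G.edgeSet × ℕ → ℝ) → ℕ → V × ℝ := fun σ => raceWalk hdeg q hq i₀ (θ, σ) with hz
  have hzm : Measurable z := (measurable_raceWalk hdeg q hq i₀).comp measurable_prodMk_left
  have hrm : Measurable fun σ => jumpRecord i₀ n (z σ) := (measurable_jumpRecord i₀ n).comp hzm
  have hpos : ∀ m, Measurable fun σ => (z σ m).1 := fun m => by fun_prop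
  have hposm : ∀ m x, MeasurableSet {σ | (z σ m).1 = x} := fun m x =>
    hpos m (MeasurableSet.of_discrete (s := {x}))
  have hhold : MeasurableSet {σ | s < (z σ n).2} := by
    have : Measurable fun σ => (z σ n).2 := by fun_prop
    exact measurableSet_lt measurable_const this
  have hgood : ∀ᵐ σ ∂μ, ∃ e, (edgeRace hdeg q hq).WinsAt n (raceState hdeg q hq i₀ (θ, σ) n) e := by
    have h := ae_raceState_good hdeg q hq i₀ (Measure.dirac θ)
    rw [Measure.dirac_prod] at h
    filter_upwards [ae_of_ae_map measurable_prodMk_left.aemeasurable h] with σ hσ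
    exact (hσ n).1
  have hpiece : ∀ x, μ {σ | (z σ n).1 = x ∧ jumpRecord i₀ n (z σ) ∈ A ∧ s < (z σ n).2 ∧
        (z σ (n + 1)).1 = j} =
      ∫⁻ σ in {σ | (z σ n).1 = x ∧ jumpRecord i₀ n (z σ) ∈ A},
        ENNReal.ofReal (jumpProb hdeg q hq n (θ, jumpRecord i₀ n (z σ)) j s) ∂μ := by
    intro x
    have hset : MeasurableSet {σ | (z σ n).1 = x ∧ jumpRecord i₀ n (z σ) ∈ A} :=
      (hposm n x).inter (hrm hA)
    by_cases hadj : G.Adj x j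
    · set e : G.edgeSet := ⟨s(x, j), G.mem_edgeSet.2 hadj⟩ with he
      have hA' : MeasurableSet {h : (G.edgeSet → ℝ) × (ℕ → V × ℝ) | (h.2 n).1 = x ∧ h.2 ∈ A} :=
        (measurableSet_position_eq n x).inter (measurable_snd hA)
      -- The initial history is deterministic, hence a Dirac mass; the current position is made part
      -- of the event on the history.
      have key := (edgeRace hdeg q hq).measure_run_winsAt (Measure.dirac (θ, fun _ => (i₀, 0))) n e hs
        hA'
      have hrun := (edgeRace hdeg q hq).measurable_run n
      have hstart : Measurable (Prod.mk (θ, fun _ : ℕ => (i₀, (0 : ℝ))) :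
        (G.edgeSet × ℕ → ℝ) → _) := measurable_prodMk_left
      have hf : Measurable fun h => ENNReal.ofReal ((edgeRace hdeg q hq).speed n h e /
          (edgeRace hdeg q hq).totalSpeed n h *
          Real.exp (-(edgeRace hdeg q hq).totalSpeed n h * s)) := by
        have h2 := measurable_edgeRace_totalSpeed hdeg q hq n
        exact ((((edgeRace hdeg q hq).measurable_speed n e).div h2).mul
          (Real.measurable_exp.comp (h2.neg.mul_const s))).ennreal_ofReal
      have hK : MeasurableSet {p | ((edgeRace hdeg q hq).run p n).1 ∈
            {h : (G.edgeSet → ℝ) × (ℕ → V × ℝ) | (h.2 n).1 = x ∧ h.2 ∈ A} ∧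
          (edgeRace hdeg q hq).WinsAt n ((edgeRace hdeg q hq).run p n) e ∧
            s < (edgeRace hdeg q hq).duration n ((edgeRace hdeg q hq).run p n) e} :=
        (hrun.fst hA').inter ((hrun ((edgeRace hdeg q hq).measurableSet_winsAt n e)).inter
          (measurableSet_lt measurable_const
            (((edgeRace hdeg q hq).measurable_duration n e).comp hrun)))
      rw [Measure.dirac_prod, Measure.map_map hrun.fst hstart, setLIntegral_map hA' hf
        (hrun.fst.comp hstart), Measure.map_apply hstart hK] at key
      have hhist : ∀ σ, ((edgeRace hdeg q hq).run ((θ, fun _ => (i₀, 0)), σ) n).1 =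
        (θ, jumpRecord i₀ n (z σ)) := fun σ => raceState_history hdeg q hq i₀ (θ, σ) n
      have hmem : ∀ σ, ((edgeRace hdeg q hq).run ((θ, fun _ => (i₀, 0)), σ) n).1 ∈
          {h : (G.edgeSet → ℝ) × (ℕ → V × ℝ) | (h.2 n).1 = x ∧ h.2 ∈ A} ↔
          (z σ n).1 = x ∧ jumpRecord i₀ n (z σ) ∈ A := fun σ => by
        rw [hhist, Set.mem_ofPred_eq, jumpRecord_apply_fst i₀ _ le_rfl]
      refine Eq.trans (measure_congr ?_) (key.trans ?_)
      · filter_upwards [hgood] with σ hσ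
        obtain ⟨e', he'⟩ := hσ
        obtain ⟨h1, h2, -⟩ := raceWalk_succ hdeg q hq i₀ he'
        refine propext (Iff.trans ?_ (Iff.symm (and_congr (hmem σ) Iff.rfl)))
        rw [and_assoc]
        refine and_congr_right fun hx => and_congr_right fun _ => ?_
        have hx' : (raceWalk hdeg q hq i₀ (θ, σ) n).1 = x := hx
        rw [hx'] at h1
        constructor
        · rintro ⟨h3, h4⟩
          have h4' : (raceWalk hdeg q hq i₀ (θ, σ) (n + 1)).1 = j := h4
          have hee : e' = e := Subtype.ext (by rw [h1, h4'])
          subst hee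
          exact ⟨he', h2 ▸ h3⟩
        · rintro ⟨h3, h4⟩
          have hee : e' = e := he'.unique h3
          rw [hee] at h1 h2
          exact ⟨lt_of_lt_of_eq h4 h2.symm, (Sym2.congr_right.1 h1).symm⟩
      · have hset' : (fun σ => ((edgeRace hdeg q hq).run ((θ, fun _ => (i₀, 0)), σ) n).1) ⁻¹'
            {h | (h.2 n).1 = x ∧ h.2 ∈ A} = {σ | (z σ n).1 = x ∧ jumpRecord i₀ n (z σ) ∈ A} :=
          Set.ext hmem
        refine Eq.trans ?_ (setLIntegral_congr_fun (f := fun σ => ENNReal.ofReal ((edgeRace hdeg q hq).speed n (θ, jumpRecord i₀ n (z σ)) e /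
            (edgeRace hdeg q hq).totalSpeed n (θ, jumpRecord i₀ n (z σ)) *
            Real.exp (-(edgeRace hdeg q hq).totalSpeed n (θ, jumpRecord i₀ n (z σ)) * s)))
          hset fun σ hσ => ?_)
        · rw [← hset']
          refine lintegral_congr fun σ => ?_
          simp only [Function.comp_apply, hhist]
        · have h1 : (z σ n).1 = x := hσ.1
          simp only [jumpProb, jumpRecord_apply_fst i₀ _ le_rfl, h1]
          rw [pairWeight_of_eq G (e := e) rfl]
    -- Without an edge from `x` to `j` both sides vanish: almost surely every race has a winner, and
    -- the walk then crosses an edge of `G`.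
    · have h0 : μ {σ | (z σ n).1 = x ∧ jumpRecord i₀ n (z σ) ∈ A ∧ s < (z σ n).2 ∧
          (z σ (n + 1)).1 = j} = 0 := by
        refine measure_eq_zero_iff_ae_notMem.2 ?_
        filter_upwards [hgood] with σ hσ
        rintro ⟨h1, -, -, h2⟩
        obtain ⟨e', he'⟩ := hσ
        have h3 := (raceWalk_succ hdeg q hq i₀ he').1
        refine hadj ?_
        rw [← SimpleGraph.mem_edgeSet, ← h1, ← h2, ← h3]
        exact e'.2
      rw [h0, setLIntegral_congr_fun (g := fun _ => 0) hset fun σ hσ => ?_, lintegral_zero]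
      have h1 : (z σ n).1 = x := hσ.1
      simp [jumpProb, jumpRecord_apply_fst i₀ _ le_rfl, h1, pairWeight, hadj]
  have hU : ∀ B : Set (G.edgeSet × ℕ → ℝ), B = ⋃ x, {σ | (z σ n).1 = x ∧ σ ∈ B} := fun B => by
    ext σ; simp
  have hdisj : ∀ B : Set (G.edgeSet × ℕ → ℝ),
      Pairwise (Function.onFun Disjoint fun x => {σ | (z σ n).1 = x ∧ σ ∈ B}) := fun B x y hxy =>
    Set.disjoint_left.2 fun σ h1 h2 => hxy (h1.1.symm.trans h2.1)
  have hP : ∀ (B : Set (G.edgeSet × ℕ → ℝ)), MeasurableSet B → ∀ x,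
      MeasurableSet {σ | (z σ n).1 = x ∧ σ ∈ B} := fun B hB x => (hposm n x).inter hB
  have hB : MeasurableSet {σ | jumpRecord i₀ n (z σ) ∈ A} := hrm hA
  have hB' : MeasurableSet {σ | jumpRecord i₀ n (z σ) ∈ A ∧ s < (z σ n).2 ∧ (z σ (n + 1)).1 = j} :=
    hB.inter (hhold.inter (hposm (n + 1) j))
  change μ {σ | jumpRecord i₀ n (z σ) ∈ A ∧ s < (z σ n).2 ∧ (z σ (n + 1)).1 = j} =
    ∫⁻ σ in {σ | jumpRecord i₀ n (z σ) ∈ A},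
      ENNReal.ofReal (jumpProb hdeg q hq n (θ, jumpRecord i₀ n (z σ)) j s) ∂μ
  rw [hU {σ | jumpRecord i₀ n (z σ) ∈ A}, hU {σ | jumpRecord i₀ n (z σ) ∈ A ∧ s < (z σ n).2 ∧
    (z σ (n + 1)).1 = j}, measure_iUnion (hdisj _) (hP _ hB'),
    lintegral_iUnion (hP _ hB) (hdisj _)]
  exact tsum_congr hpiece

end RaceLaw

/-! ### Conditional probabilities in integrated form -/

section CondExp

variable {Ω : Type*} {m m0 : MeasurableSpace Ω} {P : Measure Ω} [IsFiniteMeasure P]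

theorem measure_inter_eq_of_condExp_ae_eq (hm : m ≤ m0) {A : Set Ω} (hA : MeasurableSet A)
    {f : Ω → ℝ} (h : P⟦A|m⟧ =ᵐ[P] f) {B : Set Ω} (hB : MeasurableSet[m] B) :
    P (B ∩ A) = ∫⁻ ω in B, ENNReal.ofReal (f ω) ∂P := by
  have h1 : ∫⁻ ω in B, ENNReal.ofReal (f ω) ∂P = ∫⁻ ω in B, ENNReal.ofReal ((P⟦A|m⟧) ω) ∂P := by
    refine lintegral_congr_ae (ae_restrict_of_ae ?_)
    filter_upwards [h] with ω hω
    rw [hω]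
  have h0 : 0 ≤ᵐ[P] P⟦A|m⟧ :=
    condExp_nonneg (Filter.Eventually.of_forall fun ω => Set.indicator_nonneg (fun _ _ => zero_le_one) ω)
  have hint : Integrable (A.indicator fun _ => (1 : ℝ)) P := (integrable_const 1).indicator hA
  rw [h1, ← ofReal_integral_eq_lintegral_ofReal integrable_condExp.integrableOn
    (ae_restrict_of_ae h0), setIntegral_condExp hm hint hB, setIntegral_indicator hA]
  simp

theorem condExp_ae_eq_of_measure_inter_eq (hm : m ≤ m0) {A : Set Ω} (hA : MeasurableSet A)
    {f : Ω → ℝ} (hf : Measurable[m] f) (h0 : ∀ ω, 0 ≤ f ω)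
    (h : ∀ B, MeasurableSet[m] B → P (B ∩ A) = ∫⁻ ω in B, ENNReal.ofReal (f ω) ∂P) :
    P⟦A|m⟧ =ᵐ[P] f := by
  have hf' : Measurable f := hf.mono hm le_rfl
  have hint : Integrable f P := by
    refine ⟨hf'.aestronglyMeasurable, ?_⟩
    rw [hasFiniteIntegral_iff_ofReal (Filter.Eventually.of_forall h0), ← setLIntegral_univ,
      ← h Set.univ MeasurableSet.univ]
    exact measure_lt_top _ _
  refine (ae_eq_condExp_of_forall_setIntegral_eq hm ((integrable_const 1).indicator hA)
    (fun B _ _ => hint.integrableOn) (fun B hB _ => ?_) hf.stronglyMeasurable.aestronglyMeasurable).symm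
  rw [setIntegral_indicator hA, integral_eq_lintegral_of_nonneg_ae (Filter.Eventually.of_forall h0)
    hf'.aestronglyMeasurable, ← h B hB]
  simp [Measure.real]

end CondExp

/-! ### Uniqueness criteria for measures -/

section Sequences

/-- Every finite set of coordinates is a function of a sufficiently long record, and the
finite-dimensional marginals determine the law. -/
theorem measure_ext_of_records {α : Type*} [MeasurableSpace α] {T : ℕ → (ℕ → α) → ℕ → α}
    (hT : ∀ n, Measurable (T n)) (hTk : ∀ n z, ∀ k < n, T n z k = z k) {Q Q' : Measure (ℕ → α)}
    [IsFiniteMeasure Q] (h : ∀ n, Q.map (T n) = Q'.map (T n)) : Q = Q' := by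
  have key : ∀ I : Finset ℕ, Q.map I.restrict = Q'.map I.restrict := by
    intro I
    obtain ⟨n, hn⟩ : ∃ n, ∀ k ∈ I, k < n :=
      ⟨I.sup id + 1, fun k hk => Nat.lt_succ_of_le (Finset.le_sup (f := id) hk)⟩
    have h1 : (I.restrict : (ℕ → α) → _) = I.restrict ∘ T n := by
      funext z k
      exact (hTk n z k (hn k k.2)).symm
    rw [h1, ← Measure.map_map (Finset.measurable_restrict I) (hT n),
      ← Measure.map_map (Finset.measurable_restrict I) (hT n), h n]
  exact IsProjectiveLimit.unique (P := fun I => Q.map I.restrict) (fun _ => rfl)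
    fun I => (key I).symm

/-- A jump law prescribes only the tails at `s ≥ 0`. Since neither measure charges `(-∞, 0]`, the
remaining half-lines have the same measure as `(0, ∞)`. -/
theorem measure_ext_of_Ioi_nonneg {m m' : Measure ℝ} [IsFiniteMeasure m]
    (h0 : m (Set.Iic 0) = 0) (h0' : m' (Set.Iic 0) = 0)
    (h : ∀ s, 0 ≤ s → m (Set.Ioi s) = m' (Set.Ioi s)) : m = m' := by
  have h1 : ∀ (m : Measure ℝ), m (Set.Iic 0) = 0 → ∀ D, Set.Ioi 0 ⊆ D → m D = m (Set.Ioi 0) := by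
    intro m hm D hD
    refine le_antisymm ?_ (measure_mono hD)
    calc m D ≤ m (Set.Iic 0 ∪ Set.Ioi 0) := measure_mono (by simp)
      _ ≤ m (Set.Iic 0) + m (Set.Ioi 0) := measure_union_le _ _
      _ = m (Set.Ioi 0) := by rw [hm, zero_add]
  refine ext_of_generate_finite (Set.range Set.Ioi) ?_ isPiSystem_Ioi ?_ ?_
  · rw [← borel_eq_generateFrom_Ioi]
    exact BorelSpace.measurable_eq
  · rintro _ ⟨s, rfl⟩
    rcases le_total 0 s with hs | hs
    · exact h s hs
    · rw [h1 m h0 _ (Set.Ioi_subset_Ioi hs), h1 m' h0' _ (Set.Ioi_subset_Ioi hs), h 0 le_rfl]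
  · rw [h1 m h0 _ (Set.subset_univ _), h1 m' h0' _ (Set.subset_univ _), h 0 le_rfl]

end Sequences

/-! ### Laws determined by their jump probabilities -/

section JumpLaw

variable {V : Type*} [MeasurableSpace V]

/-- Under `Q`, conditionally on the record `z` of the first `n` jumps, the `n`-th holding time exceeds `s`
and the next position is `j` with probability `p n z j s`. -/
structure HasJumpLaw (i₀ : V) (p : ℕ → (ℕ → V × ℝ) → V → ℝ → ℝ) (Q : Measure (ℕ → V × ℝ)) : Prop where
  start : ∀ᵐ z ∂Q, (z 0).1 = i₀
  jump : ∀ (n : ℕ) (j : V) (s : ℝ), 0 ≤ s → ∀ A, MeasurableSet A →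
    Q {z | jumpRecord i₀ n z ∈ A ∧ s < (z n).2 ∧ (z (n + 1)).1 = j} =
      ∫⁻ z in {z | jumpRecord i₀ n z ∈ A}, ENNReal.ofReal (p n (jumpRecord i₀ n z) j s) ∂Q

variable [DiscreteMeasurableSpace V] [Countable V]

omit [Countable V] in
theorem measurableSet_jump (n : ℕ) (j : V) (s : ℝ) :
    MeasurableSet {z : ℕ → V × ℝ | s < (z n).2 ∧ (z (n + 1)).1 = j} := by
  have h1 : Measurable fun z : ℕ → V × ℝ => (z n).2 := by fun_prop
  have h2 : Measurable fun z : ℕ → V × ℝ => (z (n + 1)).1 := by fun_prop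
  exact (measurableSet_lt measurable_const h1).inter (h2 (MeasurableSet.of_discrete (s := {j})))

/-- The probability of a positive holding time is the sum over the next positions; integrating the
total mass one of `f` gives one. -/
theorem ae_holding_pos {Q : Measure (ℕ → V × ℝ)} [IsProbabilityMeasure Q] {n : ℕ}
    {f : (ℕ → V × ℝ) → V → ℝ≥0∞} (hf : ∀ j, AEMeasurable (fun z => f z j) Q)
    (hsum : ∀ᵐ z ∂Q, ∑' j, f z j = 1)
    (h : ∀ j, Q {z | 0 < (z n).2 ∧ (z (n + 1)).1 = j} = ∫⁻ z, f z j ∂Q) :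
    ∀ᵐ z ∂Q, 0 < (z n).2 := by
  have h1 : {z : ℕ → V × ℝ | 0 < (z n).2} = ⋃ j, {z | 0 < (z n).2 ∧ (z (n + 1)).1 = j} := by
    ext z; simp
  have h2 : Measurable fun z : ℕ → V × ℝ => (z n).2 := by fun_prop
  refine (mem_ae_iff_prob_eq_one (measurableSet_lt measurable_const h2)).2 ?_
  change Q {z : ℕ → V × ℝ | 0 < (z n).2} = 1
  rw [h1, measure_iUnion (fun j j' hj => Set.disjoint_left.2 fun z hz hz' =>
    hj (hz.2.symm.trans hz'.2)) (fun j => measurableSet_jump n j 0)]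
  simp only [h]
  rw [← lintegral_tsum hf, lintegral_congr_ae hsum, lintegral_one, measure_univ]

variable {i₀ : V} {p : ℕ → (ℕ → V × ℝ) → V → ℝ → ℝ} {Q Q' : Measure (ℕ → V × ℝ)}
    [IsProbabilityMeasure Q] [IsProbabilityMeasure Q']

theorem HasJumpLaw.ae_pos (h : HasJumpLaw i₀ p Q) (hp : ∀ n j s, Measurable fun z => p n z j s)
    (hsum : ∀ n z, ∑' j, ENNReal.ofReal (p n z j 0) = 1) : ∀ᵐ z ∂Q, ∀ n, 0 < (z n).2 := by
  refine ae_all_iff.2 fun n => ae_holding_pos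
    (f := fun z j => ENNReal.ofReal (p n (jumpRecord i₀ n z) j 0))
    (fun j => (((hp n j 0).comp (measurable_jumpRecord i₀ n)).ennreal_ofReal).aemeasurable)
    (Filter.Eventually.of_forall fun z => hsum n _) fun j => ?_
  simpa using h.jump n j 0 le_rfl Set.univ MeasurableSet.univ

/-- Induction on the length of the record. The law of a record determines its joint law with the
next position and the holding time: the position is tested on points, since `V` is countable, and
the holding time on tails. -/
theorem HasJumpLaw.unique (h : HasJumpLaw i₀ p Q) (h' : HasJumpLaw i₀ p Q')
    (hp : ∀ n j s, Measurable fun z => p n z j s)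
    (hsum : ∀ n z, ∑' j, ENNReal.ofReal (p n z j 0) = 1) : Q = Q' := by
  have hpos := h.ae_pos hp hsum
  have hpos' := h'.ae_pos hp hsum
  refine measure_ext_of_records (measurable_jumpRecord i₀)
    (fun n z k hk => jumpRecord_apply_of_lt i₀ z hk) fun n => ?_
  have hrec : ∀ n, Measurable (jumpRecord (V := V) i₀ n) := measurable_jumpRecord i₀
  induction n with
  | zero =>
    have h0 : ∀ z : ℕ → V × ℝ, (z 0).1 = i₀ → jumpRecord i₀ 0 z = fun _ => (i₀, 0) := by
      intro z hz
      funext k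
      by_cases hk : k = 0
      · simp [jumpRecord, hk, hz]
      · simp [jumpRecord, hk]
    rw [Measure.map_congr (h.start.mono h0), Measure.map_congr (h'.start.mono h0)]
    simp
  | succ n ih =>
    have hmt : Measurable fun z : ℕ → V × ℝ => (z n).2 := by fun_prop
    have hmj : Measurable fun z : ℕ → V × ℝ => (z (n + 1)).1 := by fun_prop
    set J : (ℕ → V × ℝ) → (ℕ → V × ℝ) × V × ℝ := fun z =>
      (jumpRecord i₀ n z, (z (n + 1)).1, (z n).2) with hJ
    have hJm : Measurable J := (hrec n).prodMk (hmj.prodMk hmt)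
    have hcomp : jumpRecord (V := V) i₀ (n + 1) =
        (fun p : (ℕ → V × ℝ) × V × ℝ => recordJump n p.1 p.2.1 p.2.2) ∘ J :=
      funext fun z => jumpRecord_succ i₀ n z
    -- The longer record is a function of the shorter one, the next position and the holding time.
    suffices hQ : Q.map J = Q'.map J by
      rw [hcomp, ← Measure.map_map (measurable_recordJump n) hJm,
        ← Measure.map_map (measurable_recordJump n) hJm, hQ]
    have : IsProbabilityMeasure (Q.map J) := Measure.isProbabilityMeasure_map hJm.aemeasurable
    refine Measure.ext_prod₃ fun {A T D} hA hT hD => ?_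
    have hstep : ∀ j s, 0 ≤ s → Q {z | jumpRecord i₀ n z ∈ A ∧ s < (z n).2 ∧ (z (n + 1)).1 = j} =
        Q' {z | jumpRecord i₀ n z ∈ A ∧ s < (z n).2 ∧ (z (n + 1)).1 = j} := by
      intro j s hs
      have hpm : Measurable fun z => ENNReal.ofReal (p n z j s) := (hp n j s).ennreal_ofReal
      have e1 := setLIntegral_map (μ := Q) hA hpm (hrec n)
      have e2 := setLIntegral_map (μ := Q') hA hpm (hrec n)
      rw [h.jump n j s hs A hA, h'.jump n j s hs A hA]
      exact e1.symm.trans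
        ((congrArg (fun m => ∫⁻ z in A, ENNReal.ofReal (p n z j s) ∂m) ih).trans e2)
    have hlaw : ∀ j, (Q.restrict {z | jumpRecord i₀ n z ∈ A ∧ (z (n + 1)).1 = j}).map (fun z => (z n).2) =
        (Q'.restrict {z | jumpRecord i₀ n z ∈ A ∧ (z (n + 1)).1 = j}).map fun z => (z n).2 := by
      intro j
      have hnull : ∀ M : Measure (ℕ → V × ℝ), (∀ᵐ z ∂M, ∀ n, 0 < (z n).2) →
          ((M.restrict {z | jumpRecord i₀ n z ∈ A ∧ (z (n + 1)).1 = j}).map fun z => (z n).2)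
            (Set.Iic 0) = 0 := by
        intro M hM
        rw [Measure.map_apply hmt measurableSet_Iic]
        refine measure_eq_zero_iff_ae_notMem.2 (ae_restrict_of_ae ?_)
        filter_upwards [hM] with z hz hz'
        exact absurd (hz n) (not_lt.2 hz')
      refine measure_ext_of_Ioi_nonneg (hnull Q hpos) (hnull Q' hpos') fun s hs => ?_
      have hset : (fun z : ℕ → V × ℝ => (z n).2) ⁻¹' Set.Ioi s ∩
          {z | jumpRecord i₀ n z ∈ A ∧ (z (n + 1)).1 = j} =
          {z | jumpRecord i₀ n z ∈ A ∧ s < (z n).2 ∧ (z (n + 1)).1 = j} := by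
        ext z
        simp only [Set.mem_inter_iff, Set.mem_preimage, Set.mem_Ioi, Set.mem_ofPred_eq]
        tauto
      rw [Measure.map_apply hmt measurableSet_Ioi, Measure.map_apply hmt measurableSet_Ioi,
        Measure.restrict_apply (hmt measurableSet_Ioi), Measure.restrict_apply (hmt measurableSet_Ioi),
        hset, hstep j s hs]
    have hsing : ∀ j, Q {z | (jumpRecord i₀ n z ∈ A ∧ (z n).2 ∈ D) ∧ (z (n + 1)).1 = j} =
        Q' {z | (jumpRecord i₀ n z ∈ A ∧ (z n).2 ∈ D) ∧ (z (n + 1)).1 = j} := by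
      intro j
      have e := congrArg (fun m : Measure ℝ => m D) (hlaw j)
      simp only [Measure.map_apply hmt hD, Measure.restrict_apply (hmt hD)] at e
      have hset : (fun z : ℕ → V × ℝ => (z n).2) ⁻¹' D ∩
          {z | jumpRecord i₀ n z ∈ A ∧ (z (n + 1)).1 = j} =
          {z | (jumpRecord i₀ n z ∈ A ∧ (z n).2 ∈ D) ∧ (z (n + 1)).1 = j} := by
        ext z
        simp only [Set.mem_inter_iff, Set.mem_preimage, Set.mem_ofPred_eq]
        tauto
      rwa [hset] at e
    have hpre : J ⁻¹' (A ×ˢ T ×ˢ D) =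
        ⋃ j ∈ T, {z | (jumpRecord i₀ n z ∈ A ∧ (z n).2 ∈ D) ∧ (z (n + 1)).1 = j} := by
      ext z
      simp only [hJ, Set.mem_preimage, Set.mem_prod, Set.mem_iUnion, Set.mem_ofPred_eq, exists_prop]
      constructor
      · exact fun ⟨h1, h2, h3⟩ => ⟨_, h2, ⟨h1, h3⟩, rfl⟩
      · rintro ⟨j, hj, ⟨h1, h3⟩, rfl⟩
        exact ⟨h1, hj, h3⟩
    have hms : ∀ j, MeasurableSet
        {z : ℕ → V × ℝ | (jumpRecord i₀ n z ∈ A ∧ (z n).2 ∈ D) ∧ (z (n + 1)).1 = j} := fun j =>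
      (((hrec n) hA).inter (hmt hD)).inter (hmj (MeasurableSet.of_discrete (s := {j})))
    have hdisj : T.PairwiseDisjoint fun j =>
        {z : ℕ → V × ℝ | (jumpRecord i₀ n z ∈ A ∧ (z n).2 ∈ D) ∧ (z (n + 1)).1 = j} :=
      fun j _ j' _ hj => Set.disjoint_left.2 fun z hz hz' => hj (hz.2.symm.trans hz'.2)
    have hTD := hA.prod (hT.prod hD)
    rw [Measure.map_apply hJm hTD, Measure.map_apply hJm hTD, hpre,
      measure_biUnion T.to_countable hdisj fun j _ => hms j,
      measure_biUnion T.to_countable hdisj fun j _ => hms j]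
    exact tsum_congr fun j => hsing j

end JumpLaw

/-! ### Laws determined by their transition probabilities -/

section StepLaw

variable {V : Type*} [MeasurableSpace V]

/-- The first `n + 1` positions. -/
def stepRecord (i₀ : V) (n : ℕ) (x : ℕ → V) : ℕ → V := fun k => if k ≤ n then x k else i₀

omit [MeasurableSpace V] in
theorem stepRecord_apply (i₀ : V) {n k : ℕ} (x : ℕ → V) (h : k ≤ n) : stepRecord i₀ n x k = x k :=
  if_pos h

theorem measurable_stepRecord (i₀ : V) (n : ℕ) : Measurable (stepRecord i₀ n) := by
  refine measurable_pi_lambda _ fun k => ?_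
  unfold stepRecord
  split_ifs <;> fun_prop

/-- Under `Q`, conditionally on the first `n + 1` positions, recorded in `x`, the next position is `j`
with probability `p n x j`. -/
structure HasStepLaw (i₀ : V) (p : ℕ → (ℕ → V) → V → ℝ) (Q : Measure (ℕ → V)) : Prop where
  start : ∀ᵐ x ∂Q, x 0 = i₀
  step : ∀ (n : ℕ) (j : V), ∀ A, MeasurableSet A →
    Q {x | stepRecord i₀ n x ∈ A ∧ x (n + 1) = j} =
      ∫⁻ x in {x | stepRecord i₀ n x ∈ A}, ENNReal.ofReal (p n (stepRecord i₀ n x) j) ∂Q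

variable [DiscreteMeasurableSpace V] [Countable V]

theorem HasStepLaw.unique {i₀ : V} {p : ℕ → (ℕ → V) → V → ℝ} {Q Q' : Measure (ℕ → V)}
    [IsProbabilityMeasure Q] [IsProbabilityMeasure Q'] (h : HasStepLaw i₀ p Q)
    (h' : HasStepLaw i₀ p Q') (hp : ∀ n j, Measurable fun x => p n x j) : Q = Q' := by
  refine measure_ext_of_records (measurable_stepRecord i₀)
    (fun n z k hk => stepRecord_apply i₀ z hk.le) fun n => ?_
  have hrec : ∀ n, Measurable (stepRecord (V := V) i₀ n) := measurable_stepRecord i₀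
  induction n with
  | zero =>
    have h0 : ∀ x : ℕ → V, x 0 = i₀ → stepRecord i₀ 0 x = fun _ => i₀ := by
      intro x hx
      funext k
      by_cases hk : k = 0
      · simp [stepRecord, hk, hx]
      · simp [stepRecord, hk]
    rw [Measure.map_congr (h.start.mono h0), Measure.map_congr (h'.start.mono h0)]
    simp
  | succ n ih =>
    have hmj : Measurable fun x : ℕ → V => x (n + 1) := by fun_prop
    set J : (ℕ → V) → (ℕ → V) × V := fun x => (stepRecord i₀ n x, x (n + 1)) with hJ
    have hJm : Measurable J := (hrec n).prodMk hmj
    set F : (ℕ → V) × V → ℕ → V := fun p k => if k = n + 1 then p.2 else p.1 k with hF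
    have hFm : Measurable F := by
      refine measurable_pi_lambda _ fun k => ?_
      simp only [hF]
      split_ifs <;> fun_prop
    have hcomp : stepRecord (V := V) i₀ (n + 1) = F ∘ J := by
      funext x k
      by_cases hk : k = n + 1
      · simp [hF, hJ, stepRecord, hk]
      · by_cases hk' : k ≤ n
        · simp [hF, hJ, stepRecord, hk, hk', Nat.le_succ_of_le hk']
        · have : ¬ k ≤ n + 1 := by omega
          simp [hF, hJ, stepRecord, hk, hk', this]
    suffices hQ : Q.map J = Q'.map J by
      rw [hcomp, ← Measure.map_map hFm hJm, ← Measure.map_map hFm hJm, hQ]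
    have : IsProbabilityMeasure (Q.map J) := Measure.isProbabilityMeasure_map hJm.aemeasurable
    refine Measure.ext_prod fun {A T} hA hT => ?_
    have hsing : ∀ j, Q {x | stepRecord i₀ n x ∈ A ∧ x (n + 1) = j} =
        Q' {x | stepRecord i₀ n x ∈ A ∧ x (n + 1) = j} := by
      intro j
      have hpm : Measurable fun x => ENNReal.ofReal (p n x j) := (hp n j).ennreal_ofReal
      have e1 := setLIntegral_map (μ := Q) hA hpm (hrec n)
      have e2 := setLIntegral_map (μ := Q') hA hpm (hrec n)
      rw [h.step n j A hA, h'.step n j A hA]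
      exact e1.symm.trans
        ((congrArg (fun m => ∫⁻ x in A, ENNReal.ofReal (p n x j) ∂m) ih).trans e2)
    have hpre : J ⁻¹' (A ×ˢ T) = ⋃ j ∈ T, {x | stepRecord i₀ n x ∈ A ∧ x (n + 1) = j} := by
      ext x
      simp [hJ]
    have hms : ∀ j, MeasurableSet {x : ℕ → V | stepRecord i₀ n x ∈ A ∧ x (n + 1) = j} := fun j =>
      ((hrec n) hA).inter (hmj (MeasurableSet.of_discrete (s := {j})))
    have hdisj : T.PairwiseDisjoint fun j => {x : ℕ → V | stepRecord i₀ n x ∈ A ∧ x (n + 1) = j} :=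
      fun j _ j' _ hj => Set.disjoint_left.2 fun z hz hz' => hj (hz.2.symm.trans hz'.2)
    rw [Measure.map_apply hJm (hA.prod hT), Measure.map_apply hJm (hA.prod hT), hpre,
      measure_biUnion T.to_countable hdisj fun j _ => hms j,
      measure_biUnion T.to_countable hdisj fun j _ => hms j]
    exact tsum_congr fun j => hsing j

end StepLaw

theorem occupation_congr {V : Type*} {ξ ξ' : ℕ → V} {S S' : ℕ → ℝ} {n : ℕ}
    (h : ∀ k < n, ξ k = ξ' k) (hS : ∀ k < n, S k = S' k) (x : V) :
    occupation ξ S x n = occupation ξ' S' x n :=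
  Finset.sum_congr rfl fun k hk => by
    have hk := Finset.mem_range.1 hk
    rw [h k hk, hS k hk]

theorem localTime_jumpPath_eq_occupation {V : Type*} {ξ : ℕ → V} {S : ℕ → ℝ} {n : ℕ}
    (hS : ∀ k < n, 0 < S k) (x : V) :
    localTime (jumpPath ξ S) (some x) (jumpTime S n) = occupation ξ S x n := by
  classical
  cases n with
  | zero => simp [localTime, jumpTime, occupation]
  | succ n =>
    rw [jumpTime_succ, localTime_jumpPath (fun k hk => hS k (by omega)) x (hS n (by omega)).le le_rfl,
      occupation_succ]

/-! ### The vertex-reinforced jump process as a race -/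

section VertexReinforced

variable {V : Type*} [MeasurableSpace V] [DiscreteMeasurableSpace V]

theorem measurable_occupation (x : V) (n : ℕ) : Measurable fun z : ℕ → V × ℝ =>
    occupation (fun k => (z k).1) (fun k => (z k).2) x n := by
  classical
  unfold occupation
  refine Finset.measurable_sum _ fun k _ => ?_
  have h1 : Measurable fun z : ℕ → V × ℝ => (z k).1 := by fun_prop
  have h2 : Measurable fun z : ℕ → V × ℝ => (z k).2 := by fun_prop
  convert Measurable.ite (h1 (MeasurableSet.of_discrete (s := {x}))) h2 measurable_const using 1
  rfl

variable (G : SimpleGraph V)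

/-- The rate at which the vertex-reinforced jump process crosses the adjacent edge `e`. -/
def vertexReinforcedSpeed (n : ℕ) (h : (G.edgeSet → ℝ) × (ℕ → V × ℝ)) (e : G.edgeSet) : ℝ :=
  h.1 e * (1 + occupation (fun k => (h.2 k).1) (fun k => (h.2 k).2) (otherEnd (h.2 n).1 e) n)

variable [Countable V]

theorem measurable_vertexReinforcedSpeed (n : ℕ) (e : G.edgeSet) :
    Measurable fun h => vertexReinforcedSpeed G n h e :=
  measurable_of_countable_selector (e := fun h : (G.edgeSet → ℝ) × (ℕ → V × ℝ) => (h.2 n).1)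
    (f := fun x h => h.1 e *
      (1 + occupation (fun k => (h.2 k).1) (fun k => (h.2 k).2) (otherEnd x e) n))
    (measurableSet_position_eq n) fun x =>
    ((measurable_pi_apply e).comp measurable_fst).mul
      (((measurable_occupation (otherEnd x e) n).comp measurable_snd).const_add 1)

variable [G.LocallyFinite] (hdeg : ∀ x, ∃ y, G.Adj x y) (i₀ : V)

/-- The race that drives the vertex-reinforced jump process. -/
abbrev vertexReinforcedRace : RaceScheme G.edgeSet ((G.edgeSet → ℝ) × (ℕ → V × ℝ)) :=
  edgeRace hdeg (vertexReinforcedSpeed G) (measurable_vertexReinforcedSpeed G)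

theorem vertexReinforcedRace_speed {w : G.edgeSet → ℝ} (hw : ∀ e, 0 < w e) {n : ℕ} {z : ℕ → V × ℝ}
    (hz : ∀ k < n, 0 < (z k).2) {e : G.edgeSet} {y : V} (he : (e : Sym2 V) = s((z n).1, y)) :
    (vertexReinforcedRace G hdeg).speed n (w, jumpRecord i₀ n z) e =
      w e * (1 + occupation (fun k => (z k).1) (fun k => (z k).2) y n) := by
  have h1 : (jumpRecord i₀ n z n).1 = (z n).1 := jumpRecord_apply_fst i₀ z le_rfl
  have h2 : vertexReinforcedSpeed G n (w, jumpRecord i₀ n z) e =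
      w e * (1 + occupation (fun k => (z k).1) (fun k => (z k).2) y n) := by
    simp only [vertexReinforcedSpeed, h1, he, otherEnd_mk]
    rw [occupation_congr (fun k hk => ?_) (fun k hk => ?_)]
    · simp only [jumpRecord_apply_of_lt i₀ z hk]
    · simp only [jumpRecord_apply_of_lt i₀ z hk]
  rw [← h2]
  refine edgeRace_speed_of_mem hdeg _ _ ?_ ?_
  · rw [h1, he]
    exact Sym2.mem_mk_left _ _
  · rw [h2]
    have := occupation_nonneg (ξ := fun k => (z k).1) (x := y) hz
    exact mul_pos (hw e) (by linarith)

/-- The rate is defined by a local time of the path and the speed by a sum of holding times. They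
agree because the earlier holding times are positive. -/
theorem vrjpRate_eq_pairWeight {w : G.edgeSet → ℝ} (hw : ∀ e, 0 < w e) {n : ℕ} {z : ℕ → V × ℝ}
    (hz : ∀ k < n, 0 < (z k).2) (j : V) :
    vrjpRate G w (fun k => (z k).1) (fun k => (z k).2) n j =
      pairWeight G ((vertexReinforcedRace G hdeg).speed n (w, jumpRecord i₀ n z)) (z n).1 j := by
  rw [vrjpRate, localTime_jumpPath_eq_occupation hz]
  by_cases hadj : G.Adj (z n).1 j
  · rw [pairWeight_of_eq G (e := ⟨s((z n).1, j), G.mem_edgeSet.2 hadj⟩) rfl,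
      pairWeight_of_eq G (e := ⟨s((z n).1, j), G.mem_edgeSet.2 hadj⟩) rfl,
      vertexReinforcedRace_speed G hdeg i₀ hw hz rfl]
  · simp [pairWeight, hadj]

theorem vrjp_eq_jumpProb {w : G.edgeSet → ℝ} (hw : ∀ e, 0 < w e) {n : ℕ} {z : ℕ → V × ℝ}
    (hz : ∀ k < n, 0 < (z k).2) (j : V) (s : ℝ) :
    vrjpRate G w (fun k => (z k).1) (fun k => (z k).2) n j /
        vrjpTotalRate G w (fun k => (z k).1) (fun k => (z k).2) n *
      Real.exp (-(vrjpTotalRate G w (fun k => (z k).1) (fun k => (z k).2) n * s)) =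
    jumpProb hdeg (vertexReinforcedSpeed G) (measurable_vertexReinforcedSpeed G) n
      (w, jumpRecord i₀ n z) j s := by
  have h1 : (jumpRecord i₀ n z n).1 = (z n).1 := jumpRecord_apply_fst i₀ z le_rfl
  have h2 : vrjpTotalRate G w (fun k => (z k).1) (fun k => (z k).2) n =
      (vertexReinforcedRace G hdeg).totalSpeed n (w, jumpRecord i₀ n z) := by
    rw [edgeRace_totalSpeed, vrjpTotalRate]
    dsimp only
    rw [h1]
    exact Finset.sum_congr rfl fun j _ => vrjpRate_eq_pairWeight G hdeg i₀ hw hz j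
  rw [jumpProb, h2, vrjpRate_eq_pairWeight G hdeg i₀ hw hz, neg_mul]
  simp only [h1]

end VertexReinforced

/-! ### The σ-algebra of the past -/

section Past

variable {V : Type*} [MeasurableSpace V] (i₀ : V) (n : ℕ)

theorem jumpPast_le : jumpPast (fun n (z : ℕ → V × ℝ) => (z n).1) (fun n z => (z n).2) n ≤
    MeasurableSpace.pi :=
  Measurable.comap_le (by fun_prop)

theorem measurable_jumpRecord_jumpPast :
    Measurable[jumpPast (fun n (z : ℕ → V × ℝ) => (z n).1) (fun n z => (z n).2) n]
      (jumpRecord i₀ n) := by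
  set g : (ℕ → V × ℝ) → (Fin (n + 1) → V) × (Fin n → ℝ) :=
    fun z => (fun k => (z k).1, fun k => (z k).2) with hg
  have hgm : Measurable[MeasurableSpace.comap g inferInstance] g := comap_measurable g
  have h1 : ∀ k (hk : k < n + 1), Measurable[MeasurableSpace.comap g inferInstance]
      fun z : ℕ → V × ℝ => (z k).1 := fun k hk =>
    (measurable_pi_apply (X := fun _ : Fin (n + 1) => V) ⟨k, hk⟩).comp (measurable_fst.comp hgm)
  have h2 : ∀ k (hk : k < n), Measurable[MeasurableSpace.comap g inferInstance]
      fun z : ℕ → V × ℝ => (z k).2 := fun k hk =>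
    (measurable_pi_apply (X := fun _ : Fin n => ℝ) ⟨k, hk⟩).comp (measurable_snd.comp hgm)
  refine @measurable_pi_lambda _ _ _ (MeasurableSpace.comap g inferInstance) _ _ fun k => ?_
  unfold jumpRecord
  split_ifs with hk hk'
  · exact (h1 k (by omega)).prodMk (h2 k hk)
  · exact (h1 n (by omega)).prodMk measurable_const
  · exact measurable_const

/-- An event of the past depends only on the coordinates that the record keeps. So conditioning on
`jumpPast` and conditioning on the record amount to the same. -/
theorem jumpRecord_mem_iff {B : Set (ℕ → V × ℝ)}
    (hB : MeasurableSet[jumpPast (fun n (z : ℕ → V × ℝ) => (z n).1) (fun n z => (z n).2) n] B)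
    (z : ℕ → V × ℝ) : jumpRecord i₀ n z ∈ B ↔ z ∈ B := by
  obtain ⟨C, -, rfl⟩ := hB
  simp only [Set.mem_preimage]
  have h1 : ∀ k : Fin (n + 1), (jumpRecord i₀ n z k).1 = (z k).1 := fun k =>
    jumpRecord_apply_fst i₀ z (Nat.lt_succ_iff.1 k.2)
  have h2 : ∀ k : Fin n, (jumpRecord i₀ n z k).2 = (z k).2 := fun k => by
    rw [jumpRecord_apply_of_lt i₀ z k.2]
  simp only [h1, h2]

end Past

section RaceJumpLaw

variable {V : Type*} [MeasurableSpace V] [DiscreteMeasurableSpace V] [Countable V] {G : SimpleGraph V}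
    [G.LocallyFinite] [Nonempty G.edgeSet] (hdeg : ∀ x, ∃ y, G.Adj x y)
    (q : ℕ → (G.edgeSet → ℝ) × (ℕ → V × ℝ) → G.edgeSet → ℝ) (hq : ∀ n e, Measurable fun h => q n h e)
    (i₀ : V)

theorem hasJumpLaw_raceWalk (θ : G.edgeSet → ℝ) :
    HasJumpLaw i₀ (fun n z j s => jumpProb hdeg q hq n (θ, z) j s)
      ((expField (G.edgeSet × ℕ)).map fun σ => raceWalk hdeg q hq i₀ (θ, σ)) := by
  have hm : Measurable fun σ => raceWalk hdeg q hq i₀ (θ, σ) :=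
    (measurable_raceWalk hdeg q hq i₀).comp measurable_prodMk_left
  have hrm := measurable_jumpRecord (V := V) i₀
  refine ⟨?_, fun n j s hs A hA => ?_⟩
  · have h1 : Measurable fun z : ℕ → V × ℝ => (z 0).1 := by fun_prop
    refine (ae_map_iff hm.aemeasurable (h1 (MeasurableSet.of_discrete (s := {i₀})))).2
      (Filter.Eventually.of_forall fun σ => raceWalk_zero hdeg q hq i₀ _)
  · have hp : Measurable fun z : ℕ → V × ℝ =>
        ENNReal.ofReal (jumpProb hdeg q hq n (θ, jumpRecord i₀ n z) j s) :=
      (((measurable_jumpProb hdeg q hq n j s).comp measurable_prodMk_left).comp (hrm n)).ennreal_ofReal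
    have hA' : MeasurableSet {z : ℕ → V × ℝ | jumpRecord i₀ n z ∈ A} := hrm n hA
    have hA'' : MeasurableSet {z : ℕ → V × ℝ | jumpRecord i₀ n z ∈ A ∧ s < (z n).2 ∧
      (z (n + 1)).1 = j} := hA'.inter (measurableSet_jump n j s)
    rw [Measure.map_apply hm hA'', setLIntegral_map hA' hp hm]
    exact measure_raceWalk_jump hdeg q hq i₀ θ n j hs hA

end RaceJumpLaw

/-! ### Existence and uniqueness of the law of the VRJP -/

section Kernel

variable {V : Type*} [MeasurableSpace V] [DiscreteMeasurableSpace V] [Countable V] (G : SimpleGraph V)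
    [G.LocallyFinite] [Nonempty G.edgeSet] (hdeg : ∀ x, ∃ y, G.Adj x y) (i₀ : V)

/-- The walk of the race that drives the vertex-reinforced jump process. -/
abbrev vertexReinforcedWalk : (G.edgeSet → ℝ) × (G.edgeSet × ℕ → ℝ) → ℕ → V × ℝ :=
  raceWalk hdeg (vertexReinforcedSpeed G) (measurable_vertexReinforcedSpeed G) i₀

/-- The law of the vertex-reinforced jump process as a function of the weights. -/
def vertexReinforcedKernel : Kernel (G.edgeSet → ℝ) (ℕ → V × ℝ) :=
  (Kernel.id ×ₖ Kernel.const _ (expField (G.edgeSet × ℕ))).map (vertexReinforcedWalk G hdeg i₀)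

instance : IsMarkovKernel (vertexReinforcedKernel G hdeg i₀) :=
  Kernel.IsMarkovKernel.map _ (measurable_raceWalk hdeg _ _ i₀)

theorem vertexReinforcedKernel_apply (w : G.edgeSet → ℝ) : vertexReinforcedKernel G hdeg i₀ w =
    (expField (G.edgeSet × ℕ)).map fun σ => vertexReinforcedWalk G hdeg i₀ (w, σ) := by
  rw [vertexReinforcedKernel, Kernel.map_apply _ (measurable_raceWalk hdeg _ _ i₀), Kernel.prod_apply,
    Kernel.id_apply, Kernel.const_apply, Measure.dirac_prod,
    Measure.map_map (measurable_raceWalk hdeg _ _ i₀) measurable_prodMk_left]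
  rfl

theorem hasJumpLaw_vertexReinforcedKernel (w : G.edgeSet → ℝ) :
    HasJumpLaw i₀ (fun n z j s => jumpProb hdeg (vertexReinforcedSpeed G)
      (measurable_vertexReinforcedSpeed G) n (w, z) j s) (vertexReinforcedKernel G hdeg i₀ w) := by
  rw [vertexReinforcedKernel_apply]
  exact hasJumpLaw_raceWalk hdeg _ _ i₀ w

theorem isVRJPKernel_vertexReinforcedKernel : IsVRJPKernel G i₀ (vertexReinforcedKernel G hdeg i₀) := by
  refine ⟨inferInstance, fun w hw => ⟨fun n => by fun_prop, fun n => by fun_prop,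
    (hasJumpLaw_vertexReinforcedKernel G hdeg i₀ w).start, fun n j s hs => ?_⟩⟩
  have hlaw := hasJumpLaw_vertexReinforcedKernel G hdeg i₀ w
  have hp := fun n j s => (measurable_jumpProb hdeg (vertexReinforcedSpeed G)
    (measurable_vertexReinforcedSpeed G) n j s).comp (measurable_prodMk_left (x := w))
  have hpos := hlaw.ae_pos hp fun n z => tsum_jumpProb hdeg _ _ n (w, z)
  refine (condExp_ae_eq_of_measure_inter_eq (jumpPast_le n) (measurableSet_jump n j s)
    (f := fun z => jumpProb hdeg (vertexReinforcedSpeed G) (measurable_vertexReinforcedSpeed G) n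
      (w, jumpRecord i₀ n z) j s) ((hp n j s).comp (measurable_jumpRecord_jumpPast i₀ n))
    (fun z => jumpProb_nonneg hdeg _ _ n _ j s) fun B hB => ?_).trans ?_
  · have h := hlaw.jump n j s hs B (jumpPast_le n B hB)
    simp only [jumpRecord_mem_iff i₀ n hB] at h
    exact h
  · filter_upwards [hpos] with z hz
    exact (vrjp_eq_jumpProb G hdeg i₀ hw (fun k _ => hz k) j s).symm

omit [Nonempty G.edgeSet] in
-- `IsVRJP` does not include positivity of the holding times, while its rates have the expected form
-- only if the earlier ones are positive. Positivity is therefore obtained by strong induction: the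
-- jump probabilities at step `n` are valid as soon as the holding times before `n` are positive,
-- and they make the `n`-th one positive.
theorem IsVRJP.hasJumpLaw {w : G.edgeSet → ℝ} (hw : ∀ e, 0 < w e) {Q : Measure (ℕ → V × ℝ)}
    [IsProbabilityMeasure Q] (h : IsVRJP G w i₀ Q (fun n z => (z n).1) (fun n z => (z n).2)) :
    HasJumpLaw i₀ (fun n z j s => jumpProb hdeg (vertexReinforcedSpeed G)
      (measurable_vertexReinforcedSpeed G) n (w, z) j s) Q := by
  have hp := fun n j s => (measurable_jumpProb hdeg (vertexReinforcedSpeed G)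
    (measurable_vertexReinforcedSpeed G) n j s).comp (measurable_prodMk_left (x := w))
  have hjump : ∀ n, (∀ᵐ z ∂Q, ∀ k < n, 0 < (z k).2) → ∀ (j : V) (s : ℝ), 0 ≤ s →
      ∀ A, MeasurableSet A → Q {z | jumpRecord i₀ n z ∈ A ∧ s < (z n).2 ∧ (z (n + 1)).1 = j} =
        ∫⁻ z in {z | jumpRecord i₀ n z ∈ A}, ENNReal.ofReal (jumpProb hdeg (vertexReinforcedSpeed G)
          (measurable_vertexReinforcedSpeed G) n (w, jumpRecord i₀ n z) j s) ∂Q := by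
    intro n hn j s hs A hA
    refine (measure_inter_eq_of_condExp_ae_eq (jumpPast_le n) (measurableSet_jump n j s)
      (h.jump n j s hs) (measurable_jumpRecord_jumpPast i₀ n hA)).trans ?_
    refine lintegral_congr_ae (ae_restrict_of_ae ?_)
    filter_upwards [hn] with z hz
    rw [vrjp_eq_jumpProb G hdeg i₀ hw hz j s]
  have hpos : ∀ n, ∀ᵐ z ∂Q, 0 < (z n).2 := by
    intro n
    induction n using Nat.strong_induction_on with
    | _ n ih =>
      refine ae_holding_pos (fun j => (((hp n j 0).comp
        (measurable_jumpRecord i₀ n)).ennreal_ofReal).aemeasurable)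
        (Filter.Eventually.of_forall fun z => tsum_jumpProb hdeg _ _ n (w, jumpRecord i₀ n z))
        fun j => ?_
      have hn : ∀ᵐ z ∂Q, ∀ k < n, 0 < (z k).2 := by
        refine ae_all_iff.2 fun k => ?_
        by_cases hk : k < n
        · filter_upwards [ih k hk] with z hz _
          exact hz
        · exact Filter.Eventually.of_forall fun z hk' => absurd hk' hk
      simpa using hjump n hn j 0 le_rfl Set.univ MeasurableSet.univ
  exact ⟨h.start, fun n => hjump n ((ae_all_iff.2 hpos).mono fun z hz k _ => hz k)⟩

/-- The law of the vertex-reinforced jump process is determined by its weights. -/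
theorem IsVRJPKernel.apply_eq {κ : Kernel (G.edgeSet → ℝ) (ℕ → V × ℝ)} (hκ : IsVRJPKernel G i₀ κ)
    {w : G.edgeSet → ℝ} (hw : ∀ e, 0 < w e) : κ w = vertexReinforcedKernel G hdeg i₀ w := by
  have := hκ.1
  exact ((hκ.2 w hw).hasJumpLaw G hdeg i₀ hw).unique
    (hasJumpLaw_vertexReinforcedKernel G hdeg i₀ w)
    (fun n j s => (measurable_jumpProb hdeg (vertexReinforcedSpeed G)
      (measurable_vertexReinforcedSpeed G) n j s).comp (measurable_prodMk_left (x := w)))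
    fun n z => tsum_jumpProb hdeg _ _ n (w, z)

end Kernel

/-- The set `B n` consists of the endpoints of walks of length `n` from `i`. It is countable by
local finiteness, and by connectedness these sets cover `V`. -/
theorem SimpleGraph.Connected.countable {V : Type*} {G : SimpleGraph V} [G.LocallyFinite]
    (hG : G.Connected) : Countable V := by
  obtain ⟨i⟩ := hG.nonempty
  let B : ℕ → Set V := fun n => Nat.rec {i} (fun _ s => ⋃ x ∈ s, (G.neighborFinset x : Set V)) n
  have hB : ∀ n, (B n).Countable := by
    intro n
    induction n with
    | zero => exact Set.countable_singleton i
    | succ n ih => exact ih.biUnion fun x _ => (G.neighborFinset x).countable_toSet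
  have hwalk : ∀ {x y : V} (p : G.Walk x y) (n : ℕ), x ∈ B n → ∃ m, y ∈ B m := by
    intro x y p
    induction p with
    | nil => exact fun n hn => ⟨n, hn⟩
    | cons hadj p ih =>
      exact fun n hn => ih (n + 1)
        (Set.mem_biUnion hn (Finset.mem_coe.2 ((G.mem_neighborFinset _ _).2 hadj)))
  refine Set.countable_univ_iff.1 ((Set.countable_iUnion hB).mono fun y _ => ?_)
  obtain ⟨p⟩ := hG.preconnected i y
  exact Set.mem_iUnion.2 (hwalk p 0 rfl)

theorem strictMono_alarmTime {b : ℝ} (hb : 0 < b) {τ : ℕ → ℝ} (hτ : ∀ k, 0 < τ k) :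
    StrictMono (alarmTime b τ) := by
  refine strictMono_nat_of_lt_succ fun k => ?_
  have := hτ k
  rw [alarmTime, alarmTime, Finset.sum_range_succ]
  have : 0 < 1 / (b + k) * τ k := by positivity
  linarith

theorem measurableSet_apply_eq {V : Type*} [MeasurableSpace V] [DiscreteMeasurableSpace V] (n : ℕ)
    (y : V) : MeasurableSet {x : ℕ → V | x n = y} := by
  have h : Measurable fun x : ℕ → V => x n := by fun_prop
  exact h (MeasurableSet.of_discrete (s := {y}))

/-! ### The edge-reinforced random walk as a race -/

section EdgeReinforced

variable {V : Type*} [MeasurableSpace V] [DiscreteMeasurableSpace V] [Countable V] (G : SimpleGraph V)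

theorem measurable_crossings (e : Sym2 V) (n : ℕ) :
    Measurable fun x : ℕ → V => (crossings x e n : ℝ) := by
  classical
  have h1 : ∀ k, Measurable fun x : ℕ → V => (x k, x (k + 1)) := fun k => by fun_prop
  have h2 : Measurable fun x : ℕ → V => crossings x e n := by
    unfold crossings
    refine Finset.measurable_sum _ fun k _ => ?_
    convert Measurable.ite (h1 k (MeasurableSet.of_discrete (s := {q | s(q.1, q.2) = e})))
      measurable_const measurable_const using 1
    rfl
  exact measurable_from_top.comp h2

omit [MeasurableSpace V] [DiscreteMeasurableSpace V] [Countable V] in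
theorem reinforcedWeight_eq_add_crossings (a : G.edgeSet → ℝ) (x : ℕ → V) (n : ℕ) (e : G.edgeSet) :
    reinforcedWeight G a x n e = a e + crossings x e n := by
  rw [reinforcedWeight, crossings]
  push_cast
  rfl

/-- The weight of an edge for the edge-reinforced random walk. -/
def edgeReinforcedSpeed (n : ℕ) (h : (G.edgeSet → ℝ) × (ℕ → V × ℝ)) (e : G.edgeSet) : ℝ :=
  h.1 e + crossings (fun k => (h.2 k).1) e n

theorem measurable_edgeReinforcedSpeed (n : ℕ) (e : G.edgeSet) :
    Measurable fun h => edgeReinforcedSpeed G n h e := by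
  have h1 : Measurable fun (h : (G.edgeSet → ℝ) × (ℕ → V × ℝ)) (k : ℕ) => (h.2 k).1 :=
    measurable_pi_lambda _ fun k => by fun_prop
  have h2 : Measurable fun h : (G.edgeSet → ℝ) × (ℕ → V × ℝ) => h.1 e := by fun_prop
  have h3 := measurable_crossings (V := V) (e : Sym2 V) n
  exact h2.add (h3.comp h1)

variable [G.LocallyFinite] (hdeg : ∀ x, ∃ y, G.Adj x y) (i₀ : V)

/-- The transition probabilities of the edge-reinforced random walk. -/
def stepProb (a : G.edgeSet → ℝ) (n : ℕ) (x : ℕ → V) (j : V) : ℝ :=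
  pairWeight G (reinforcedWeight G a x n) (x n) j /
    ∑ k ∈ G.neighborFinset (x n), pairWeight G (reinforcedWeight G a x n) (x n) k

omit [MeasurableSpace V] [DiscreteMeasurableSpace V] [Countable V] in
theorem stepProb_stepRecord (a : G.edgeSet → ℝ) (n : ℕ) (x : ℕ → V) (j : V) :
    stepProb G a n (stepRecord i₀ n x) j = stepProb G a n x j := by
  have h1 : stepRecord i₀ n x n = x n := stepRecord_apply i₀ x le_rfl
  have h2 : reinforcedWeight G a (stepRecord i₀ n x) n = reinforcedWeight G a x n := by
    funext e
    rw [reinforcedWeight_eq_add_crossings, reinforcedWeight_eq_add_crossings,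
      crossings_congr fun k hk => stepRecord_apply i₀ x hk]
  rw [stepProb, stepProb, h2, h1]

theorem measurable_stepProb (a : G.edgeSet → ℝ) (n : ℕ) (j : V) :
    Measurable fun x => stepProb G a n x j := by
  have h1 : ∀ y k, Measurable fun x : ℕ → V => pairWeight G (reinforcedWeight G a x n) y k := by
    intro y k
    unfold pairWeight
    split_ifs
    · simp only [reinforcedWeight_eq_add_crossings]
      exact (measurable_crossings _ n).const_add _
    · exact measurable_const
  exact measurable_of_countable_selector (e := fun x : ℕ → V => x n)
    (f := fun y x => pairWeight G (reinforcedWeight G a x n) y j /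
      ∑ k ∈ G.neighborFinset y, pairWeight G (reinforcedWeight G a x n) y k)
    (measurableSet_apply_eq n) fun y =>
    (h1 y j).div (Finset.measurable_sum _ fun k _ => h1 y k)

theorem IsERRW.hasStepLaw {a : G.edgeSet → ℝ} {Ω : Type*} [MeasurableSpace Ω] {P : Measure Ω}
    [IsProbabilityMeasure P] {X : ℕ → Ω → V} (h : IsERRW G a i₀ P X) :
    HasStepLaw i₀ (stepProb G a) (P.map fun ω n => X n ω) := by
  have hX : Measurable fun ω n => X n ω := measurable_pi_lambda _ h.measurable
  have hrec := measurable_stepRecord (V := V) i₀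
  refine ⟨(ae_map_iff hX.aemeasurable (measurableSet_apply_eq 0 i₀)).2 h.start, fun n j A hA => ?_⟩
  have hle : chainPast X n ≤ ‹MeasurableSpace Ω› :=
    Measurable.comap_le (measurable_pi_lambda _ fun k => h.measurable k)
  have hpast : Measurable[chainPast X n] fun ω => stepRecord i₀ n fun k => X k ω := by
    refine @measurable_pi_lambda _ _ _ (chainPast X n) _ _ fun k => ?_
    unfold stepRecord
    split_ifs with hk
    · exact (measurable_pi_apply (X := fun _ : Fin (n + 1) => V) ⟨k, by omega⟩).comp
        (comap_measurable fun ω (k : Fin (n + 1)) => X k ω)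
    · exact measurable_const
  have hA' : MeasurableSet {x : ℕ → V | stepRecord i₀ n x ∈ A} := hrec n hA
  have hj : MeasurableSet {x : ℕ → V | x (n + 1) = j} := measurableSet_apply_eq (n + 1) j
  have hA'' : MeasurableSet {x : ℕ → V | stepRecord i₀ n x ∈ A ∧ x (n + 1) = j} := hA'.inter hj
  have hp : Measurable fun x => ENNReal.ofReal (stepProb G a n (stepRecord i₀ n x) j) :=
    ((measurable_stepProb G a n j).comp (hrec n)).ennreal_ofReal
  rw [Measure.map_apply hX hA'', setLIntegral_map hA' hp hX]
  simp only [stepProb_stepRecord]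
  exact measure_inter_eq_of_condExp_ae_eq hle (h.measurable (n + 1)
    (MeasurableSet.of_discrete (s := {j}))) (h.step n j) (hpast hA)

/-- The race that drives the edge-reinforced random walk. -/
abbrev edgeReinforcedRace : RaceScheme G.edgeSet ((G.edgeSet → ℝ) × (ℕ → V × ℝ)) :=
  edgeRace hdeg (edgeReinforcedSpeed G) (measurable_edgeReinforcedSpeed G)

theorem edgeReinforcedRace_speed {a : G.edgeSet → ℝ} (ha : ∀ e, 0 < a e) {n : ℕ} {z : ℕ → V × ℝ}
    {e : G.edgeSet} (he : (z n).1 ∈ (e : Sym2 V)) :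
    (edgeReinforcedRace G hdeg).speed n (a, jumpRecord i₀ n z) e =
      a e + crossings (fun k => (z k).1) e n := by
  have h2 : edgeReinforcedSpeed G n (a, jumpRecord i₀ n z) e =
      a e + crossings (fun k => (z k).1) e n := by
    rw [edgeReinforcedSpeed, crossings_congr fun k hk => jumpRecord_apply_fst i₀ z hk]
  rw [← h2]
  refine edgeRace_speed_of_mem hdeg _ _ ?_ ?_
  · rwa [jumpRecord_apply_fst i₀ z le_rfl]
  · rw [h2]
    have := ha e
    positivity

theorem jumpProb_edgeReinforced {a : G.edgeSet → ℝ} (ha : ∀ e, 0 < a e) (n : ℕ) (z : ℕ → V × ℝ)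
    (j : V) : jumpProb hdeg (edgeReinforcedSpeed G) (measurable_edgeReinforcedSpeed G) n
      (a, jumpRecord i₀ n z) j 0 = stepProb G a n (fun k => (z k).1) j := by
  have h1 : (jumpRecord i₀ n z n).1 = (z n).1 := jumpRecord_apply_fst i₀ z le_rfl
  have h2 : ∀ y, pairWeight G ((edgeReinforcedRace G hdeg).speed n (a, jumpRecord i₀ n z)) (z n).1 y =
      pairWeight G (reinforcedWeight G a (fun k => (z k).1) n) (z n).1 y := by
    intro y
    by_cases hadj : G.Adj (z n).1 y
    · rw [pairWeight_of_eq G (e := ⟨s((z n).1, y), G.mem_edgeSet.2 hadj⟩) rfl,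
        pairWeight_of_eq G (e := ⟨s((z n).1, y), G.mem_edgeSet.2 hadj⟩) rfl,
        edgeReinforcedRace_speed G hdeg i₀ ha (Sym2.mem_mk_left _ _),
        reinforcedWeight_eq_add_crossings]
    · simp [pairWeight, hadj]
  rw [jumpProb, edgeRace_totalSpeed, mul_zero, Real.exp_zero, mul_one, stepProb]
  dsimp only
  rw [h1, h2]
  congr 1
  exact Finset.sum_congr rfl fun y _ => h2 y

variable [Nonempty G.edgeSet]

/-- The walk of the race that drives the edge-reinforced random walk. -/
abbrev edgeReinforcedWalk : (G.edgeSet → ℝ) × (G.edgeSet × ℕ → ℝ) → ℕ → V × ℝ :=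
  raceWalk hdeg (edgeReinforcedSpeed G) (measurable_edgeReinforcedSpeed G) i₀

/-- The positions of the race walk form an ERRW: in its jump law take `s = 0`, where the exponential
factor is one, and drop the almost sure condition that the holding time is positive. -/
theorem hasStepLaw_edgeReinforcedWalk {a : G.edgeSet → ℝ} (ha : ∀ e, 0 < a e) :
    HasStepLaw i₀ (stepProb G a) ((expField (G.edgeSet × ℕ)).map fun σ n =>
      (edgeReinforcedWalk G hdeg i₀ (a, σ) n).1) := by
  have hw : Measurable fun σ => edgeReinforcedWalk G hdeg i₀ (a, σ) :=
    (measurable_raceWalk hdeg _ _ i₀).comp measurable_prodMk_left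
  have hf : Measurable fun (z : ℕ → V × ℝ) (n : ℕ) => (z n).1 :=
    measurable_pi_lambda _ fun n => by fun_prop
  have hmap : ((expField (G.edgeSet × ℕ)).map fun σ n => (edgeReinforcedWalk G hdeg i₀ (a, σ) n).1) =
      ((expField (G.edgeSet × ℕ)).map fun σ => edgeReinforcedWalk G hdeg i₀ (a, σ)).map
        fun z n => (z n).1 := (Measure.map_map hf hw).symm
  have hlaw := hasJumpLaw_raceWalk hdeg (edgeReinforcedSpeed G) (measurable_edgeReinforcedSpeed G) i₀ a
  have hQ : IsProbabilityMeasure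
      ((expField (G.edgeSet × ℕ)).map fun σ => edgeReinforcedWalk G hdeg i₀ (a, σ)) :=
    Measure.isProbabilityMeasure_map hw.aemeasurable
  have hpos := hlaw.ae_pos (fun n j s => (measurable_jumpProb hdeg (edgeReinforcedSpeed G)
    (measurable_edgeReinforcedSpeed G) n j s).comp (measurable_prodMk_left (x := a)))
    fun n z => tsum_jumpProb hdeg _ _ n (a, z)
  have hrec := measurable_stepRecord (V := V) i₀
  rw [hmap]
  refine ⟨(ae_map_iff hf.aemeasurable (measurableSet_apply_eq 0 i₀)).2 hlaw.start, fun n j A hA => ?_⟩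
  have hA' : MeasurableSet {x : ℕ → V | stepRecord i₀ n x ∈ A} := hrec n hA
  have hj : MeasurableSet {x : ℕ → V | x (n + 1) = j} := measurableSet_apply_eq (n + 1) j
  have hA'' : MeasurableSet {x : ℕ → V | stepRecord i₀ n x ∈ A ∧ x (n + 1) = j} := hA'.inter hj
  have hp : Measurable fun x => ENNReal.ofReal (stepProb G a n (stepRecord i₀ n x) j) :=
    ((measurable_stepProb G a n j).comp (hrec n)).ennreal_ofReal
  have h := hlaw.jump n j 0 le_rfl _ (hf hA')
  have hsr : ∀ z : ℕ → V × ℝ, stepRecord i₀ n (fun k => (jumpRecord i₀ n z k).1) =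
      stepRecord i₀ n fun k => (z k).1 := fun z => by
    funext k
    by_cases hk : k ≤ n
    · rw [stepRecord_apply i₀ _ hk, stepRecord_apply i₀ _ hk, jumpRecord_apply_fst i₀ z hk]
    · simp [stepRecord, hk]
  rw [Measure.map_apply hf hA'', setLIntegral_map hA' hp hf]
  simp only [stepProb_stepRecord]
  simp only [Set.mem_preimage, Set.mem_ofPred_eq, hsr, jumpProb_edgeReinforced G hdeg i₀ ha] at h
  refine (measure_congr ?_).trans h
  filter_upwards [hpos] with z hz
  exact propext (and_congr_right fun _ => ⟨fun h => ⟨hz n, h⟩, fun h => h.2⟩)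

theorem ae_isAlarmRace_edgeReinforcedWalk {a : G.edgeSet → ℝ} (ha : ∀ e, 0 < a e) :
    ∀ᵐ σ ∂expField (G.edgeSet × ℕ), IsAlarmRace (fun e => alarmTime (a e) fun k => σ (e, k))
      (fun n => (edgeReinforcedWalk G hdeg i₀ (a, σ) n).1)
      fun n => (edgeReinforcedWalk G hdeg i₀ (a, σ) n).2 := by
  have h := ae_raceState_good hdeg (edgeReinforcedSpeed G) (measurable_edgeReinforcedSpeed G) i₀
    (Measure.dirac a)
  rw [Measure.dirac_prod] at h
  filter_upwards [ae_of_ae_map measurable_prodMk_left.aemeasurable h] with σ hσ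
  refine (isEdgeRace_raceWalk hdeg _ _ i₀ hσ).isAlarmRace_of_crossings ha (fun n e he => ?_)
    fun n e he => ?_
  · exact edgeReinforcedRace_speed G hdeg i₀ ha he
  · refine edgeRace_speed_of_notMem hdeg _ _ ?_
    rwa [jumpRecord_apply_fst i₀ _ le_rfl]

end EdgeReinforced

/-! ### Coupling the two processes through common alarms -/

section Coupling

variable {V : Type*} [MeasurableSpace V] [DiscreteMeasurableSpace V] [Countable V] (G : SimpleGraph V)
    [G.LocallyFinite] [Nonempty G.edgeSet] (hdeg : ∀ x, ∃ y, G.Adj x y) (i₀ : V)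
    {a : G.edgeSet → ℝ}

/-- If `p` consists of conductances and Poisson waiting times, the birth-process increments built
from `p` are `logIncrements a p`. Thus the time-changed VRJP driven by `p` obeys the alarms of an
ERRW driven by these increments. -/
theorem ae_isAlarmRace_vertexReinforcedWalk (ha : ∀ e, 0 < a e) :
    ∀ᵐ p ∂(gammaConductances a).prod (expField (G.edgeSet × ℕ)),
      (∀ n, 0 < (vertexReinforcedWalk G hdeg i₀ p n).2) ∧
      IsAlarmRace (fun e => alarmTime (a e) fun k => logIncrements a p (e, k))
        (fun n => (vertexReinforcedWalk G hdeg i₀ p n).1)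
        (logHolding (fun n => (vertexReinforcedWalk G hdeg i₀ p n).1)
          fun n => (vertexReinforcedWalk G hdeg i₀ p n).2) := by
  have := isProbabilityMeasure_gammaConductances ha
  filter_upwards [ae_raceState_good hdeg (vertexReinforcedSpeed G) (measurable_vertexReinforcedSpeed G)
    i₀ (gammaConductances a), ae_poissonClocks_logIncrements ha] with p hp hp'
  have hrace := isEdgeRace_raceWalk hdeg _ _ i₀ hp
  have hpos : ∀ n, 0 < (vertexReinforcedWalk G hdeg i₀ p n).2 := fun n => by
    obtain ⟨e, -, h, -⟩ := hrace n
    exact h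
  refine ⟨hpos, hrace.isAlarmRace_of_occupation hp'.1 (fun n e y he => ?_) (fun n e he => ?_)
    fun e k => ?_⟩
  · exact vertexReinforcedRace_speed G hdeg i₀ hp'.1 (fun k _ => hpos k) he
  · refine edgeRace_speed_of_notMem hdeg _ _ ?_
    rwa [jumpRecord_apply_fst i₀ _ le_rfl]
  · exact exp_alarmTime_logIncrement (ha e) (hp'.1 e) (fun l => hp'.2.1 (e, l)) k

theorem map_vertexReinforcedWalk (ha : ∀ e, 0 < a e) :
    ((gammaConductances a).prod (expField (G.edgeSet × ℕ))).map
        (fun p => (p.1, vertexReinforcedWalk G hdeg i₀ p)) =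
      gammaConductances a ⊗ₘ vertexReinforcedKernel G hdeg i₀ := by
  have := isProbabilityMeasure_gammaConductances ha
  have hw : Measurable (vertexReinforcedWalk G hdeg i₀) := measurable_raceWalk hdeg _ _ i₀
  refine Measure.ext_of_lintegral _ fun f hf => ?_
  have hf1 : Measurable fun p : (G.edgeSet → ℝ) × (G.edgeSet × ℕ → ℝ) =>
    (p.1, vertexReinforcedWalk G hdeg i₀ p) := measurable_fst.prodMk hw
  have hf2 : Measurable fun p : (G.edgeSet → ℝ) × (G.edgeSet × ℕ → ℝ) =>
    f (p.1, vertexReinforcedWalk G hdeg i₀ p) := hf.comp hf1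
  rw [lintegral_map hf hf1, lintegral_prod _ hf2.aemeasurable, Measure.lintegral_compProd hf]
  refine lintegral_congr fun w => ?_
  have hf3 : Measurable fun z => f (w, z) := hf.comp measurable_prodMk_left
  have hw' : Measurable fun σ => vertexReinforcedWalk G hdeg i₀ (w, σ) :=
    hw.comp measurable_prodMk_left
  rw [vertexReinforcedKernel_apply, lintegral_map hf3 hw']

theorem IsVRJPKernel.compProd_eq (ha : ∀ e, 0 < a e) {κ : Kernel (G.edgeSet → ℝ) (ℕ → V × ℝ)}
    (hκ : IsVRJPKernel G i₀ κ) :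
    gammaConductances a ⊗ₘ κ = gammaConductances a ⊗ₘ vertexReinforcedKernel G hdeg i₀ := by
  have := isProbabilityMeasure_gammaConductances ha
  have := hκ.1
  refine Measure.compProd_congr ?_
  filter_upwards [gammaConductances_ae_pos ha] with w hw
  exact hκ.apply_eq G hdeg i₀ hw

/-- Drive the ERRW race by `logIncrements a p` and the VRJP race by `p`. After the time change both
walks obey the same alarms and start at `i₀`, so their positions agree; the time change does not
alter the skeleton. -/
theorem map_skeleton_vertexReinforced (ha : ∀ e, 0 < a e) {κ : Kernel (G.edgeSet → ℝ) (ℕ → V × ℝ)}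
    (hκ : IsVRJPKernel G i₀ κ) :
    ((gammaConductances a).bind κ).map (fun z n => (z n).1) =
      (expField (G.edgeSet × ℕ)).map fun σ n => (edgeReinforcedWalk G hdeg i₀ (a, σ) n).1 := by
  have := isProbabilityMeasure_gammaConductances ha
  have := hκ.1
  have hw : Measurable (vertexReinforcedWalk G hdeg i₀) := measurable_raceWalk hdeg _ _ i₀
  have hf : Measurable fun (z : ℕ → V × ℝ) (n : ℕ) => (z n).1 :=
    measurable_pi_lambda _ fun n => by fun_prop
  have hr : Measurable fun (σ : G.edgeSet × ℕ → ℝ) (n : ℕ) =>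
      (edgeReinforcedWalk G hdeg i₀ (a, σ) n).1 :=
    hf.comp ((measurable_raceWalk hdeg _ _ i₀).comp measurable_prodMk_left)
  have h1 : (gammaConductances a).bind κ =
      ((gammaConductances a).prod (expField (G.edgeSet × ℕ))).map (vertexReinforcedWalk G hdeg i₀) := by
    rw [← Measure.snd_compProd, hκ.compProd_eq G hdeg i₀ ha, ← map_vertexReinforcedWalk G hdeg i₀ ha,
      Measure.snd, Measure.map_map measurable_snd (measurable_fst.prodMk hw)]
    rfl
  rw [h1, Measure.map_map hf hw]
  -- Put both walks on the space of conductances and waiting times, where almost sure equality is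
  -- enough.
  conv_rhs => rw [← map_logIncrements ha, Measure.map_map hr (measurable_logIncrements a)]
  refine Measure.map_congr ?_
  have h2 := ae_isAlarmRace_edgeReinforcedWalk G hdeg i₀ ha
  rw [← map_logIncrements ha] at h2
  filter_upwards [ae_isAlarmRace_vertexReinforcedWalk G hdeg i₀ ha,
    ae_of_ae_map (measurable_logIncrements a).aemeasurable h2] with p hp hp'
  exact (hp.2.unique hp' rfl).1

omit [G.LocallyFinite] [Nonempty G.edgeSet] in
theorem jumpPath_eq_timeChangedPath {ξ : ℕ → V} {S : ℕ → ℝ} {τ : G.edgeSet × ℕ → ℝ} {z : ℕ → V × ℝ}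
    (ha : ∀ e, 0 < a e) (hτ : ∀ k, 0 < τ k) (h : FollowsAlarms G a (fun e k => τ (e, k)) ξ S)
    (hz : ∀ n, 0 < (z n).2) (hrace : IsAlarmRace (fun e => alarmTime (a e) fun k => τ (e, k))
      (fun n => (z n).1) (logHolding (fun n => (z n).1) fun n => (z n).2)) (h0 : ξ 0 = (z 0).1) :
    (fun t : ℝ≥0 => jumpPath ξ S t) = timeChangedPath z := by
  obtain ⟨rfl, rfl⟩ := IsAlarmRace.eq_of_followsAlarms h hrace
    (fun e => strictMono_alarmTime (ha e) fun k => hτ (e, k)) h0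
  funext t
  exact (timeChange_jumpPath _ hz t.2).symm

/-- The continuous-time edge-reinforced random walk is a mixture of time-changed vertex-reinforced jump
processes, with conductances that are functions of the alarms. -/
theorem IsContinuousTimeERRW.exists_conductances (hdeg : ∀ x, ∃ y, G.Adj x y)
    (ha : ∀ e, 0 < a e) {Ω : Type*} [MeasurableSpace Ω] {P : Measure Ω} [IsProbabilityMeasure P]
    {τ : G.edgeSet → ℕ → Ω → ℝ} {ξ : ℕ → Ω → V}
    {S : ℕ → Ω → ℝ} (h : IsContinuousTimeERRW G a i₀ P τ ξ S) :
    ∃ W : G.edgeSet → Ω → ℝ, (∀ e, Measurable (W e)) ∧ iIndepFun W P ∧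
      (∀ e, HasLaw (W e) (gammaMeasure (a e) 1) P) ∧
      ∀ κ : Kernel (G.edgeSet → ℝ) (ℕ → V × ℝ), IsVRJPKernel G i₀ κ →
        HasCondDistrib (fun ω (t : ℝ≥0) => jumpPath (fun n => ξ n ω) (fun n => S n ω) (t : ℝ))
          (fun ω e => W e ω) (κ.map timeChangedPath) P := by
  have := isProbabilityMeasure_gammaConductances ha
  have hgamma := fun e => isProbabilityMeasure_gammaMeasure (ha e) one_pos
  set T : Ω → G.edgeSet × ℕ → ℝ := fun ω k => τ k.1 k.2 ω with hT
  have hTm : Measurable T := measurable_pi_lambda _ fun k => h.measurable_alarm k.1 k.2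
  have hTlaw : P.map T = expField (G.edgeSet × ℕ) :=
    (h.indep_alarm.hasLaw_infinitePi (fun k : G.edgeSet × ℕ => h.law_alarm k.1 k.2) hTm.aemeasurable).map_eq
  have hcm := measurable_poissonClocks a
  -- The conductances are read off the given alarms as limits of `n * exp (-V_n)`, so no enlargement
  -- of the probability space is needed. The second component holds the Poisson waiting times,
  -- independent of them.
  set C : Ω → (G.edgeSet → ℝ) × (G.edgeSet × ℕ → ℝ) := fun ω => poissonClocks a (T ω) with hC
  have hCm : Measurable C := hcm.comp hTm
  have hClaw : P.map C = (gammaConductances a).prod (expField (G.edgeSet × ℕ)) := by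
    rw [← map_poissonClocks ha, ← hTlaw, Measure.map_map hcm hTm]
    rfl
  have hWm : Measurable fun ω => (C ω).1 := measurable_fst.comp hCm
  have hWlaw : P.map (fun ω => (C ω).1) = gammaConductances a := by
    have h1 : (P.map C).map Prod.fst = P.map fun ω => (C ω).1 := Measure.map_map measurable_fst hCm
    rw [← h1, hClaw, Measure.map_fst_prod, measure_univ, one_smul]
  have hWe : ∀ e, Measurable fun ω => (C ω).1 e := fun e => (measurable_pi_apply e).comp hWm
  have hWelaw : ∀ e, P.map (fun ω => (C ω).1 e) = gammaMeasure (a e) 1 := by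
    intro e
    have h1 : (P.map fun ω => (C ω).1).map (fun w => w e) = P.map fun ω => (C ω).1 e :=
      Measure.map_map (measurable_pi_apply e) hWm
    rw [← h1, hWlaw, gammaConductances, Measure.infinitePi_map_eval]
  refine ⟨fun e ω => (C ω).1 e, hWe, ?_, fun e => ⟨(hWe e).aemeasurable, hWelaw e⟩, fun κ hκ => ?_⟩
  · rw [iIndepFun_iff_map_fun_eq_infinitePi_map hWe]
    simp only [hWelaw]
    exact hWlaw
  have := hκ.1
  have hw : Measurable (vertexReinforcedWalk G hdeg i₀) := measurable_raceWalk hdeg _ _ i₀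
  have hcond : HasCondDistrib (fun ω => vertexReinforcedWalk G hdeg i₀ (C ω)) (fun ω => (C ω).1) κ P := by
    refine ⟨(hWm.prodMk (hw.comp hCm)).aemeasurable, ?_⟩
    have h1 : (P.map C).map (fun p => (p.1, vertexReinforcedWalk G hdeg i₀ p)) =
        P.map fun ω => ((C ω).1, vertexReinforcedWalk G hdeg i₀ (C ω)) :=
      Measure.map_map (measurable_fst.prodMk hw) hCm
    rw [← h1, hClaw, hWlaw, map_vertexReinforcedWalk G hdeg i₀ ha, hκ.compProd_eq G hdeg i₀ ha]
  -- Almost surely `logIncrements a (C ω)` is the original family of alarm variables. The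
  -- time-changed VRJP driven by `C ω` then obeys the alarms that drive the given ERRW, hence is the
  -- same path.
  have hpath : ∀ᵐ ω ∂P, (fun t : ℝ≥0 => jumpPath (fun n => ξ n ω) (fun n => S n ω) (t : ℝ)) =
      timeChangedPath (vertexReinforcedWalk G hdeg i₀ (C ω)) := by
    have h1 := ae_logIncrements_poissonClocks ha
    have h2 : ∀ᵐ σ ∂expField (G.edgeSet × ℕ), ∀ k, 0 < σ k := expField_ae_pos
    have h3 := ae_isAlarmRace_vertexReinforcedWalk G hdeg i₀ ha
    rw [← hTlaw] at h1 h2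
    rw [← hClaw] at h3
    filter_upwards [ae_of_ae_map hTm.aemeasurable h1, ae_of_ae_map hTm.aemeasurable h2,
      ae_of_ae_map hCm.aemeasurable h3, h.start, h.dynamics] with ω e1 e2 e3 e4 e5
    have e6 : logIncrements a (C ω) = T ω := e1
    rw [e6] at e3
    exact jumpPath_eq_timeChangedPath G ha e2 e5 e3.1 e3.2 (e4.trans rfl)
  exact HasLaw.congr (hcond.comp_left measurable_timeChangedPath)
    (hpath.mono fun ω hω => Prod.ext rfl hω)

end Coupling

end

/-! ### The theorem -/

theorem theorem1 {V : Type*} [Nontrivial V] [MeasurableSpace V] [DiscreteMeasurableSpace V]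
    (G : SimpleGraph V) [G.LocallyFinite] (hG : G.Connected)
    (a : G.edgeSet → ℝ) (ha : ∀ e, 0 < a e) (i₀ : V) :
    -- the law of the VRJP exists, as a measurable function of its weights
    (∃ κ : Kernel (G.edgeSet → ℝ) (ℕ → V × ℝ), IsVRJPKernel G i₀ κ) ∧
    -- the time modification is a measurable function of the path
    Measurable (timeChangedPath : (ℕ → V × ℝ) → (ℝ≥0 → Option V)) ∧
    -- the continuous-time ERRW, conditionally on suitable independent Gamma variables
    (∀ {Ω : Type*} [MeasurableSpace Ω] (P : Measure Ω) [IsProbabilityMeasure P]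
      (τ : G.edgeSet → ℕ → Ω → ℝ) (ξ : ℕ → Ω → V) (S : ℕ → Ω → ℝ),
      IsContinuousTimeERRW G a i₀ P τ ξ S →
      ∃ W : G.edgeSet → Ω → ℝ, (∀ e, Measurable (W e)) ∧ iIndepFun W P ∧
        (∀ e, HasLaw (W e) (gammaMeasure (a e) 1) P) ∧
        ∀ κ : Kernel (G.edgeSet → ℝ) (ℕ → V × ℝ), IsVRJPKernel G i₀ κ →
          HasCondDistrib
            (fun ω (t : ℝ≥0) => jumpPath (fun n => ξ n ω) (fun n => S n ω) (t : ℝ))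
            (fun ω e => W e ω)
            (κ.map timeChangedPath) P) ∧
    -- the discrete ERRW and the discrete skeleton of the VRJP in Gamma conductances
    (∀ {Ω : Type*} [MeasurableSpace Ω] (P : Measure Ω) [IsProbabilityMeasure P] (X : ℕ → Ω → V),
      IsERRW G a i₀ P X →
      ∀ κ : Kernel (G.edgeSet → ℝ) (ℕ → V × ℝ), IsVRJPKernel G i₀ κ →
        P.map (fun ω n => X n ω) =
          ((gammaConductances a).bind κ).map (fun z n => (z n).1)) := by
  have : Countable V := hG.countable
  have hdeg : ∀ x, ∃ y, G.Adj x y := fun x => by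
    obtain ⟨y, hy⟩ := exists_ne x
    obtain ⟨p⟩ := hG.preconnected x y
    cases p with
    | nil => exact absurd rfl hy
    | cons hadj _ => exact ⟨_, hadj⟩
  have : Nonempty G.edgeSet := by
    obtain ⟨y, hy⟩ := hdeg i₀
    exact ⟨⟨s(i₀, y), G.mem_edgeSet.2 hy⟩⟩
  refine ⟨⟨_, isVRJPKernel_vertexReinforcedKernel G hdeg i₀⟩, measurable_timeChangedPath,
    fun P _ τ ξ S h => h.exists_conductances G i₀ hdeg ha, fun P _ X h κ hκ => ?_⟩
  -- The skeleton is now the race realisation of the ERRW, and it remains to compare two laws with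
  -- the same transition probabilities.
  rw [map_skeleton_vertexReinforced G hdeg i₀ ha hκ]
  have hX : Measurable fun ω n => X n ω := measurable_pi_lambda _ h.measurable
  have := Measure.isProbabilityMeasure_map (μ := P) hX.aemeasurable
  have hr : Measurable fun (σ : G.edgeSet × ℕ → ℝ) (n : ℕ) =>
      (edgeReinforcedWalk G hdeg i₀ (a, σ) n).1 :=
    measurable_pi_lambda _ fun n => ((measurable_pi_apply n).comp
      ((measurable_raceWalk hdeg _ _ i₀).comp measurable_prodMk_left)).fst
  have := Measure.isProbabilityMeasure_map (μ := expField (G.edgeSet × ℕ)) hr.aemeasurable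
  exact (h.hasStepLaw G i₀).unique (hasStepLaw_edgeReinforcedWalk G hdeg i₀ ha)
    (measurable_stepProb G a)
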